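/- Let $Q$ be a smooth $n$-dimensional manifold with tangent bundle $\tau_Q\colon TQ\to Q$, let $L\colon TQ\to\mathbb R$ be a function of class $C^2$ (the Lagrangian), and let $C\subset TQ$ be a submanifold (of class $C^2$) of codimension $m<n$; that is, near each of its points $C$ is the zero set of $m$ constraints $\phi^1,\dots,\phi^m$ (functions of class $C^2$) whose differentials are linearly independent at the points of $C$. Such constraints, with the open set $U\subset TQ$ on which they are given, are called a local system of constraints for $C$. Assume that the projection $\tau_Q|_C\colon C\to Q$ is a submersion. Let $I=[t_1,t_2]$ with $t_1<t_2$, and $q_1,q_2\in Q$. An admissible path is a $C^2$ path $\gamma\colon I\to Q$ with $\gamma(t_1)=q_1$, $\gamma(t_2)=q_2$ and $\dot\gamma(t)\in C$ for all $t\in I$. An admissible variation field of $\gamma$ is a $C^1$ vector field $\mathbf w$ along $\gamma$ with $\mathbf w(t_1)=0$, $\mathbf w(t_2)=0$ and $s(\dot{\mathbf w}(t))\in T_{\dot\gamma(t)}C$ for all $t\in I$, where $s\colon T(TQ)\to T(TQ)$ is the canonical involution, $s(q,v;u,a)=(q,u;v,a)$ in local coordinates. The path $\gamma$ is critical if $$\frac{d}{d\varepsilon}\Big|_{\varepsilon=0}\int_I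 L(\dot\Gamma_\varepsilon(t))\,dt=0$$ for every $C^2$ variation $\Gamma\colon(-\delta,\delta)\times I\to Q$ of $\gamma$ with fixed end-points whose variation field $\mathbf w(t)=\partial_\varepsilon\Gamma(0,t)$ is an admissible variation field. The Euler–Lagrange operator $\mathcal E_F$ of a (possibly time-dependent) function $F$ on $TQ$ is defined by $$\langle\mathcal E_F\circ\ddot\gamma,\mathbf w\rangle=\langle dF\circ\dot\gamma,\,s\circ\dot{\mathbf w}\rangle-\frac{d}{dt}\langle\mathcal DF\circ\dot\gamma,\mathbf w\rangle$$ for all $C^1$ vector fields $\mathbf w$ along $\gamma$, where $\mathcal DF\colon TQ\to T^*Q$ is the fibre derivative. Theorem. Let $\gamma$ be an admissible path. (1) Let $\phi^1,\dots,\phi^m$ be a system of constraints for $C$ on an open set that contains $\dot\gamma(I)$. Then $\gamma$ is critical if and only if there exist $C^1$ functions $\mu_1,\dots,\mu_m\colon I\to\mathbb R$ such that $$\mathcal E_{L+\sum_{i=1}^m\mu_i\phi^i}\circ\ddot\gamma=0 .$$ (2) More generally, let $(U_c,\phi_c^1,\dots,\phi_c^m)_c$ be any family of local systems of constraints for $C$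 whose domains $U_c$ cover $\dot\gamma(I)$, and put $I_c=\{t\in I:\dot\gamma(t)\in U_c\}$. Then $\gamma$ is critical if and only if there exist $C^1$ functions $\mu_{c,i}\colon I_c\to\mathbb R$ such that, for all $c,c'$, $$\sum_i\mu_{c,i}(t)\,d\phi_c^i(\dot\gamma(t))=\sum_i\mu_{c',i}(t)\,d\phi_{c'}^i(\dot\gamma(t))\quad(t\in I_c\cap I_{c'}),\qquad \mathcal E_{L+\sum_i\mu_{c,i}\phi_c^i}\circ\ddot\gamma=0\ \text{ on } I_c .$$ (3) There is a $C^1$ frame $(\mathbf w_1,\dots,\mathbf w_n)$ of $\gamma^*TQ$ such that the vertical lifts $\mathrm{vl}(\dot\gamma,\mathbf w_l)$, $l=m+1,\dots,n$, are tangent to $C$. For every such frame there are continuous functions $K^j_{\,l}\colon I\to\mathbb R$ ($1\le j\le m<l\le n$) such that, for all $C^1$ functions $\lambda^{m+1},\dots,\lambda^n$ on $I$ that vanish at $t_1$ and $t_2$, there exist $C^1$ functions $\lambda^1,\dots,\lambda^m$ for which $\sum_{k=1}^n\lambda^k\mathbf w_k$ is an admissible variation field if and only if $$\int_{t_1}^{t_2}\sum_{l=m+1}^nK^j_{\,l}(t)\,\lambda^l(t)\,dt=0\quad\text{for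 } j=1,\dots,m .$$ Thus admissible variation fields exist: their free components $\lambda^l$ are subject only to $m$ linear conditions. -/

import Mathlib

open Set MeasureTheory
open scoped Manifold ContDiff

noncomputable section

namespace Vakonomic

/-- The coordinate space of an `n`-dimensional manifold. -/
abbrev E (n : ℕ) : Type := EuclideanSpace ℝ (Fin n)

section Basic

variable {n : ℕ} {Q : Type*} [TopologicalSpace Q] [ChartedSpace (E n) Q]

/-- The tangent vector `γ'(t)`, as a point of the tangent bundle, of a path `γ` with values in a
manifold `M` and defined on the interval `I = [t₁, t₂]` (one-sided at the end-points). -/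
def velocity {F : Type*} [NormedAddCommGroup F] [NormedSpace ℝ F] {H : Type*} [TopologicalSpace H]
    (J : ModelWithCorners ℝ F H) {M : Type*} [TopologicalSpace M] [ChartedSpace H M]
    (t₁ t₂ : ℝ) (γ : ℝ → M) (t : ℝ) : TangentBundle J M :=
  ⟨γ t, mfderivWithin 𝓘(ℝ, ℝ) J γ (Icc t₁ t₂) t (1 : ℝ)⟩

variable [IsManifold (𝓡 n) ∞ Q]

/-- The lift `γ̇ : I → TQ` of a path `γ : I → Q`. -/
abbrev dot (t₁ t₂ : ℝ) (γ : ℝ → Q) : ℝ → TangentBundle (𝓡 n) Q := velocity (𝓡 n) t₁ t₂ γ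

/-- The canonical involution `s : T(TQ) → T(TQ)`, with local expression
`s (q, v; u, a) = (q, u; v, a)`.  In Mathlib the tangent space to `Q` at `q` is the coordinate space
`E n`, identified through the preferred chart at `q`, and the tangent space to `TQ` at `(q, v)` is
`E n × E n`, identified through the natural chart of `TQ` induced by the preferred chart at `q`;
so the formula below is the local expression in this natural chart. -/
def canonicalInvolution (ξ : TangentBundle (𝓡 n).tangent (TangentBundle (𝓡 n) Q)) :
    TangentBundle (𝓡 n).tangent (TangentBundle (𝓡 n) Q) :=
  let ua : E n × E n := ξ.2
  ⟨⟨ξ.1.1, ua.1⟩, ((ξ.1.2, ua.2) : E n × E n)⟩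

/-- The vertical lift `vl : TQ ×_Q TQ → T(TQ)`, with local expression
`vl (q, v, u) = (q, v; 0, u)`. -/
def verticalLift (v : TangentBundle (𝓡 n) Q) (u : TangentSpace (𝓡 n) v.proj) :
    TangentBundle (𝓡 n).tangent (TangentBundle (𝓡 n) Q) :=
  ⟨v, ((0, u) : E n × E n)⟩

/-- The differential `dF(v) : T_v(TQ) → ℝ` of a function `F` on `TQ`. -/
def differentialAt (F : TangentBundle (𝓡 n) Q → ℝ) (v : TangentBundle (𝓡 n) Q) :
    TangentSpace (𝓡 n).tangent v →L[ℝ] ℝ :=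
  mfderiv (𝓡 n).tangent 𝓘(ℝ, ℝ) F v

/-- The contraction `⟨dF, ξ⟩` of the differential of `F` with a tangent vector `ξ ∈ T(TQ)`. -/
def differential (F : TangentBundle (𝓡 n) Q → ℝ)
    (ξ : TangentBundle (𝓡 n).tangent (TangentBundle (𝓡 n) Q)) : ℝ :=
  differentialAt F ξ.proj ξ.2

/-- The fibre derivative `𝒟F : TQ → T*Q` of a function `F` on `TQ`: the derivative at `v` of the
restriction of `F` to the tangent space that contains `v`. -/
def fibreDerivative (F : TangentBundle (𝓡 n) Q → ℝ) (v : TangentBundle (𝓡 n) Q) :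
    TangentSpace (𝓡 n) v.proj →L[ℝ] ℝ :=
  (fderiv ℝ (fun u : E n => F ⟨v.proj, u⟩) v.2 : E n →L[ℝ] ℝ)

/-- The point of `TQ` given by the value at `t` of a vector field `w` along `γ`. -/
abbrev lift (γ : ℝ → Q) (w : ∀ t : ℝ, TangentSpace (𝓡 n) (γ t)) (t : ℝ) : TangentBundle (𝓡 n) Q :=
  ⟨γ t, w t⟩

/-- `w` is a vector field along `γ : I → Q` of class `C¹`. -/
def IsFieldAlong (t₁ t₂ : ℝ) (γ : ℝ → Q) (w : ∀ t : ℝ, TangentSpace (𝓡 n) (γ t)) : Prop :=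
  ContMDiffOn 𝓘(ℝ, ℝ) (𝓡 n).tangent 1 (lift γ w) (Icc t₁ t₂)

/-- The vector field `s ∘ ẇ` along `γ̇`, where `w` is a vector field along `γ`. -/
def involutionDot (t₁ t₂ : ℝ) (γ : ℝ → Q) (w : ∀ t : ℝ, TangentSpace (𝓡 n) (γ t)) (t : ℝ) :
    TangentBundle (𝓡 n).tangent (TangentBundle (𝓡 n) Q) :=
  canonicalInvolution (velocity (𝓡 n).tangent t₁ t₂ (lift γ w) t)

/-! ### The constraint submanifold -/

/-- `f` is a (local) constraint: a function of class `C²` on the open set `V ⊆ TQ` that vanishes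
on `C ∩ V`. -/
def IsConstraint (C V : Set (TangentBundle (𝓡 n) Q)) (f : TangentBundle (𝓡 n) Q → ℝ) : Prop :=
  IsOpen V ∧ ContMDiffOn (𝓡 n).tangent 𝓘(ℝ, ℝ) 2 f V ∧ ∀ v ∈ C ∩ V, f v = 0

/-- `φ¹, …, φᵐ` is a system of constraints that defines `C` in the open set `U ⊆ TQ`: `C ∩ U` is
their common zero set in `U`, and their differentials are linearly independent at each point
of `C ∩ U`. -/
structure IsConstraintSystem {m : ℕ} (C U : Set (TangentBundle (𝓡 n) Q))
    (φ : Fin m → TangentBundle (𝓡 n) Q → ℝ) : Prop where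
  isOpen : IsOpen U
  contMDiffOn : ∀ i, ContMDiffOn (𝓡 n).tangent 𝓘(ℝ, ℝ) 2 (φ i) U
  mem_iff : ∀ v ∈ U, v ∈ C ↔ ∀ i, φ i v = 0
  linearIndependent : ∀ v ∈ C ∩ U, LinearIndependent ℝ fun i => differentialAt (φ i) v

/-- `C` is a submanifold of `TQ` of codimension `m` (of class `C²`): near each of its points it is
defined by a system of `m` constraints. -/
def IsSubmanifoldOfCodim (m : ℕ) (C : Set (TangentBundle (𝓡 n) Q)) : Prop :=
  ∀ v ∈ C, ∃ (U : Set (TangentBundle (𝓡 n) Q)) (φ : Fin m → TangentBundle (𝓡 n) Q → ℝ),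
    v ∈ U ∧ IsConstraintSystem C U φ

/-- The tangent bundle `T(C) ⊆ T(TQ)` of the submanifold `C`: the vectors based at points of `C`
that are annihilated by the differentials of all the constraints. -/
def tangentSet (C : Set (TangentBundle (𝓡 n) Q)) :
    Set (TangentBundle (𝓡 n).tangent (TangentBundle (𝓡 n) Q)) :=
  {ξ | ξ.proj ∈ C ∧ ∀ V f, ξ.proj ∈ V → IsConstraint C V f → differential f ξ = 0}

/-- The projection `C → Q` is a submersion: at each `v ∈ C` its tangent map
`T_v(C) → T_{τ(v)}Q` is surjective. -/
def ProjectionIsSubmersion (C : Set (TangentBundle (𝓡 n) Q)) : Prop :=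
  ∀ v ∈ C, ∀ u : TangentSpace (𝓡 n) v.proj,
    ∃ ξ : TangentSpace (𝓡 n).tangent v,
      (⟨v, ξ⟩ : TangentBundle (𝓡 n).tangent (TangentBundle (𝓡 n) Q)) ∈ tangentSet C ∧
      mfderiv (𝓡 n).tangent (𝓡 n) (fun x : TangentBundle (𝓡 n) Q => x.proj) v ξ = u

/-! ### Admissible paths, variations and critical paths -/

/-- `γ : [t₁, t₂] → Q` is an admissible path from `q₁` to `q₂`. -/
structure IsAdmissiblePath (C : Set (TangentBundle (𝓡 n) Q)) (t₁ t₂ : ℝ) (q₁ q₂ : Q)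
    (γ : ℝ → Q) : Prop where
  contMDiffOn : ContMDiffOn 𝓘(ℝ, ℝ) (𝓡 n) 2 γ (Icc t₁ t₂)
  left : γ t₁ = q₁
  right : γ t₂ = q₂
  dot_mem : ∀ t ∈ Icc t₁ t₂, dot t₁ t₂ γ t ∈ C

/-- `w` is an admissible variation field of `γ`: a vector field along `γ` of class `C¹` that
vanishes at the end-points and is such that `s ∘ ẇ` is tangent to `C`. -/
structure IsAdmissibleField (C : Set (TangentBundle (𝓡 n) Q)) (t₁ t₂ : ℝ) (γ : ℝ → Q)
    (w : ∀ t : ℝ, TangentSpace (𝓡 n) (γ t)) : Prop where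
  isFieldAlong : IsFieldAlong t₁ t₂ γ w
  left : w t₁ = 0
  right : w t₂ = 0
  tangent : ∀ t ∈ Icc t₁ t₂, involutionDot t₁ t₂ γ w t ∈ tangentSet C

/-- `Γ : (-δ, δ) × [t₁, t₂] → Q` is a variation of `γ`. -/
structure IsVariation (t₁ t₂ : ℝ) (γ : ℝ → Q) (δ : ℝ) (Γ : ℝ → ℝ → Q) : Prop where
  pos : 0 < δ
  contMDiffOn : ContMDiffOn 𝓘(ℝ, ℝ × ℝ) (𝓡 n) 2 (fun p : ℝ × ℝ => Γ p.1 p.2)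
    (Ioo (-δ) δ ×ˢ Icc t₁ t₂)
  left : ∀ ε ∈ Ioo (-δ) δ, Γ ε t₁ = γ t₁
  right : ∀ ε ∈ Ioo (-δ) δ, Γ ε t₂ = γ t₂
  zero : ∀ t ∈ Icc t₁ t₂, Γ 0 t = γ t

/-- `w` is the variation field `Γ'(0, ·)` of the variation `Γ` of `γ`. -/
def IsVariationFieldOf (t₁ t₂ : ℝ) (γ : ℝ → Q) (Γ : ℝ → ℝ → Q)
    (w : ∀ t : ℝ, TangentSpace (𝓡 n) (γ t)) : Prop :=
  ∀ t ∈ Icc t₁ t₂, lift γ w t =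
    (⟨Γ 0 t, mfderiv 𝓘(ℝ, ℝ) (𝓡 n) (fun ε => Γ ε t) 0 (1 : ℝ)⟩ : TangentBundle (𝓡 n) Q)

/-- The action `S[γ]` of the Lagrangian `L`. -/
def action (L : TangentBundle (𝓡 n) Q → ℝ) (t₁ t₂ : ℝ) (γ : ℝ → Q) : ℝ :=
  ∫ t in t₁..t₂, L (dot t₁ t₂ γ t)

/-- `γ` is a critical path of the vakonomic problem: for each variation of `γ` whose variation
field is an admissible variation field, the first variation of the action vanishes. -/
def IsCritical (L : TangentBundle (𝓡 n) Q → ℝ) (C : Set (TangentBundle (𝓡 n) Q)) (t₁ t₂ : ℝ)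
    (γ : ℝ → Q) : Prop :=
  ∀ (δ : ℝ) (Γ : ℝ → ℝ → Q) (w : ∀ t : ℝ, TangentSpace (𝓡 n) (γ t)),
    IsVariation (n := n) t₁ t₂ γ δ Γ → IsVariationFieldOf t₁ t₂ γ Γ w → IsAdmissibleField C t₁ t₂ γ w →
      HasDerivAt (fun ε => action L t₁ t₂ (Γ ε)) 0 0

/-! ### The Euler-Lagrange operator -/

/-- `α = ℰ_F ∘ γ̈` at the times `t ∈ J ⊆ I`, where `ℰ_F` is the Euler-Lagrange operator of the
time-dependent Lagrangian `F`.  It is defined by the relation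
`⟨ℰ_F ∘ γ̈, w⟩ = ⟨dF ∘ γ̇, s ∘ ẇ⟩ - D ⟨𝒟F ∘ γ̇, w⟩` for all `C¹` vector fields `w` along `γ`
(it includes that the derivative with respect to the time exists). -/
def IsEulerLagrange (F : ℝ → TangentBundle (𝓡 n) Q → ℝ) (t₁ t₂ : ℝ) (γ : ℝ → Q) (J : Set ℝ)
    (α : ∀ t : ℝ, TangentSpace (𝓡 n) (γ t) →L[ℝ] ℝ) : Prop :=
  ∀ w : ∀ t : ℝ, TangentSpace (𝓡 n) (γ t), IsFieldAlong t₁ t₂ γ w → ∀ t ∈ J,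
    HasDerivWithinAt (fun τ => fibreDerivative (F τ) (dot t₁ t₂ γ τ) (w τ))
      (differential (F t) (involutionDot t₁ t₂ γ w t) - α t (w t)) (Icc t₁ t₂) t

/-- The extended Lagrangian `L + ∑ᵢ μᵢ φⁱ`, a time-dependent function on `TQ`. -/
def extendedLagrangian {m : ℕ} (L : TangentBundle (𝓡 n) Q → ℝ)
    (φ : Fin m → TangentBundle (𝓡 n) Q → ℝ) (μ : Fin m → ℝ → ℝ) (t : ℝ)
    (v : TangentBundle (𝓡 n) Q) : ℝ :=
  L v + ∑ i, μ i t * φ i v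

/-- The times `t ∈ I` such that `γ̇(t) ∈ U`. -/
def timesIn (t₁ t₂ : ℝ) (γ : ℝ → Q) (U : Set (TangentBundle (𝓡 n) Q)) : Set ℝ :=
  {t | t ∈ Icc t₁ t₂ ∧ dot t₁ t₂ γ t ∈ U}

/-! ### Frames adapted to the constraints -/

/-- `(a₁, …, a_m, b₁, …, b_k)` is a frame of class `C¹` of `γ*TQ` such that the vertical lifts
`vl(γ̇, b_l)` are tangent to `C`. -/
structure IsAdaptedFrame {m k : ℕ} (C : Set (TangentBundle (𝓡 n) Q)) (t₁ t₂ : ℝ) (γ : ℝ → Q)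
    (a : Fin m → ∀ t : ℝ, TangentSpace (𝓡 n) (γ t))
    (b : Fin k → ∀ t : ℝ, TangentSpace (𝓡 n) (γ t)) : Prop where
  isFieldAlong_left : ∀ j, IsFieldAlong t₁ t₂ γ (a j)
  isFieldAlong_right : ∀ l, IsFieldAlong t₁ t₂ γ (b l)
  linearIndependent : ∀ t ∈ Icc t₁ t₂,
    LinearIndependent ℝ (Sum.elim (fun j => a j t) (fun l => b l t))
  span : ∀ t ∈ Icc t₁ t₂,
    Submodule.span ℝ (range (Sum.elim (fun j => a j t) (fun l => b l t))) = ⊤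
  vertical : ∀ l, ∀ t ∈ Icc t₁ t₂, verticalLift (dot t₁ t₂ γ t) (b l t) ∈ tangentSet C

end Basic

end Vakonomic

end

namespace Vakonomic

/-! Along γ choose a C¹ frame (a_j, b_l) in which the b_l span the vertical directions tangent to C.
Since C → Q is a submersion, the constraints have independent fibre derivatives, so their
differentials along γ̇ recombine into covectors β^j with β^j(vl a_k) = δ_jk and β^j(vl b_l) = 0,
which do not depend on the system of constraints used (`exists_adapted_frame`,
`exists_constraintCoframe`). For w = ∑ κ^j a_j + ∑ λ^l b_l the tangency condition β^j(s ẇ) = 0 is a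
linear differential equation κ' = -Nκ - K₀λ with continuous coefficients: λ is free, and κ follows
from its initial value.

If Φ is a fundamental matrix of κ' = -Nκ and Ψ its inverse, then (Ψκ)' = -ΨK₀λ. Hence a solution
with κ = 0 at both ends exists exactly when ∫ ΨK₀λ = 0, which is statement (3) with K = ΨK₀
(`exists_boundary_solution_iff`).

Every C¹ field along γ that vanishes at the ends is the variation field of a C² variation with fixed
ends (`exists_variation`), so γ is critical if and only if ∫ dL(s ẇ) = 0 for all admissible w
(`isCritical_iff`). Let ν₀ solve the Euler-Lagrange equations in the directions a_j, a linear
equation for the multipliers. Integration by parts then removes κ and leaves ∫ hλ, which has to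
vanish whenever ∫ Kλ = 0. As there are only m such conditions, h = ∑ c_j K^j for constants c_j
(`exists_multipliers_of_integral_eq_zero`). Replacing ν₀ by ν₀ - cΨ, which solves the same equations
in the directions a_j, gives the equations in the directions b_l as well
(`forall_integral_eq_zero_iff_exists_multiplier`).

The ν_j are multipliers relative to the coframe β. Multipliers μ_c for a local system φ_c are the
coefficients of the global covector ∑ ν_j β^j in the dφ_c^i, which explains the compatibility
condition in (2). Statement (1) is the case of a covering by one system. -/

/-! ### Linear differential equations and fundamental matrices -/

/-- Linear differential equations with continuous coefficients have global solutions. -/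
theorem exists_linear_ode_solution {W : Type*} [NormedAddCommGroup W] [NormedSpace ℝ W]
    [CompleteSpace W] {t₁ t₂ : ℝ} (ht : t₁ ≤ t₂) (N : ℝ → W →L[ℝ] W)
    (hN : ContinuousOn N (Icc t₁ t₂)) (x₀ : W) :
    ∃ x : ℝ → W, x t₁ = x₀ ∧ ∀ t ∈ Icc t₁ t₂, HasDerivWithinAt x (N t (x t)) (Icc t₁ t₂) t := by
  classical
  -- the coefficients, extended to `ℝ`
  set N' : ℝ → W →L[ℝ] W := IccExtend ht ((Icc t₁ t₂).domRestrict N) with hN'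
  have hN'c : Continuous N' := (continuousOn_iff_continuous_domRestrict.1 hN).Icc_extend'
  have hN'e : ∀ t ∈ Icc t₁ t₂, N' t = N t := fun t h => by
    rw [hN', IccExtend_of_mem ht _ h]; rfl
  obtain ⟨K, hK⟩ : ∃ K, ∀ t ∈ Icc t₁ t₂, ‖N' t‖ ≤ K :=
    isCompact_Icc.exists_bound_of_continuousOn hN'c.continuousOn
  -- The unknown is y = exp(-k(t - t₁)) x in place of x. With this weight the integral operator has
  -- Lipschitz constant at most |K| / k ≤ 1/2 on the whole interval, whatever its length, so no
  -- subdivision is needed.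
  set k : ℝ := 2 * |K| + 1 with hk
  have hkpos : 0 < k := by positivity
  have : Nonempty (Icc t₁ t₂) := ⟨⟨t₁, left_mem_Icc.2 ht⟩⟩
  let ext : C(Icc t₁ t₂, W) → ℝ → W := fun y => IccExtend ht y
  have hext : ∀ y, Continuous (ext y) := fun y => y.continuous.Icc_extend'
  let I : C(Icc t₁ t₂, W) → ℝ → W := fun y t =>
    ∫ s in t₁..t, Real.exp (k * (s - t₁)) • N' s (ext y s)
  have hIi : ∀ y, Continuous fun s => Real.exp (k * (s - t₁)) • N' s (ext y s) := fun y => by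
    have := hext y
    fun_prop
  have hI : ∀ y, Continuous (I y) := fun y =>
    intervalIntegral.continuous_primitive (fun a b => (hIi y).intervalIntegrable a b) _
  let T : C(Icc t₁ t₂, W) → C(Icc t₁ t₂, W) := fun y =>
    ⟨fun t => Real.exp (-(k * (t - t₁))) • (x₀ + I y t), by
      have := hI y
      fun_prop⟩
  have hT : ContractingWith (1 / 2) T := by
    refine ⟨by rw [← NNReal.coe_lt_coe]; norm_num, LipschitzWith.of_dist_le_mul fun y z => ?_⟩
    rw [ContinuousMap.dist_le (by positivity)]
    intro t
    have hsub : I y t - I z t = ∫ s in t₁..t, Real.exp (k * (s - t₁)) • N' s (ext y s - ext z s) := by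
      simp only [I]
      rw [← intervalIntegral.integral_sub ((hIi y).intervalIntegrable _ _)
        ((hIi z).intervalIntegrable _ _)]
      simp [smul_sub]
    have h1 : ‖I y t - I z t‖ ≤ ∫ s in t₁..t, Real.exp (k * (s - t₁)) * (|K| * dist y z) := by
      rw [hsub]
      refine intervalIntegral.norm_integral_le_of_norm_le t.2.1 (Filter.Eventually.of_forall
        fun s hs => ?_) (Continuous.intervalIntegrable (by fun_prop) _ _)
      have hs' : s ∈ Icc t₁ t₂ := ⟨hs.1.le, hs.2.trans t.2.2⟩
      rw [norm_smul, Real.norm_of_nonneg (Real.exp_pos _).le]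
      gcongr
      refine (ContinuousLinearMap.le_opNorm _ _).trans ?_
      gcongr
      · exact (hK s hs').trans (le_abs_self _)
      · simp only [ext, IccExtend_of_mem ht _ hs']
        rw [← dist_eq_norm]
        exact ContinuousMap.dist_apply_le_dist _
    have h2 : ∫ s in t₁..t, Real.exp (k * (s - t₁)) * (|K| * dist y z)
        = (Real.exp (k * (t - t₁)) - 1) / k * (|K| * dist y z) := by
      rw [intervalIntegral.integral_mul_const]
      congr 1
      have : ∀ s ∈ uIcc t₁ t, HasDerivAt (fun s => Real.exp (k * (s - t₁)) / k)
          (Real.exp (k * (s - t₁))) s := fun s _ => by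
        have := ((((hasDerivAt_id s).sub_const t₁).const_mul k).exp).div_const k
        convert! this using 1
        field_simp
        simp
      rw [intervalIntegral.integral_eq_sub_of_hasDerivAt this
        (Continuous.intervalIntegrable (by fun_prop) _ _)]
      simp; ring
    have h3 : dist (T y t) (T z t) = Real.exp (-(k * (t - t₁))) * ‖I y t - I z t‖ := by
      simp only [T, ContinuousMap.coe_mk, dist_eq_norm]
      rw [← smul_sub, norm_smul, Real.norm_of_nonneg (Real.exp_pos _).le]
      congr 2
      abel
    rw [h3]
    calc Real.exp (-(k * (t - t₁))) * ‖I y t - I z t‖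
        ≤ Real.exp (-(k * (t - t₁))) *
            ((Real.exp (k * (t - t₁)) - 1) / k * (|K| * dist y z)) := by
          gcongr; exact h1.trans h2.le
      _ = (1 - Real.exp (-(k * (t - t₁)))) * (|K| / k * dist y z) := by
          have : Real.exp (-(k * (t - t₁))) * Real.exp (k * (t - t₁)) = 1 := by
            rw [← Real.exp_add]; simp
          field_simp
          linear_combination |K| * dist y z * this
      _ ≤ 1 * (1 / 2 * dist y z) := by
          have := Real.exp_pos (-(k * (t - t₁)))
          have hK2 : |K| / k ≤ 1 / 2 := by
            rw [div_le_iff₀ hkpos]; linarith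
          gcongr
          linarith
      _ = _ := by simp
  obtain ⟨y, hy, -⟩ := hT.exists_fixedPoint 0 (edist_ne_top _ _)
  have hy' : ∀ t ∈ Icc t₁ t₂, Real.exp (k * (t - t₁)) • ext y t = x₀ + I y t := fun t h => by
    have : ext y t = T y ⟨t, h⟩ := by
      rw [show T y = y from hy]; simp [ext, IccExtend_of_mem ht _ h]
    rw [this]
    simp only [T, ContinuousMap.coe_mk, smul_smul, ← Real.exp_add]
    simp
  refine ⟨fun t => x₀ + I y t, by simp [I], fun t h => ?_⟩
  have : HasDerivAt (fun t => x₀ + I y t) (Real.exp (k * (t - t₁)) • N' t (ext y t)) t :=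
    ((intervalIntegral.integral_hasDerivAt_right ((hIi y).intervalIntegrable _ _)
      ((hIi y).stronglyMeasurableAtFilter _ _) (hIi y).continuousAt)).const_add _
  convert! this.hasDerivWithinAt using 1
  change N t (x₀ + I y t) = _
  rw [← hy' t h, map_smul, hN'e t h]

theorem contDiffOn_one_of_hasDerivWithinAt {W : Type*} [NormedAddCommGroup W] [NormedSpace ℝ W]
    {t₁ t₂ : ℝ} (ht : t₁ < t₂) {f f' : ℝ → W}
    (h : ∀ t ∈ Icc t₁ t₂, HasDerivWithinAt f (f' t) (Icc t₁ t₂) t)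
    (hf' : ContinuousOn f' (Icc t₁ t₂)) : ContDiffOn ℝ 1 f (Icc t₁ t₂) := by
  rw [contDiffOn_one_iff_derivWithin (uniqueDiffOn_Icc ht)]
  exact ⟨fun t h' => (h t h').differentiableWithinAt,
    hf'.congr fun t h' => (h t h').derivWithin (uniqueDiffOn_Icc ht t h')⟩

theorem eq_of_hasDerivWithinAt_zero {W : Type*} [NormedAddCommGroup W] [NormedSpace ℝ W]
    {t₁ t₂ : ℝ} {f : ℝ → W}
    (h : ∀ t ∈ Icc t₁ t₂, HasDerivWithinAt f 0 (Icc t₁ t₂) t) : ∀ t ∈ Icc t₁ t₂, f t = f t₁ := by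
  refine constant_of_has_deriv_right_zero (fun t ht => (h t ht).continuousWithinAt) fun t ht => ?_
  exact (h t (Ico_subset_Icc_self ht)).mono_of_mem_nhdsWithin (Icc_mem_nhdsGE_of_mem ht)

/-- The fundamental matrix of a linear differential equation, and its inverse. -/
theorem exists_fundamental_matrix {ι : Type*} [Fintype ι] [DecidableEq ι] {t₁ t₂ : ℝ}
    (ht : t₁ < t₂) (N : ι → ι → ℝ → ℝ) (hN : ∀ i j, ContinuousOn (N i j) (Icc t₁ t₂)) :
    ∃ Φ Ψ : ℝ → Matrix ι ι ℝ, (∀ t ∈ Icc t₁ t₂, Φ t * Ψ t = 1 ∧ Ψ t * Φ t = 1) ∧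
      (∀ i j, ∀ t ∈ Icc t₁ t₂, HasDerivWithinAt (fun τ => Φ τ i j)
        (-∑ k, N i k t * Φ t k j) (Icc t₁ t₂) t) ∧
      (∀ i j, ∀ t ∈ Icc t₁ t₂, HasDerivWithinAt (fun τ => Ψ τ i j)
        (∑ k, Ψ t i k * N k j t) (Icc t₁ t₂) t) := by
  classical
  have ext : ∀ (G : ℝ → (ι → ι → ℝ) →ₗ[ℝ] (ι → ι → ℝ)), (∀ x i j, ContinuousOn (fun t => G t x i j) (Icc t₁ t₂)) →
      ∃ x : ℝ → ι → ι → ℝ, x t₁ = Matrix.of.symm (1 : Matrix ι ι ℝ) ∧ ∀ i j, ∀ t ∈ Icc t₁ t₂,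
        HasDerivWithinAt (fun τ => x τ i j) (G t (x t) i j) (Icc t₁ t₂) t := by
    intro G hG
    obtain ⟨x, hx0, hx⟩ := exists_linear_ode_solution ht.le
      (fun t => LinearMap.toContinuousLinearMap (G t))
      (by
        refine (continuousOn_clm_apply).2 fun x => ?_
        simp only [LinearMap.coe_toContinuousLinearMap']
        exact continuousOn_pi.2 fun i => continuousOn_pi.2 fun j => hG x i j)
      (Matrix.of.symm (1 : Matrix ι ι ℝ))
    exact ⟨x, hx0, fun i j t h => hasDerivWithinAt_pi.1 (hasDerivWithinAt_pi.1 (hx t h) i) j⟩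
  obtain ⟨Φ, hΦ0, hΦ⟩ := ext
    (fun t => { toFun := fun x i j => -∑ k, N i k t * x k j
                map_add' := fun x y => by
                  ext i j; simp [mul_add, Finset.sum_add_distrib]; ring
                map_smul' := fun c x => by
                  ext i j; simp [Finset.mul_sum, mul_left_comm, Pi.smul_apply] })
    (fun x i j => by
      simp only [LinearMap.coe_mk, AddHom.coe_mk]
      exact (continuousOn_finsetSum _ fun k _ => (hN i k).mul continuousOn_const).neg)
  obtain ⟨Ψ, hΨ0, hΨ⟩ := ext
    (fun t => { toFun := fun x i j => ∑ k, x i k * N k j t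
                map_add' := fun x y => by
                  ext i j; simp [add_mul, Finset.sum_add_distrib]
                map_smul' := fun c x => by
                  ext i j; simp [Finset.mul_sum, mul_assoc] })
    (fun x i j => by
      simp only [LinearMap.coe_mk, AddHom.coe_mk]
      exact (continuousOn_finsetSum _ fun k _ => continuousOn_const.mul (hN k j)))
  -- The derivative of ΨΦ is ΨNΦ - ΨNΦ = 0. The derivative of ΦΨ is only a commutator of ΦΨ with N,
  -- so ΦΨ = 1 is deduced afterwards from the fact that the matrices are square.
  have key : ∀ t ∈ Icc t₁ t₂, Matrix.of (Ψ t) * Matrix.of (Φ t) = 1 := by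
    intro t h
    ext i j
    have hd : ∀ t ∈ Icc t₁ t₂, HasDerivWithinAt (fun τ => ∑ k, Ψ τ i k * Φ τ k j) 0
        (Icc t₁ t₂) t := by
      intro t h
      have := HasDerivWithinAt.fun_sum (u := Finset.univ)
        fun k _ => (hΨ i k t h).fun_mul (hΦ k j t h)
      convert! this using 1
      simp only [LinearMap.coe_mk, AddHom.coe_mk, Finset.sum_mul, Finset.sum_add_distrib, mul_neg,
        Finset.sum_neg_distrib, Finset.mul_sum]
      rw [Finset.sum_comm]
      simp [mul_assoc]
    have h1 := eq_of_hasDerivWithinAt_zero hd t h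
    rw [hΨ0, hΦ0] at h1
    rw [Matrix.mul_apply]
    simp only [Matrix.of_apply, h1, Matrix.of_symm_apply]
    rw [← Matrix.mul_apply, one_mul]
  refine ⟨fun t => Matrix.of (Φ t), fun t => Matrix.of (Ψ t), fun t h => ⟨mul_eq_one_comm.1 (key t h), key t h⟩, fun i j t h => ?_,
    fun i j t h => ?_⟩
  · exact hΦ i j t h
  · exact hΨ i j t h

/-! ### Fundamental lemma of the calculus of variations under integral constraints -/

theorem integral_derivWithin_Icc {t₁ t₂ : ℝ} (ht : t₁ < t₂) {f f' : ℝ → ℝ}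
    (h : ∀ t ∈ Icc t₁ t₂, HasDerivWithinAt f (f' t) (Icc t₁ t₂) t)
    (hf' : ContinuousOn f' (Icc t₁ t₂)) : ∫ t in t₁..t₂, f' t = f t₂ - f t₁ := by
  refine intervalIntegral.integral_eq_sub_of_hasDeriv_right_of_le ht.le
    (fun t h' => (h t h').continuousWithinAt) (fun t h' => ?_)
    (hf'.mono (by rw [uIcc_of_le ht.le])).intervalIntegrable
  exact ((h t (Ioo_subset_Icc_self h')).hasDerivAt (Icc_mem_nhds h'.1 h'.2)).hasDerivWithinAt

theorem hasDerivWithinAt_integral_Icc {t₁ t₂ : ℝ} {f : ℝ → ℝ}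
    (hf : ContinuousOn f (Icc t₁ t₂)) :
    ∀ t ∈ Icc t₁ t₂, HasDerivWithinAt (fun u => ∫ s in t₁..u, f s) (f t) (Icc t₁ t₂) t := by
  intro t h
  have : Fact (t ∈ Icc t₁ t₂) := ⟨h⟩
  refine intervalIntegral.integral_hasDerivWithinAt_right
    (hf.mono (by rw [uIcc_of_le h.1]; exact Icc_subset_Icc_right h.2)).intervalIntegrable
    (hf.stronglyMeasurableAtFilter_nhdsWithin measurableSet_Icc t) (hf t h)

/-- A continuous function that is orthogonal to all test functions vanishes. -/
theorem eqOn_zero_of_integral_mul_eq_zero {t₁ t₂ : ℝ} (ht : t₁ < t₂) {u : ℝ → ℝ}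
    (hu : ContinuousOn u (Icc t₁ t₂))
    (h : ∀ g : ℝ → ℝ, ContDiff ℝ 1 g → g t₁ = 0 → g t₂ = 0 → ∫ t in t₁..t₂, u t * g t = 0) :
    ∀ t ∈ Icc t₁ t₂, u t = 0 := by
  have h1 : ∀ᵐ x, x ∈ Ioo t₁ t₂ → u x = 0 := by
    refine isOpen_Ioo.ae_eq_zero_of_integral_contDiff_smul_eq_zero
      ((hu.mono Ioo_subset_Icc_self).locallyIntegrableOn measurableSet_Ioo) fun g hg _ hs => ?_
    have hz : ∀ x, x ∉ Ioo t₁ t₂ → g x = 0 := fun x hx => by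
      by_contra h'
      exact hx (hs (subset_tsupport _ h'))
    have := h g (hg.of_le (by exact_mod_cast le_top)) (hz _ (by simp)) (hz _ (by simp))
    rw [intervalIntegral.integral_of_le ht.le, setIntegral_eq_integral_of_forall_compl_eq_zero]
      at this
    · simpa [mul_comm] using this
    · intro x hx
      rw [hz x fun h' => hx ⟨h'.1, h'.2.le⟩, mul_zero]
  have h2 : u =ᵐ[volume.restrict (Icc t₁ t₂)] fun _ => 0 := by
    rw [← Measure.restrict_congr_set Ioo_ae_eq_Icc]
    exact (ae_restrict_iff' measurableSet_Ioo).2 h1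
  exact Measure.eqOn_Icc_of_ae_eq volume ht.ne h2 hu continuousOn_const

/-- The fundamental lemma of the calculus of variations with finitely many linear constraints. -/
theorem exists_multipliers_of_integral_eq_zero {ι κ : Type*} [Fintype ι] [Fintype κ] {t₁ t₂ : ℝ}
    (ht : t₁ < t₂) (h : κ → ℝ → ℝ) (K : ι → κ → ℝ → ℝ)
    (hh : ∀ l, ContinuousOn (h l) (Icc t₁ t₂)) (hK : ∀ j l, ContinuousOn (K j l) (Icc t₁ t₂))
    (H : ∀ lam : κ → ℝ → ℝ, (∀ l, ContDiffOn ℝ 1 (lam l) (Icc t₁ t₂)) →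
      (∀ l, lam l t₁ = 0 ∧ lam l t₂ = 0) → (∀ j, ∫ t in t₁..t₂, ∑ l, K j l t * lam l t = 0) →
      ∫ t in t₁..t₂, ∑ l, h l t * lam l t = 0) :
    ∃ c : ι → ℝ, ∀ l, ∀ t ∈ Icc t₁ t₂, h l t = ∑ j, c j * K j l t := by
  classical
  let V : Submodule ℝ (κ → ℝ → ℝ) :=
    { carrier := {lam | (∀ l, ContDiffOn ℝ 1 (lam l) (Icc t₁ t₂)) ∧
        ∀ l, lam l t₁ = 0 ∧ lam l t₂ = 0}
      add_mem' := fun {x y} hx hy => ⟨fun l => (hx.1 l).add (hy.1 l), fun l => by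
        simp [hx.2 l, hy.2 l]⟩
      zero_mem' := ⟨fun l => contDiffOn_const, fun l => by simp⟩
      smul_mem' := fun c x hx => ⟨fun l => (hx.1 l).const_smul c, fun l => by simp [hx.2 l]⟩ }
  have hi : ∀ u : κ → ℝ → ℝ, (∀ l, ContinuousOn (u l) (Icc t₁ t₂)) → ∀ x : V,
      IntervalIntegrable (fun t => ∑ l, u l t * x.1 l t) volume t₁ t₂ := fun u hu x => by
    refine ContinuousOn.intervalIntegrable ?_
    rw [uIcc_of_le ht.le]
    exact continuousOn_finsetSum _ fun l _ => (hu l).mul (x.2.1 l).continuousOn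
  let Λ : {u : κ → ℝ → ℝ // ∀ l, ContinuousOn (u l) (Icc t₁ t₂)} → V →ₗ[ℝ] ℝ := fun u =>
    { toFun := fun x => ∫ t in t₁..t₂, ∑ l, u.1 l t * x.1 l t
      map_add' := fun x y => by
        rw [← intervalIntegral.integral_add (hi _ u.2 x) (hi _ u.2 y)]
        simp [mul_add, Finset.sum_add_distrib]
      map_smul' := fun c x => by
        rw [RingHom.id_apply, smul_eq_mul, ← intervalIntegral.integral_const_mul]
        simp [Finset.mul_sum, mul_left_comm] }
  -- Pure linear algebra, with no topology on the space of test functions: a functional that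
  -- vanishes on the common kernel of finitely many functionals is a combination of them.
  have hspan : Λ ⟨h, hh⟩ ∈ Submodule.span ℝ (range fun j => Λ ⟨K j, hK j⟩) := by
    refine mem_span_of_iInf_ker_le_ker fun x hx => ?_
    simp only [Submodule.mem_iInf, LinearMap.mem_ker] at hx ⊢
    exact H x.1 x.2.1 x.2.2 hx
  obtain ⟨c, hc⟩ := (Submodule.mem_span_range_iff_exists_fun ℝ).1 hspan
  refine ⟨c, fun l t h' => ?_⟩
  have hcK : ContinuousOn (fun t => ∑ j, c j * K j l t) (Icc t₁ t₂) :=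
    continuousOn_finsetSum _ fun j _ => continuousOn_const.mul (hK j l)
  refine sub_eq_zero.1 (eqOn_zero_of_integral_mul_eq_zero ht (u := fun t => h l t - ∑ j, c j * K j l t)
    ((hh l).sub hcK) (fun g hg hg1 hg2 => ?_) t h')
  -- A test field with the single component g in position l turns the identity of functionals into
  -- one about the l-th coefficients.
  let x : V := ⟨fun l' => if l' = l then g else 0, fun l' => by
      by_cases hl : l' = l
      · simpa [hl] using hg.contDiffOn
      · simp only [hl, if_false]; exact contDiffOn_const, fun l' => by
      by_cases hl : l' = l <;> simp [hl, hg1, hg2]⟩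
  have hx : ∀ u : {u : κ → ℝ → ℝ // ∀ l, ContinuousOn (u l) (Icc t₁ t₂)},
      Λ u x = ∫ t in t₁..t₂, u.1 l t * g t := fun u => by
    simp only [Λ, LinearMap.coe_mk, AddHom.coe_mk, x]
    congr 1
    ext t
    rw [Finset.sum_eq_single l (fun l' _ hl => by simp [hl]) (by simp)]
    simp
  have h2 := LinearMap.congr_fun hc x
  simp only [LinearMap.sum_apply, LinearMap.smul_apply, hx, smul_eq_mul] at h2
  have hgi : ∀ u, ContinuousOn u (Icc t₁ t₂) →
      IntervalIntegrable (fun t => u t * g t) volume t₁ t₂ := fun u hu =>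
    (by rw [uIcc_of_le ht.le]; exact hu.mul hg.continuous.continuousOn :
      ContinuousOn (fun t => u t * g t) (uIcc t₁ t₂)).intervalIntegrable
  simp only [sub_mul]
  rw [intervalIntegral.integral_sub (hgi _ (hh l)) (hgi _ hcK), ← h2, sub_eq_zero]
  simp only [Finset.sum_mul, mul_assoc]
  rw [intervalIntegral.integral_finsetSum fun j _ => (hgi _ (hK j l)).const_mul _]
  simp

/-! ### The variational problem in frame coordinates: a linear control system -/

section LinearCore

variable {ι κ : Type*} [Fintype ι] [Fintype κ] [DecidableEq ι] {t₁ t₂ : ℝ}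

/-- Solvability of the boundary value problem `κ' = -N κ - K₀ λ`, `κ(t₁) = κ(t₂) = 0`. -/
theorem exists_boundary_solution_iff (ht : t₁ < t₂)
    (N : ι → ι → ℝ → ℝ) (K₀ : ι → κ → ℝ → ℝ)
    (hK₀ : ∀ j l, ContinuousOn (K₀ j l) (Icc t₁ t₂)) {Φ Ψ : ℝ → Matrix ι ι ℝ}
    (hΦΨ : ∀ t ∈ Icc t₁ t₂, Φ t * Ψ t = 1 ∧ Ψ t * Φ t = 1)
    (hΦ : ∀ i j, ∀ t ∈ Icc t₁ t₂, HasDerivWithinAt (fun τ => Φ τ i j)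
        (-∑ k, N i k t * Φ t k j) (Icc t₁ t₂) t)
    (hΨ : ∀ i j, ∀ t ∈ Icc t₁ t₂, HasDerivWithinAt (fun τ => Ψ τ i j)
        (∑ k, Ψ t i k * N k j t) (Icc t₁ t₂) t)
    (lam : κ → ℝ → ℝ) (hlam : ∀ l, ContinuousOn (lam l) (Icc t₁ t₂)) :
    (∃ kap : ι → ℝ → ℝ, (∀ j, kap j t₁ = 0 ∧ kap j t₂ = 0) ∧ ∀ j, ∀ t ∈ Icc t₁ t₂,
        HasDerivWithinAt (kap j) (-(∑ i, N j i t * kap i t + ∑ l, K₀ j l t * lam l t))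
          (Icc t₁ t₂) t) ↔
      ∀ j, ∫ t in t₁..t₂, ∑ l, (∑ i, Ψ t j i * K₀ i l t) * lam l t = 0 := by
  have hΨc : ∀ i j, ContinuousOn (fun t => Ψ t i j) (Icc t₁ t₂) :=
    fun i j t h => (hΨ i j t h).continuousWithinAt
  have hc : ∀ j, ContinuousOn (fun t => ∑ l, (∑ i, Ψ t j i * K₀ i l t) * lam l t) (Icc t₁ t₂) :=
    fun j => continuousOn_finsetSum _ fun l _ =>
      (continuousOn_finsetSum _ fun i _ => (hΨc j i).mul (hK₀ i l)).mul (hlam l)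
  constructor
  · rintro ⟨kap, h0, hk⟩ j
    -- In (Ψκ)' the terms that contain N cancel, and -Ψκ is a primitive of ΨK₀λ that vanishes at
    -- both ends.
    have hd : ∀ t ∈ Icc t₁ t₂, HasDerivWithinAt (fun τ => -∑ i, Ψ τ j i * kap i τ)
        (∑ l, (∑ i, Ψ t j i * K₀ i l t) * lam l t) (Icc t₁ t₂) t := fun t h => by
      have := (HasDerivWithinAt.fun_sum (u := Finset.univ)
        fun i _ => (hΨ j i t h).fun_mul (hk i t h)).fun_neg
      convert! this using 1
      have e1 : ∑ i, (∑ k, Ψ t j k * N k i t) * kap i t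
          = ∑ i, Ψ t j i * ∑ k, N i k t * kap k t := by
        simp only [Finset.sum_mul, Finset.mul_sum]
        rw [Finset.sum_comm]
        simp [mul_assoc]
      have e2 : ∑ l, (∑ i, Ψ t j i * K₀ i l t) * lam l t
          = ∑ i, Ψ t j i * ∑ l, K₀ i l t * lam l t := by
        simp only [Finset.sum_mul, Finset.mul_sum]
        rw [Finset.sum_comm]
        simp [mul_assoc]
      rw [Finset.sum_add_distrib, e1, e2]
      simp only [mul_neg, mul_add, Finset.sum_neg_distrib, Finset.sum_add_distrib]
      ring
    rw [integral_derivWithin_Icc ht hd (hc j)]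
    simp [h0]
  · intro H
    -- Variation of constants from the zero value at t₁; the value at t₂ is zero precisely by the
    -- integral conditions `H`.
    refine ⟨fun i t => -∑ j, Φ t i j * ∫ s in t₁..t, ∑ l, (∑ i, Ψ s j i * K₀ i l s) * lam l s,
      fun j => by simp [H], fun i t h => ?_⟩
    have := (HasDerivWithinAt.fun_sum (u := Finset.univ)
        fun j _ => (hΦ i j t h).fun_mul (hasDerivWithinAt_integral_Icc (hc j) t h)).fun_neg
    convert! this using 1
    set J : ι → ℝ := fun j => ∫ s in t₁..t, ∑ l, (∑ i, Ψ s j i * K₀ i l s) * lam l s with hJ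
    have e2 : ∀ j, ∑ l, (∑ i, Ψ t j i * K₀ i l t) * lam l t
        = ∑ k, Ψ t j k * ∑ l, K₀ k l t * lam l t := fun j => by
      simp only [Finset.sum_mul, Finset.mul_sum]
      rw [Finset.sum_comm]
      simp [mul_assoc]
    have e3 : ∑ j, Φ t i j * ∑ k, Ψ t j k * ∑ l, K₀ k l t * lam l t
        = ∑ l, K₀ i l t * lam l t := by
      have : Matrix.mulVec (Φ t) (Matrix.mulVec (Ψ t) fun k => ∑ l, K₀ k l t * lam l t) i
          = ∑ l, K₀ i l t * lam l t := by
        rw [Matrix.mulVec_mulVec, (hΦΨ t h).1, Matrix.one_mulVec]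
      simpa [Matrix.mulVec, dotProduct] using this
    have e4 : ∑ j, (∑ k, N i k t * Φ t k j) * J j = ∑ k, N i k t * ∑ j, Φ t k j * J j := by
      simp only [Finset.sum_mul, Finset.mul_sum]
      rw [Finset.sum_comm]
      simp [mul_assoc]
    simp only [e2]
    rw [Finset.sum_add_distrib, e3]
    simp only [neg_mul, mul_neg, Finset.sum_neg_distrib]
    rw [e4]

/-- The Euler-Lagrange equations with multipliers for a linear variational problem with
constraints `κ' = -N κ - K₀ λ`. -/
theorem forall_integral_eq_zero_iff_exists_multiplier (ht : t₁ < t₂)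
    (N : ι → ι → ℝ → ℝ) (K₀ : ι → κ → ℝ → ℝ) (hN : ∀ i j, ContinuousOn (N i j) (Icc t₁ t₂))
    (hK₀ : ∀ j l, ContinuousOn (K₀ j l) (Icc t₁ t₂))
    (Aa Ba : ι → ℝ → ℝ) (Ab Bb : κ → ℝ → ℝ)
    (hAa : ∀ i, ContinuousOn (Aa i) (Icc t₁ t₂)) (hAb : ∀ l, ContinuousOn (Ab l) (Icc t₁ t₂))
    (hBa : ∀ i, ContDiffOn ℝ 1 (Ba i) (Icc t₁ t₂))
    (hBb : ∀ l, ContDiffOn ℝ 1 (Bb l) (Icc t₁ t₂)) :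
    (∀ (kap : ι → ℝ → ℝ) (lam : κ → ℝ → ℝ), (∀ i, ContDiffOn ℝ 1 (kap i) (Icc t₁ t₂)) →
      (∀ l, ContDiffOn ℝ 1 (lam l) (Icc t₁ t₂)) → (∀ i, kap i t₁ = 0 ∧ kap i t₂ = 0) →
      (∀ l, lam l t₁ = 0 ∧ lam l t₂ = 0) →
      (∀ j, ∀ t ∈ Icc t₁ t₂, HasDerivWithinAt (kap j)
        (-(∑ i, N j i t * kap i t + ∑ l, K₀ j l t * lam l t)) (Icc t₁ t₂) t) →
      ∫ t in t₁..t₂, (∑ i, (kap i t * Aa i t + derivWithin (kap i) (Icc t₁ t₂) t * Ba i t) +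
        ∑ l, (lam l t * Ab l t + derivWithin (lam l) (Icc t₁ t₂) t * Bb l t)) = 0) ↔
    ∃ ν : ι → ℝ → ℝ, (∀ i, ContDiffOn ℝ 1 (ν i) (Icc t₁ t₂)) ∧
      (∀ i, ∀ t ∈ Icc t₁ t₂, HasDerivWithinAt (fun τ => Ba i τ + ν i τ)
        (Aa i t + ∑ j, ν j t * N j i t) (Icc t₁ t₂) t) ∧
      ∀ l, ∀ t ∈ Icc t₁ t₂, HasDerivWithinAt (Bb l)
        (Ab l t + ∑ j, ν j t * K₀ j l t) (Icc t₁ t₂) t := by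
  have hdc : ∀ {f : ℝ → ℝ}, ContDiffOn ℝ 1 f (Icc t₁ t₂) →
      ContinuousOn (derivWithin f (Icc t₁ t₂)) (Icc t₁ t₂) := fun hf =>
    hf.continuousOn_derivWithin (uniqueDiffOn_Icc ht) le_rfl
  have hdd : ∀ {f : ℝ → ℝ}, ContDiffOn ℝ 1 f (Icc t₁ t₂) → ∀ t ∈ Icc t₁ t₂,
      HasDerivWithinAt f (derivWithin f (Icc t₁ t₂) t) (Icc t₁ t₂) t := fun hf t h =>
    ((hf.differentiableOn one_ne_zero) t h).hasDerivWithinAt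
  -- the first variation, when the multipliers solve the equations in the constrained directions
  have key : ∀ ν : ι → ℝ → ℝ, (∀ i, ContDiffOn ℝ 1 (ν i) (Icc t₁ t₂)) →
      (∀ i, ∀ t ∈ Icc t₁ t₂, HasDerivWithinAt (fun τ => Ba i τ + ν i τ)
        (Aa i t + ∑ j, ν j t * N j i t) (Icc t₁ t₂) t) →
      ∀ (kap : ι → ℝ → ℝ) (lam : κ → ℝ → ℝ), (∀ i, ContDiffOn ℝ 1 (kap i) (Icc t₁ t₂)) →
      (∀ l, ContDiffOn ℝ 1 (lam l) (Icc t₁ t₂)) → (∀ i, kap i t₁ = 0 ∧ kap i t₂ = 0) →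
      (∀ l, lam l t₁ = 0 ∧ lam l t₂ = 0) →
      (∀ j, ∀ t ∈ Icc t₁ t₂, HasDerivWithinAt (kap j)
        (-(∑ i, N j i t * kap i t + ∑ l, K₀ j l t * lam l t)) (Icc t₁ t₂) t) →
      ∫ t in t₁..t₂, (∑ i, (kap i t * Aa i t + derivWithin (kap i) (Icc t₁ t₂) t * Ba i t) +
        ∑ l, (lam l t * Ab l t + derivWithin (lam l) (Icc t₁ t₂) t * Bb l t)) =
      ∫ t in t₁..t₂, ∑ l, (Ab l t + ∑ j, ν j t * K₀ j l t - derivWithin (Bb l) (Icc t₁ t₂) t) *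
        lam l t := by
    intro ν hν hode kap lam hkap hlam hk0 hl0 hk
    -- The derivative of ∑ (Ba + ν) κ + ∑ Bb λ, a function that vanishes at both ends. Adding its
    -- zero integral to the right-hand side performs the integration by parts and leaves a pointwise
    -- identity.
    set G' : ℝ → ℝ := fun t => ∑ i, ((Aa i t + ∑ j, ν j t * N j i t) * kap i t +
        (Ba i t + ν i t) * derivWithin (kap i) (Icc t₁ t₂) t) +
      ∑ l, (derivWithin (Bb l) (Icc t₁ t₂) t * lam l t +
        Bb l t * derivWithin (lam l) (Icc t₁ t₂) t) with hG'
    have hG'c : ContinuousOn G' (Icc t₁ t₂) := by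
      refine (continuousOn_finsetSum _ fun i _ => ?_).add (continuousOn_finsetSum _ fun l _ => ?_)
      · exact (((hAa i).add (continuousOn_finsetSum _ fun j _ =>
          (hν j).continuousOn.mul (hN j i))).mul (hkap i).continuousOn).add
          (((hBa i).continuousOn.add (hν i).continuousOn).mul (hdc (hkap i)))
      · exact ((hdc (hBb l)).mul (hlam l).continuousOn).add
          ((hBb l).continuousOn.mul (hdc (hlam l)))
    have hG : ∀ t ∈ Icc t₁ t₂, HasDerivWithinAt (fun τ => ∑ i, (Ba i τ + ν i τ) * kap i τ +
        ∑ l, Bb l τ * lam l τ) (G' t) (Icc t₁ t₂) t := fun t h =>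
      (HasDerivWithinAt.fun_sum fun i _ => (hode i t h).fun_mul (hdd (hkap i) t h)).fun_add
        (HasDerivWithinAt.fun_sum fun l _ => (hdd (hBb l) t h).fun_mul (hdd (hlam l) t h))
    have hG0 : ∫ t in t₁..t₂, G' t = 0 := by
      rw [integral_derivWithin_Icc ht hG hG'c]
      simp [hk0, hl0]
    have hhc : ContinuousOn (fun t => ∑ l, (Ab l t + ∑ j, ν j t * K₀ j l t -
        derivWithin (Bb l) (Icc t₁ t₂) t) * lam l t) (Icc t₁ t₂) :=
      continuousOn_finsetSum _ fun l _ => (((hAb l).add (continuousOn_finsetSum _ fun j _ =>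
          (hν j).continuousOn.mul (hK₀ j l))).sub (hdc (hBb l))).mul (hlam l).continuousOn
    rw [← add_zero (∫ t in t₁..t₂, ∑ l, (Ab l t + ∑ j, ν j t * K₀ j l t -
      derivWithin (Bb l) (Icc t₁ t₂) t) * lam l t), ← hG0, ← intervalIntegral.integral_add
      (hhc.mono (by rw [uIcc_of_le ht.le])).intervalIntegrable
      (hG'c.mono (by rw [uIcc_of_le ht.le])).intervalIntegrable]
    refine intervalIntegral.integral_congr fun t h => ?_
    rw [uIcc_of_le ht.le] at h
    -- The constraint equation paired with ν trades ν κ' for terms in κ and λ without derivatives;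
    -- the terms in κ are those which the equation for ν cancels.
    have hkd : ∑ i, ν i t * derivWithin (kap i) (Icc t₁ t₂) t =
        -(∑ i, (∑ j, ν j t * N j i t) * kap i t + ∑ l, (∑ j, ν j t * K₀ j l t) * lam l t) := by
      simp only [fun i => (hk i t h).derivWithin (uniqueDiffOn_Icc ht t h)]
      simp only [mul_neg, mul_add, Finset.sum_neg_distrib, Finset.sum_add_distrib, Finset.sum_mul,
        Finset.mul_sum, mul_assoc]
      congr 1
      congr 1 <;> exact Finset.sum_comm
    simp only [hG', add_mul, sub_mul, Finset.sum_add_distrib, Finset.sum_sub_distrib, hkd]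
    simp only [mul_comm]
    ring
  constructor
  · intro H
    obtain ⟨Φ, Ψ, hΦΨ, hΦ, hΨ⟩ := exists_fundamental_matrix ht N hN
    have hΨc : ∀ i j, ContinuousOn (fun t => Ψ t i j) (Icc t₁ t₂) :=
      fun i j t h => (hΨ i j t h).continuousWithinAt
    have hΦc : ∀ i j, ContinuousOn (fun t => Φ t i j) (Icc t₁ t₂) :=
      fun i j t h => (hΦ i j t h).continuousWithinAt
    set g : ι → ℝ → ℝ := fun i t => Aa i t - derivWithin (Ba i) (Icc t₁ t₂) t with hg
    have hgc : ∀ k, ContinuousOn (fun t => ∑ i, g i t * Φ t i k) (Icc t₁ t₂) := fun k =>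
      continuousOn_finsetSum _ fun i _ => ((hAa i).sub (hdc (hBa i))).mul (hΦc i k)
    -- The adjoint equation ν' = g + νN, solved by variation of constants; c parametrizes the
    -- homogeneous solutions -cΨ. Neither end value of ν is prescribed, and this freedom absorbs the
    -- constants found below.
    have main : ∀ c : ι → ℝ, ∃ ν : ι → ℝ → ℝ,
        (∀ i t, ν i t = ∑ k, ((∫ s in t₁..t, ∑ i, g i s * Φ s i k) - c k) * Ψ t k i) ∧
        (∀ i, ContDiffOn ℝ 1 (ν i) (Icc t₁ t₂)) ∧
        (∀ i, ∀ t ∈ Icc t₁ t₂, HasDerivWithinAt (fun τ => Ba i τ + ν i τ)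
          (Aa i t + ∑ j, ν j t * N j i t) (Icc t₁ t₂) t) := by
      intro c
      set ν : ι → ℝ → ℝ := fun i t =>
        ∑ k, ((∫ s in t₁..t, ∑ i, g i s * Φ s i k) - c k) * Ψ t k i with hν
      have hd : ∀ i, ∀ t ∈ Icc t₁ t₂, HasDerivWithinAt (ν i)
          (g i t + ∑ j, ν j t * N j i t) (Icc t₁ t₂) t := by
        intro i t h
        have := HasDerivWithinAt.fun_sum (u := Finset.univ) fun k _ =>
          ((hasDerivWithinAt_integral_Icc (hgc k) t h).sub_const (c k)).fun_mul (hΨ k i t h)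
        convert! this using 1
        rw [Finset.sum_add_distrib]
        congr 1
        · have : Matrix.vecMul (Matrix.vecMul (fun i => g i t) (Φ t)) (Ψ t) i = g i t := by
            rw [Matrix.vecMul_vecMul, (hΦΨ t h).1, Matrix.vecMul_one]
          rw [← this]
          simp [Matrix.vecMul, dotProduct]
        · simp only [hν, Finset.sum_mul, Finset.mul_sum]
          rw [Finset.sum_comm]
          simp [mul_assoc]
      have hνc : ∀ i, ContinuousOn (ν i) (Icc t₁ t₂) := fun i t h => (hd i t h).continuousWithinAt
      refine ⟨ν, fun i t => rfl, fun i => contDiffOn_one_of_hasDerivWithinAt ht (hd i) ?_,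
        fun i t h => ?_⟩
      · exact ((hAa i).sub (hdc (hBa i))).add
          (continuousOn_finsetSum _ fun j _ => (hνc j).mul (hN j i))
      · have := (hdd (hBa i) t h).fun_add (hd i t h)
        convert! this using 1
        simp only [hg]
        ring
    obtain ⟨ν₀, hν₀e, hν₀c, hν₀⟩ := main 0
    obtain ⟨c, hc⟩ := exists_multipliers_of_integral_eq_zero ht
      (fun l t => Ab l t + ∑ j, ν₀ j t * K₀ j l t - derivWithin (Bb l) (Icc t₁ t₂) t)
      (fun j l t => ∑ i, Ψ t j i * K₀ i l t)
      (fun l => ((hAb l).add (continuousOn_finsetSum _ fun j _ =>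
          (hν₀c j).continuousOn.mul (hK₀ j l))).sub (hdc (hBb l)))
      (fun j l => continuousOn_finsetSum _ fun i _ => (hΨc j i).mul (hK₀ i l)) (by
        intro lam hlam hl0 hint
        obtain ⟨kap, hk0, hk⟩ := (exists_boundary_solution_iff ht N K₀ hK₀ hΦΨ hΦ hΨ lam
          (fun l => (hlam l).continuousOn)).2 hint
        have hkc : ∀ i, ContinuousOn (kap i) (Icc t₁ t₂) :=
          fun i t h => (hk i t h).continuousWithinAt
        have hkap : ∀ i, ContDiffOn ℝ 1 (kap i) (Icc t₁ t₂) := fun i =>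
          contDiffOn_one_of_hasDerivWithinAt ht (hk i)
            ((continuousOn_finsetSum _ fun j _ => (hN i j).mul (hkc j)).add
              (continuousOn_finsetSum _ fun l _ => (hK₀ i l).mul (hlam l).continuousOn)).neg
        rw [← key ν₀ hν₀c hν₀ kap lam hkap hlam hk0 hl0 hk]
        exact H kap lam hkap hlam hk0 hl0 hk)
    -- Passing from ν₀ to ν₀ - cΨ changes the residual in direction b_l by -∑ c_j (ΨK₀)_jl, exactly
    -- the opposite of the residual given by `hc`.
    obtain ⟨ν, hνe, hνc, hν⟩ := main c
    refine ⟨ν, hνc, hν, fun l t h => ?_⟩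
    have e1 : ∀ i, ν i t = ν₀ i t - ∑ k, c k * Ψ t k i := fun i => by
      rw [hνe, hν₀e, ← Finset.sum_sub_distrib]
      simp [sub_mul]
    have e2 : ∑ j, (∑ k, c k * Ψ t k j) * K₀ j l t = ∑ j, c j * ∑ i, Ψ t j i * K₀ i l t := by
      simp only [Finset.sum_mul, Finset.mul_sum]
      rw [Finset.sum_comm]
      simp [mul_assoc]
    convert! hdd (hBb l) t h using 1
    have := hc l t h
    simp only [e1, sub_mul, Finset.sum_sub_distrib]
    rw [e2]
    linarith
  · rintro ⟨ν, hν, hode, hb⟩ kap lam hkap hlam hk0 hl0 hk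
    rw [key ν hν hode kap lam hkap hlam hk0 hl0 hk]
    rw [← intervalIntegral.integral_zero (a := t₁) (b := t₂) (μ := volume)]
    refine intervalIntegral.integral_congr fun t h => ?_
    rw [uIcc_of_le ht.le] at h
    refine Finset.sum_eq_zero fun l _ => ?_
    rw [(hb l t h).derivWithin (uniqueDiffOn_Icc ht t h)]
    ring

end LinearCore

/-! ### Gluing of C¹ functions and splitting of C¹ cocycles over an interval -/

/-- Functions of class `C¹` on two adjacent intervals whose values and derivatives agree at the
common end-point are of class `C¹`. -/
theorem contDiffOn_one_Icc_union {W : Type*} [NormedAddCommGroup W] [NormedSpace ℝ W]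
    {a s b : ℝ} (has : a < s) (hsb : s < b) {O : Set ℝ} (hO : IsOpen O) {h : ℝ → W}
    (h1 : ContDiffOn ℝ 1 h (Icc a s ∩ O)) (h2 : ContDiffOn ℝ 1 h (Icc s b ∩ O))
    (hd : s ∈ O → derivWithin h (Icc a s) s = derivWithin h (Icc s b) s) :
    ContDiffOn ℝ 1 h (Icc a b ∩ O) := by
  rintro t ⟨ht, htO⟩
  rcases lt_trichotomy t s with hts | rfl | hts
  · refine (h1 t ⟨⟨ht.1, hts.le⟩, htO⟩).mono_of_mem_nhdsWithin ?_
    filter_upwards [self_mem_nhdsWithin, mem_nhdsWithin_of_mem_nhds (Iio_mem_nhds hts)] with x hx hx'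
    exact ⟨⟨hx.1.1, le_of_lt hx'⟩, hx.2⟩
  swap
  · refine (h2 t ⟨⟨hts.le, ht.2⟩, htO⟩).mono_of_mem_nhdsWithin ?_
    filter_upwards [self_mem_nhdsWithin, mem_nhdsWithin_of_mem_nhds (Ioi_mem_nhds hts)] with x hx hx'
    exact ⟨⟨le_of_lt hx', hx.1.2⟩, hx.2⟩
  have hO' : O ∩ Ioo a b ∈ nhds t :=
    Filter.inter_mem (hO.mem_nhds htO) (Ioo_mem_nhds has hsb)
  have hOo : IsOpen (O ∩ Ioo a b) := hO.inter isOpen_Ioo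
  refine ContDiffAt.contDiffWithinAt ?_
  refine ContDiffOn.contDiffAt (s := O ∩ Ioo a b) ?_ hO'
  have u1 : UniqueDiffOn ℝ (Icc a t ∩ O) := (uniqueDiffOn_Icc has).inter hO
  have u2 : UniqueDiffOn ℝ (Icc t b ∩ O) := (uniqueDiffOn_Icc hsb).inter hO
  have e1 : ∀ x ∈ O, derivWithin h (Icc a t ∩ O) x = derivWithin h (Icc a t) x := fun x hx =>
    derivWithin_inter (hO.mem_nhds hx)
  have e2 : ∀ x ∈ O, derivWithin h (Icc t b ∩ O) x = derivWithin h (Icc t b) x := fun x hx =>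
    derivWithin_inter (hO.mem_nhds hx)
  have d1 : ∀ x ∈ Icc a t ∩ O, HasDerivWithinAt h (derivWithin h (Icc a t) x) (Icc a t) x :=
    fun x hx => by
      have := ((h1.differentiableOn one_ne_zero) x hx).hasDerivWithinAt
      rw [e1 x hx.2] at this
      exact this.mono_of_mem_nhdsWithin (Filter.inter_mem self_mem_nhdsWithin
        (mem_nhdsWithin_of_mem_nhds (hO.mem_nhds hx.2)))
  have d2 : ∀ x ∈ Icc t b ∩ O, HasDerivWithinAt h (derivWithin h (Icc t b) x) (Icc t b) x :=
    fun x hx => by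
      have := ((h2.differentiableOn one_ne_zero) x hx).hasDerivWithinAt
      rw [e2 x hx.2] at this
      exact this.mono_of_mem_nhdsWithin (Filter.inter_mem self_mem_nhdsWithin
        (mem_nhdsWithin_of_mem_nhds (hO.mem_nhds hx.2)))
  -- At the junction the equality of the one-sided derivatives makes h differentiable; elsewhere one
  -- of the two intervals is a neighbourhood of the point.
  have hD1 : ∀ x ∈ O ∩ Ioo a b, x ≤ t → HasDerivAt h (derivWithin h (Icc a t) x) x := by
    intro x hx hxt
    rcases hxt.lt_or_eq with hxt | rfl
    · exact (d1 x ⟨⟨hx.2.1.le, hxt.le⟩, hx.1⟩).hasDerivAt (Icc_mem_nhds hx.2.1 hxt)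
    · have h3 := d2 x ⟨⟨le_rfl, hsb.le⟩, hx.1⟩
      rw [← hd hx.1] at h3
      have := (d1 x ⟨⟨has.le, le_rfl⟩, hx.1⟩).union h3
      rw [Icc_union_Icc_eq_Icc has.le hsb.le] at this
      exact this.hasDerivAt (Icc_mem_nhds has hsb)
  have hD2 : ∀ x ∈ O ∩ Ioo a b, t ≤ x → HasDerivAt h (derivWithin h (Icc t b) x) x := by
    intro x hx hxt
    rcases hxt.lt_or_eq with hxt | rfl
    · exact (d2 x ⟨⟨hxt.le, hx.2.2.le⟩, hx.1⟩).hasDerivAt (Icc_mem_nhds hxt hx.2.2)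
    · rw [← hd hx.1]
      exact hD1 t hx le_rfl
  have c1 : ContinuousOn (derivWithin h (Icc a t)) (Icc a t ∩ O) :=
    (h1.continuousOn_derivWithin u1 le_rfl).congr fun x hx => (e1 x hx.2).symm
  have c2 : ContinuousOn (derivWithin h (Icc t b)) (Icc t b ∩ O) :=
    (h2.continuousOn_derivWithin u2 le_rfl).congr fun x hx => (e2 x hx.2).symm
  rw [show (1 : WithTop ℕ∞) = 0 + 1 by simp, contDiffOn_succ_iff_deriv_of_isOpen hOo]
  refine ⟨fun x hx => ?_, by simp, contDiffOn_zero.2 ?_⟩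
  · rcases le_total x t with hxt | hxt
    · exact (hD1 x hx hxt).differentiableAt.differentiableWithinAt
    · exact (hD2 x hx hxt).differentiableAt.differentiableWithinAt
  · have k1 : ContinuousOn (deriv h) (Icc a t ∩ (O ∩ Ioo a b)) :=
      (c1.mono fun x hx => ⟨hx.1, hx.2.1⟩).congr fun x hx => (hD1 x hx.2 hx.1.2).deriv
    have k2 : ContinuousOn (deriv h) (Icc t b ∩ (O ∩ Ioo a b)) :=
      (c2.mono fun x hx => ⟨hx.1, hx.2.1⟩).congr fun x hx => (hD2 x hx.2 hx.1.1).deriv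
    have hu : O ∩ Ioo a b = Icc a t ∩ (O ∩ Ioo a b) ∪ Icc t b ∩ (O ∩ Ioo a b) := by
      rw [← union_inter_distrib_right, Icc_union_Icc_eq_Icc has.le hsb.le]
      exact (inter_eq_self_of_subset_right fun x hx => Ioo_subset_Icc_self hx.2).symm
    intro x hx
    rw [hu]
    refine ContinuousWithinAt.union ?_ ?_
    · by_cases hxt : x ≤ t
      · exact k1 x ⟨⟨hx.2.1.le, hxt⟩, hx⟩
      · refine continuousWithinAt_of_notMem_closure fun hc => hxt ?_
        exact (closure_minimal inter_subset_left isClosed_Icc hc).2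
    · by_cases hxt : t ≤ x
      · exact k2 x ⟨⟨hxt, hx.2.2.le⟩, hx⟩
      · refine continuousWithinAt_of_notMem_closure fun hc => hxt ?_
        exact (closure_minimal inter_subset_left isClosed_Icc hc).1

section Cocycle

variable {ι : Type*} {V : Type*} [NormedAddCommGroup V] [NormedSpace ℝ V] [FiniteDimensional ℝ V]

/-- The family `N` splits the cocycle `M` on the interval `[a, b]`, and preserves the
subspace `S`. -/
structure IsSplitting (S : Submodule ℝ V) (J : ι → Set ℝ) (M : ι → ι → ℝ → V →L[ℝ] V) (a b : ℝ)
    (N : ι → ℝ → V →L[ℝ] V) : Prop where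
  contDiffOn : ∀ c, ContDiffOn ℝ 1 (N c) (Icc a b ∩ J c)
  isUnit : ∀ c, ∀ t ∈ Icc a b ∩ J c, IsUnit (N c t)
  mem : ∀ c, ∀ t ∈ Icc a b ∩ J c, ∀ x ∈ S, N c t x ∈ S
  mul_eq : ∀ c c', ∀ t ∈ Icc a b ∩ (J c ∩ J c'), M c c' t * N c' t = N c t

/-- The restriction of A to S is injective, hence onto S because S is finite-dimensional. -/
theorem inverse_mem_of_isUnit {S : Submodule ℝ V} {A : V →L[ℝ] V} (hA : IsUnit A)
    (hS : ∀ x ∈ S, A x ∈ S) : ∀ x ∈ S, Ring.inverse A x ∈ S := by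
  intro x hx
  have hinj : Function.Injective ((A : V →ₗ[ℝ] V).restrict hS) := by
    intro y z hyz
    have h1 : A y = A z := congrArg Subtype.val hyz
    have h2 : Ring.inverse A (A y) = Ring.inverse A (A z) := by rw [h1]
    have h3 := Ring.inverse_mul_cancel A hA
    have h4 : ∀ w, Ring.inverse A (A w) = w := fun w => by
      simpa using DFunLike.congr_fun h3 w
    rw [h4, h4] at h2
    exact Subtype.ext h2
  obtain ⟨y, hy⟩ := (LinearMap.injective_iff_surjective.1 hinj) ⟨x, hx⟩
  have h1 : A y = x := congrArg Subtype.val hy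
  have h3 := Ring.inverse_mul_cancel A hA
  have h4 : Ring.inverse A (A y) = y := by simpa using DFunLike.congr_fun h3 (y : V)
  rw [← h1, h4]
  exact y.2

/-- A path of invertible operators with prescribed initial velocity. -/
theorem exists_isUnit_path (X : V →L[ℝ] V) : ∃ θ : ℝ → ℝ, ContDiff ℝ 1 θ ∧ θ 0 = 0 ∧
    HasDerivAt θ 1 0 ∧ ∀ t, IsUnit (1 + θ t • X) := by
  -- With θ(t) = ρ sin(t/ρ) one has θ'(0) = 1 and |θ| ≤ ρ, so ‖θ(t) X‖ < 1 for all t and 1 + θ(t) X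
  -- is invertible by the Neumann series. The straight path 1 + tX could become singular.
  set ρ : ℝ := 1 / (‖X‖ + 1) with hρ
  have hX := norm_nonneg X
  have hρ0 : 0 < ρ := by positivity
  refine ⟨fun t => ρ * Real.sin (t / ρ), by fun_prop, by simp, ?_, fun t => ?_⟩
  · have := (((hasDerivAt_id (0 : ℝ)).div_const ρ).sin).const_mul ρ
    convert! this using 1
    simp [hρ0.ne']
  · have : ‖-((ρ * Real.sin (t / ρ)) • X)‖ < 1 := by
      rw [norm_neg, norm_smul, Real.norm_eq_abs, abs_mul, abs_of_pos hρ0]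
      calc ρ * |Real.sin (t / ρ)| * ‖X‖ ≤ ρ * 1 * ‖X‖ := by
            gcongr
            exact Real.abs_sin_le_one _
        _ < 1 := by
            rw [hρ]
            field_simp
            linarith
    have h := isUnit_one_sub_of_norm_lt_one this
    rwa [sub_neg_eq_add] at h

variable {S : Submodule ℝ V} {J : ι → Set ℝ} {M : ι → ι → ℝ → V →L[ℝ] V} {a b : ℝ}

/-- A splitting can be extended to the right across an interval that is contained in a single
member of the covering. -/
theorem IsSplitting.extend {s : ℝ} {N : ι → ℝ → V →L[ℝ] V} (hN : IsSplitting S J M a s N)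
    (has : a < s) (hsb : s < b) (hJ : ∀ c, IsOpen (J c))
    (hM : ∀ c c', ContDiffOn ℝ 1 (M c c') (Icc a b ∩ (J c ∩ J c')))
    (hM1 : ∀ c, ∀ t ∈ Icc a b ∩ J c, M c c t = 1)
    (hMM : ∀ c c' c'', ∀ t ∈ Icc a b ∩ (J c ∩ J c' ∩ J c''), M c c' t * M c' c'' t = M c c'' t)
    (hMS : ∀ c c', ∀ t ∈ Icc a b ∩ (J c ∩ J c'), ∀ x ∈ S, M c c' t x ∈ S)
    {c₀ : ι} (hc₀ : Icc s b ⊆ J c₀) : ∃ N', IsSplitting S J M a b N' := by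
  classical
  have hsJ : s ∈ J c₀ := hc₀ ⟨le_rfl, hsb.le⟩
  have hs : s ∈ Icc a s ∩ J c₀ := ⟨⟨has.le, le_rfl⟩, hsJ⟩
  -- A continuation past s of class C¹ has to match both the value of N c₀ at s and this left
  -- derivative.
  set D := derivWithin (N c₀) (Icc a s) s with hD
  have hNd : HasDerivWithinAt (N c₀) D (Icc a s ∩ J c₀) s := by
    have := (((hN.contDiffOn c₀).differentiableOn one_ne_zero) s hs).hasDerivWithinAt
    rwa [derivWithin_inter ((hJ c₀).mem_nhds hsJ)] at this
  have hNd' : HasDerivWithinAt (N c₀) D (Icc a s) s :=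
    hNd.mono_of_mem_nhdsWithin (Filter.inter_mem self_mem_nhdsWithin
        (mem_nhdsWithin_of_mem_nhds ((hJ c₀).mem_nhds hsJ)))
  have hus : UniqueDiffWithinAt ℝ (Icc a s ∩ J c₀) s :=
    ((uniqueDiffOn_Icc has).inter (hJ c₀)) s hs
  -- A functional that vanishes on S vanishes along N c₀ t x, hence on its derivative; so a failure
  -- of D x ∈ S would be detected by such a functional.
  have hDS : ∀ x ∈ S, D x ∈ S := by
    intro x hx
    by_contra hxS
    have hcl : IsClosed (S : Set V) := S.closed_of_finiteDimensional
    obtain ⟨f, hf, hfS⟩ := Submodule.exists_le_ker_of_notMem hxS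
    let f' : V →L[ℝ] ℝ := LinearMap.toContinuousLinearMap f
    have h1 : HasDerivWithinAt (fun t => f' (N c₀ t x)) (f' (D x)) (Icc a s ∩ J c₀) s :=
      f'.hasFDerivAt.comp_hasDerivWithinAt s (hNd.clm_apply (hasDerivWithinAt_const s _ x) |>.congr_deriv
        (by simp))
    have h2 : HasDerivWithinAt (fun t => f' (N c₀ t x)) 0 (Icc a s ∩ J c₀) s := by
      refine (hasDerivWithinAt_const s _ (0 : ℝ)).congr (fun t ht => ?_) ?_
      · exact hfS (hN.mem c₀ t ht x hx)
      · exact hfS (hN.mem c₀ s hs x hx)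
    exact hf ((hus.eq_deriv _ h1 h2))
  set X := Ring.inverse (N c₀ s) * D with hX
  have hNX : N c₀ s * X = D := by
    rw [hX, ← mul_assoc, Ring.mul_inverse_cancel _ (hN.isUnit c₀ s hs), one_mul]
  have hXS : ∀ x ∈ S, X x ∈ S := fun x hx =>
    inverse_mem_of_isUnit (hN.isUnit c₀ s hs) (hN.mem c₀ s hs) _ (hDS x hx)
  obtain ⟨θ, hθ, hθ0, hθd, hθu⟩ := exists_isUnit_path X
  -- An invertible path that preserves S and has at s the value N c₀ s and the derivative N c₀ s * X
  -- = D.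
  let P : ℝ → V →L[ℝ] V := fun t => N c₀ s * (1 + θ (t - s) • X)
  have hP : ContDiff ℝ 1 P := by
    have : ContDiff ℝ 1 fun t => θ (t - s) := hθ.comp (contDiff_id.sub contDiff_const)
    exact contDiff_const.mul (contDiff_const.add (this.smul contDiff_const))
  have hPd : HasDerivAt P D s := by
    have h1 : HasDerivAt (fun t => θ (t - s)) 1 s := by
      have := HasDerivAt.comp_sub_const s s (f := θ) (f' := 1) (by simpa using hθd)
      exact this
    have := ((h1.smul_const X).const_add 1).const_mul (N c₀ s)
    convert! this using 1
    rw [one_smul, hNX]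
  -- To the right of s all times lie in J c₀, so the other members are forced by the splitting
  -- relation with c₀.
  let N' : ι → ℝ → V →L[ℝ] V := fun c t => if t ≤ s then N c t else M c c₀ t * P t
  have hN'l : ∀ c t, t ≤ s → N' c t = N c t := fun c t h => if_pos h
  have hN'r : ∀ c, ∀ t ∈ Icc s b ∩ J c, N' c t = M c c₀ t * P t := by
    intro c t ht
    rcases ht.1.1.lt_or_eq with h | rfl
    · exact if_neg (not_le.2 h)
    · rw [hN'l _ _ le_rfl]
      have h1 : P s = N c₀ s := by simp [P, hθ0]
      rw [h1, hN.mul_eq c c₀ s ⟨hs.1, ht.2, hsJ⟩]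
  have hN'r0 : ∀ t ∈ Icc s b, N' c₀ t = P t := by
    intro t ht
    rw [hN'r c₀ t ⟨ht, hc₀ ht⟩, hM1 c₀ t ⟨⟨has.le.trans ht.1, ht.2⟩, hc₀ ht⟩, one_mul]
  have hleft : ∀ c, ContDiffOn ℝ 1 (N' c) (Icc a s ∩ J c) := fun c =>
    (hN.contDiffOn c).congr fun t ht => hN'l c t ht.1.2
  have hc₀N : ContDiffOn ℝ 1 (N' c₀) (Icc a b ∩ J c₀) := by
    refine contDiffOn_one_Icc_union has hsb (hJ c₀) (hleft c₀)
      (hP.contDiffOn.congr fun t ht => hN'r0 t ht.1) fun _ => ?_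
    rw [derivWithin_congr (fun t ht => hN'l c₀ t ht.2) (hN'l c₀ s le_rfl), ← hD]
    exact ((hPd.hasDerivWithinAt.congr hN'r0 (hN'r0 s ⟨le_rfl, hsb.le⟩)).derivWithin
      (uniqueDiffOn_Icc hsb s ⟨le_rfl, hsb.le⟩)).symm
  have hNM : ∀ c, ∀ t ∈ Icc a b ∩ (J c ∩ J c₀), N' c t = M c c₀ t * N' c₀ t := by
    intro c t ht
    rcases le_total t s with h | h
    · rw [hN'l c t h, hN'l c₀ t h, hN.mul_eq c c₀ t ⟨⟨ht.1.1, h⟩, ht.2⟩]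
    · rw [hN'r c t ⟨⟨h, ht.1.2⟩, ht.2.1⟩, hN'r0 t ⟨h, ht.1.2⟩]
  have hMu : ∀ c, ∀ t ∈ Icc a b ∩ (J c ∩ J c₀), IsUnit (M c c₀ t) := by
    intro c t ht
    refine isUnit_iff_exists.2 ⟨M c₀ c t, ?_, ?_⟩
    · rw [hMM c c₀ c t ⟨ht.1, ht.2, ht.2.1⟩, hM1 c t ⟨ht.1, ht.2.1⟩]
    · rw [hMM c₀ c c₀ t ⟨ht.1, ⟨ht.2.2, ht.2.1⟩, ht.2.2⟩, hM1 c₀ t ⟨ht.1, ht.2.2⟩]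
  refine ⟨N', fun c t ht => ?_, fun c t ht => ?_, fun c t ht x hx => ?_, fun c c' t ht => ?_⟩
  · rcases lt_or_ge t s with h | h
    · refine (hleft c t ⟨⟨ht.1.1, h.le⟩, ht.2⟩).mono_of_mem_nhdsWithin ?_
      filter_upwards [self_mem_nhdsWithin, mem_nhdsWithin_of_mem_nhds (Iio_mem_nhds h)] with x hx hx'
      exact ⟨⟨hx.1.1, le_of_lt hx'⟩, hx.2⟩
    -- On J c ∩ J c₀ the relation N' c = M c c₀ * N' c₀ holds on both sides of s, so the regularity
    -- at s is inherited from the member c₀, for which the derivatives were matched.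
    · have htJ : t ∈ J c₀ := hc₀ ⟨h, ht.1.2⟩
      have h1 : ContDiffOn ℝ 1 (N' c) (Icc a b ∩ (J c ∩ J c₀)) :=
        ((hM c c₀).mul (hc₀N.mono fun x hx => ⟨hx.1, hx.2.2⟩)).congr (hNM c)
      refine (h1 t ⟨ht.1, ht.2, htJ⟩).mono_of_mem_nhdsWithin ?_
      filter_upwards [self_mem_nhdsWithin, mem_nhdsWithin_of_mem_nhds ((hJ c₀).mem_nhds htJ)]
        with x hx hx'
      exact ⟨hx.1, hx.2, hx'⟩
  · rcases le_total t s with h | h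
    · rw [hN'l c t h]
      exact hN.isUnit c t ⟨⟨ht.1.1, h⟩, ht.2⟩
    · rw [hN'r c t ⟨⟨h, ht.1.2⟩, ht.2⟩]
      exact (hMu c t ⟨ht.1, ht.2, hc₀ ⟨h, ht.1.2⟩⟩).mul ((hN.isUnit c₀ s hs).mul (hθu _))
  · rcases le_total t s with h | h
    · rw [hN'l c t h]
      exact hN.mem c t ⟨⟨ht.1.1, h⟩, ht.2⟩ x hx
    · rw [hN'r c t ⟨⟨h, ht.1.2⟩, ht.2⟩]
      refine hMS c c₀ t ⟨ht.1, ht.2, hc₀ ⟨h, ht.1.2⟩⟩ _ (hN.mem c₀ s hs _ ?_)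
      exact S.add_mem hx (S.smul_mem _ (hXS x hx))
  · rcases le_total t s with h | h
    · rw [hN'l c t h, hN'l c' t h, hN.mul_eq c c' t ⟨⟨ht.1.1, h⟩, ht.2⟩]
    · have htJ := hc₀ ⟨h, ht.1.2⟩
      rw [hN'r c t ⟨⟨h, ht.1.2⟩, ht.2.1⟩, hN'r c' t ⟨⟨h, ht.1.2⟩, ht.2.2⟩, ← mul_assoc,
        hMM c c' c₀ t ⟨ht.1, ht.2, htJ⟩]

/-- A cocycle of class `C¹` on a compact interval splits. -/
theorem exists_isSplitting {a b : ℝ} (hab : a ≤ b) (hJ : ∀ c, IsOpen (J c))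
    (hcov : ∀ t ∈ Icc a b, ∃ c, t ∈ J c)
    (hM : ∀ c c', ContDiffOn ℝ 1 (M c c') (Icc a b ∩ (J c ∩ J c')))
    (hM1 : ∀ c, ∀ t ∈ Icc a b ∩ J c, M c c t = 1)
    (hMM : ∀ c c' c'', ∀ t ∈ Icc a b ∩ (J c ∩ J c' ∩ J c''), M c c' t * M c' c'' t = M c c'' t)
    (hMS : ∀ c c', ∀ t ∈ Icc a b ∩ (J c ∩ J c'), ∀ x ∈ S, M c c' t x ∈ S) :
    ∃ N, IsSplitting S J M a b N := by
  -- Lebesgue number: a subdivision each of whose intervals lies in one J c; the splitting is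
  -- extended over these intervals in turn.
  obtain ⟨τ, hτ0, hτm, ⟨k, hk⟩, hτ⟩ := exists_monotone_Icc_subset_open_cover_Icc hab
    (c := fun c => ((↑) : Icc a b → ℝ) ⁻¹' J c) (fun c => (hJ c).preimage continuous_subtype_val)
    (fun t _ => mem_iUnion.2 (hcov t t.2))
  -- Over an interval inside J c₀ the column M c c₀ of the cocycle is itself a splitting. This also
  -- covers the induction step when τ i = a, where `IsSplitting.extend` does not apply.
  have hbase : ∀ (s : ℝ) (c₀ : ι), s ∈ Icc a b → Icc a s ⊆ J c₀ →
      ∃ N, IsSplitting S J M a s N := by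
    intro s c₀ hs hc₀
    have hsub : Icc a s ⊆ Icc a b := Icc_subset_Icc_right hs.2
    refine ⟨fun c => M c c₀, fun c => (hM c c₀).mono fun t ht => ⟨hsub ht.1, ht.2, hc₀ ht.1⟩,
      fun c t ht => ?_, fun c t ht => hMS c c₀ t ⟨hsub ht.1, ht.2, hc₀ ht.1⟩,
      fun c c' t ht => hMM c c' c₀ t ⟨hsub ht.1, ht.2, hc₀ ht.1⟩⟩
    have h0 := hc₀ ht.1
    have h1 := hsub ht.1
    refine isUnit_iff_exists.2 ⟨M c₀ c t, ?_, ?_⟩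
    · rw [hMM c c₀ c t ⟨h1, ⟨ht.2, h0⟩, ht.2⟩, hM1 c t ⟨h1, ht.2⟩]
    · rw [hMM c₀ c c₀ t ⟨h1, ⟨h0, ht.2⟩, h0⟩, hM1 c₀ t ⟨h1, h0⟩]
  have hind : ∀ i : ℕ, ∃ N, IsSplitting S J M a (τ i) N := by
    intro i
    induction i with
    | zero =>
      obtain ⟨c, hc⟩ := hcov a ⟨le_rfl, hab⟩
      rw [hτ0]
      exact hbase a c ⟨le_rfl, hab⟩ (by simpa using hc)
    | succ i ih =>
      obtain ⟨c₀, hc₀⟩ := hτ i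
      have hle : (τ i : ℝ) ≤ τ (i + 1) := hτm (Nat.le_succ i)
      have hc₀' : Icc (τ i : ℝ) (τ (i + 1)) ⊆ J c₀ := fun t ht =>
        hc₀ (show (⟨t, (τ i).2.1.trans ht.1, ht.2.trans (τ (i + 1)).2.2⟩ : Icc a b) ∈ _ from ht)
      rcases (τ i).2.1.lt_or_eq with h | h
      · rcases hle.lt_or_eq with h' | h'
        · obtain ⟨N, hN⟩ := ih
          have hsub : Icc a (τ (i + 1) : ℝ) ⊆ Icc a b := Icc_subset_Icc_right (τ (i + 1)).2.2
          exact hN.extend h h' hJ (fun c c' => (hM c c').mono (inter_subset_inter_left _ hsub))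
            (fun c t ht => hM1 c t ⟨hsub ht.1, ht.2⟩)
            (fun c c' c'' t ht => hMM c c' c'' t ⟨hsub ht.1, ht.2⟩)
            (fun c c' t ht => hMS c c' t ⟨hsub ht.1, ht.2⟩) hc₀'
        · rwa [← h']
      · rw [← h] at hc₀'
        exact hbase _ c₀ (τ (i + 1)).2 hc₀'
  have := hind k
  rwa [hk k le_rfl] at this

end Cocycle

/-! ### Tangent vectors and fields along a path in charts -/

section Charts

variable {n : ℕ} {Q : Type*} [TopologicalSpace Q] [ChartedSpace (E n) Q] [IsManifold (𝓡 n) ∞ Q]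

/-- The fibre coordinate of a tangent vector in the chart at `x₀`. -/
noncomputable def rep (x₀ : Q) (v : TangentBundle (𝓡 n) Q) : E n :=
  (trivializationAt (E n) (TangentSpace (𝓡 n)) x₀ v).2

/-- The fibre coordinates of tangent vectors at `x` in the chart at `x₀`. -/
noncomputable def repL (x₀ x : Q) : E n →L[ℝ] E n :=
  (trivializationAt (E n) (TangentSpace (𝓡 n)) x₀).continuousLinearMapAt ℝ x

theorem two_le_infty : (2 : WithTop ℕ∞) ≤ ∞ := by
  have : ((2 : ℕ∞) : WithTop ℕ∞) ≤ ((⊤ : ℕ∞) : WithTop ℕ∞) := WithTop.coe_le_coe.2 le_top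
  exact this

theorem rep_eq_repL {x₀ : Q} {v : TangentBundle (𝓡 n) Q} (hv : v.proj ∈ (chartAt (E n) x₀).source) :
    rep x₀ v = repL x₀ v.proj v.2 := by
  have hv' : v.proj ∈ (trivializationAt (E n) (TangentSpace (𝓡 n)) x₀).baseSet := hv
  exact (congrFun (Bundle.Trivialization.coe_linearMapAt_of_mem (R := ℝ) _ hv') v.2).symm

theorem repL_eq_mfderiv {x₀ x : Q} (hx : x ∈ (chartAt (E n) x₀).source) :
    repL x₀ x = mfderiv (𝓡 n) 𝓘(ℝ, E n) (extChartAt (𝓡 n) x₀) x :=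
  TangentBundle.continuousLinearMapAt_trivializationAt hx

theorem rep_self (v : TangentBundle (𝓡 n) Q) : rep v.proj v = v.2 :=
  congrArg Prod.snd ((tangentBundleCore (𝓡 n) Q).localTrivAt_apply v)

theorem repL_self (x : Q) (v : E n) : repL x x v = v := by
  have h := rep_eq_repL (x₀ := x) (v := (⟨x, v⟩ : TangentBundle (𝓡 n) Q)) (mem_chart_source _ x)
  exact h.symm.trans (rep_self (⟨x, v⟩ : TangentBundle (𝓡 n) Q))

theorem repL_injective {x₀ x : Q} (hx : x ∈ (chartAt (E n) x₀).source) :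
    Function.Injective (repL x₀ x : E n → E n) := by
  rw [repL_eq_mfderiv hx]
  exact (isInvertible_mfderiv_extChartAt (I := 𝓡 n) (by simpa using hx)).injective

theorem extChartAt_tangent (v₀ v : TangentBundle (𝓡 n) Q) :
    extChartAt (𝓡 n).tangent v₀ v = (extChartAt (𝓡 n) v₀.proj v.proj, rep v₀.proj v) := rfl

theorem mem_extChartAt_tangent_source {v₀ v : TangentBundle (𝓡 n) Q} :
    v ∈ (extChartAt (𝓡 n).tangent v₀).source ↔ v.proj ∈ (chartAt (E n) v₀.proj).source := by
  rw [extChartAt_source]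
  exact TangentBundle.mem_chart_source_iff v v₀

theorem rep_velocity {t₁ t₂ t : ℝ} {η : ℝ → Q} {x₀ : Q}
    (hη : MDifferentiableWithinAt 𝓘(ℝ, ℝ) (𝓡 n) η (Icc t₁ t₂) t)
    (hx : η t ∈ (chartAt (E n) x₀).source) :
    HasDerivWithinAt (fun τ => extChartAt (𝓡 n) x₀ (η τ)) (rep x₀ (dot t₁ t₂ η t))
      (Icc t₁ t₂) t := by
  have h1 : HasMFDerivAt (𝓡 n) 𝓘(ℝ, E n) (extChartAt (𝓡 n) x₀) (η t) _ :=
    (mdifferentiableAt_extChartAt (I := 𝓡 n) hx).hasMFDerivAt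
  have h2 := h1.comp_hasMFDerivWithinAt t hη.hasMFDerivWithinAt
  rw [rep_eq_repL (by exact hx), repL_eq_mfderiv (by exact hx)]
  obtain ⟨A, hA, hA'⟩ : ∃ A : ℝ →L[ℝ] E n,
      HasFDerivWithinAt (fun τ => extChartAt (𝓡 n) x₀ (η τ)) A (Icc t₁ t₂) t ∧
        A 1 = mfderiv (𝓡 n) 𝓘(ℝ, E n) (extChartAt (𝓡 n) x₀) (η t) (dot t₁ t₂ η t).2 :=
    ⟨_, hasMFDerivWithinAt_iff_hasFDerivWithinAt.1 h2, rfl⟩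
  exact hA.hasDerivWithinAt.congr_deriv hA'

/-- A derivative at time `0` in place of a derivative within an interval. -/
theorem rep_mfderiv {η : ℝ → Q} {x₀ : Q} {t : ℝ}
    (hη : MDifferentiableAt 𝓘(ℝ, ℝ) (𝓡 n) η t) (hx : η t ∈ (chartAt (E n) x₀).source) :
    HasDerivAt (fun τ => extChartAt (𝓡 n) x₀ (η τ))
      (repL x₀ (η t) (mfderiv 𝓘(ℝ, ℝ) (𝓡 n) η t (1 : ℝ))) t := by
  have h1 : HasMFDerivAt (𝓡 n) 𝓘(ℝ, E n) (extChartAt (𝓡 n) x₀) (η t) _ :=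
    (mdifferentiableAt_extChartAt (I := 𝓡 n) hx).hasMFDerivAt
  have h2 := h1.comp t hη.hasMFDerivAt
  rw [repL_eq_mfderiv (by exact hx)]
  obtain ⟨A, hA, hA'⟩ : ∃ A : ℝ →L[ℝ] E n,
      HasFDerivAt (fun τ => extChartAt (𝓡 n) x₀ (η τ)) A t ∧
        A 1 = mfderiv (𝓡 n) 𝓘(ℝ, E n) (extChartAt (𝓡 n) x₀) (η t)
          (mfderiv 𝓘(ℝ, ℝ) (𝓡 n) η t (1 : ℝ)) :=
    ⟨_, hasMFDerivAt_iff_hasFDerivAt.1 h2, rfl⟩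
  exact hA.hasDerivAt.congr_deriv hA'

/-- The coordinates of a tangent vector in the preferred chart at its base point. -/
def vec {x : Q} (v : TangentSpace (𝓡 n) x) : E n := v

/-- The derivative of a field along a path in the preferred chart at the base point. -/
noncomputable def fieldDeriv (t₁ t₂ : ℝ) (γ : ℝ → Q) (w : ∀ t : ℝ, TangentSpace (𝓡 n) (γ t)) (t : ℝ) : E n :=
  derivWithin (fun τ => rep (γ t) (lift γ w τ)) (Icc t₁ t₂) t

/-- The base component is γ, already of class C¹, so the regularity of a field reduces to its fibre
coordinate; at the time t the chart at γ(t) is enough. -/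
theorem isFieldAlong_iff {t₁ t₂ : ℝ} {γ : ℝ → Q} {w : ∀ t : ℝ, TangentSpace (𝓡 n) (γ t)}
    (hγ : ContMDiffOn 𝓘(ℝ, ℝ) (𝓡 n) 1 γ (Icc t₁ t₂)) :
    IsFieldAlong t₁ t₂ γ w ↔ ∀ t ∈ Icc t₁ t₂,
      ContDiffWithinAt ℝ 1 (fun τ => rep (γ t) (lift γ w τ)) (Icc t₁ t₂) t := by
  refine forall₂_congr fun t h => ?_
  refine Bundle.contMDiffWithinAt_totalSpace.trans ?_
  rw [contMDiffWithinAt_iff_contDiffWithinAt]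
  exact and_iff_right (hγ t h)

theorem isFieldAlong_rep {t₁ t₂ : ℝ} {γ : ℝ → Q} {w : ∀ t : ℝ, TangentSpace (𝓡 n) (γ t)}
    (hw : IsFieldAlong t₁ t₂ γ w) {t : ℝ} (h : t ∈ Icc t₁ t₂) {x₀ : Q}
    (hx : γ t ∈ (chartAt (E n) x₀).source) :
    ContDiffWithinAt ℝ 1 (fun τ => rep x₀ (lift γ w τ)) (Icc t₁ t₂) t := by
  rw [← contMDiffWithinAt_iff_contDiffWithinAt]
  have h1 := hw t h
  have h2 : ContMDiffWithinAt 𝓘(ℝ, ℝ) 𝓘(ℝ, E n × E n) 1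
      (fun τ => extChartAt (𝓡 n).tangent (⟨x₀, 0⟩ : TangentBundle (𝓡 n) Q) (lift γ w τ))
      (Icc t₁ t₂) t := by
    have h3 := (contMDiffAt_extChartAt' (I := (𝓡 n).tangent) (n := 1)
      (x := (⟨x₀, 0⟩ : TangentBundle (𝓡 n) Q)) (x' := lift γ w t)
      ((TangentBundle.mem_chart_source_iff _ _).2 hx))
    exact h3.comp_contMDiffWithinAt t h1
  rw [contMDiffWithinAt_iff_contDiffWithinAt] at h2 ⊢
  exact h2.snd

/-- In the chart at γ(t) the velocity of the lift is (γ, w; γ', w'), and s exchanges the middle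
entries. Preferred charts are used throughout, so that no coordinate change intervenes; all later
computations use this pair of components. -/
theorem involutionDot_eq {t₁ t₂ t : ℝ} (ht : t₁ < t₂) (h : t ∈ Icc t₁ t₂) {γ : ℝ → Q}
    {w : ∀ t : ℝ, TangentSpace (𝓡 n) (γ t)}
    (hγ : ContMDiffOn 𝓘(ℝ, ℝ) (𝓡 n) 1 γ (Icc t₁ t₂)) (hw : IsFieldAlong t₁ t₂ γ w) :
    involutionDot t₁ t₂ γ w t =
      ⟨dot t₁ t₂ γ t, ((vec (n := n) (w t), fieldDeriv t₁ t₂ γ w t) : E n × E n)⟩ := by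
  have hu := uniqueDiffOn_Icc ht t h
  have h1 : MDifferentiableWithinAt 𝓘(ℝ, ℝ) (𝓡 n).tangent (lift γ w) (Icc t₁ t₂) t :=
    (hw t h).mdifferentiableWithinAt one_ne_zero
  have h1' : MDifferentiableWithinAt 𝓘(ℝ, ℝ) (𝓡 n) γ (Icc t₁ t₂) t :=
    (hγ t h).mdifferentiableWithinAt one_ne_zero
  have h2 := (isFieldAlong_iff hγ).1 hw t h
  have h3 := rep_velocity h1' (x₀ := γ t) (by simp)
  have h4 : HasDerivWithinAt
      (fun τ => extChartAt (𝓡 n).tangent (lift γ w t) (lift γ w τ))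
      (rep (γ t) (dot t₁ t₂ γ t), fieldDeriv t₁ t₂ γ w t) (Icc t₁ t₂) t :=
    h3.prodMk (h2.differentiableWithinAt one_ne_zero).hasDerivWithinAt
  have h5 : (mfderivWithin 𝓘(ℝ, ℝ) (𝓡 n).tangent (lift γ w) (Icc t₁ t₂) t (1 : ℝ) : E n × E n)
      = (rep (γ t) (dot t₁ t₂ γ t), fieldDeriv t₁ t₂ γ w t) := by
    have h6 : mfderivWithin 𝓘(ℝ, ℝ) (𝓡 n).tangent (lift γ w) (Icc t₁ t₂) t =
        fderivWithin ℝ (fun τ => extChartAt (𝓡 n).tangent (lift γ w t) (lift γ w τ))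
          (Icc t₁ t₂) t := by
      refine (if_pos h1).trans ?_
      congr 1
      simp only [modelWithCornersSelf_coe, range_id, inter_univ]
      rfl
    rw [← h4.derivWithin hu, derivWithin]
    exact DFunLike.congr_fun h6 (1 : ℝ)
  have h6 : rep (γ t) (dot (n := n) t₁ t₂ γ t) = (dot (n := n) t₁ t₂ γ t).2 :=
    rep_self (dot (n := n) t₁ t₂ γ t)
  have h7 : (velocity (𝓡 n).tangent t₁ t₂ (lift γ w) t).2 = (((dot (n := n) t₁ t₂ γ t).2 : E n),
    fieldDeriv t₁ t₂ γ w t) := h5.trans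
      (congrArg (fun z : E n => (z, fieldDeriv t₁ t₂ γ w t)) h6)
  -- The base point occurs in the type of the fibre component, so the equality is generalized before
  -- it is substituted.
  have h8 : ∀ (x : E n × E n) (y z u : E n), x = (y, z) →
      (⟨⟨γ t, x.1⟩, ((u, x.2) : E n × E n)⟩ :
        TangentBundle (𝓡 n).tangent (TangentBundle (𝓡 n) Q)) =
      ⟨⟨γ t, y⟩, ((u, z) : E n × E n)⟩ := by
    rintro x y z u rfl
    rfl
  exact h8 _ _ _ _ h7

theorem fieldDeriv_sum {t₁ t₂ t : ℝ} (ht : t₁ < t₂) (h : t ∈ Icc t₁ t₂) {γ : ℝ → Q}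
    (hγ : ContMDiffOn 𝓘(ℝ, ℝ) (𝓡 n) 1 γ (Icc t₁ t₂)) {κ : Type*} [Fintype κ] (f : κ → ℝ → ℝ)
    (e : κ → ∀ t : ℝ, TangentSpace (𝓡 n) (γ t)) (hf : ∀ k, ContDiffOn ℝ 1 (f k) (Icc t₁ t₂))
    (he : ∀ k, IsFieldAlong t₁ t₂ γ (e k)) :
    IsFieldAlong t₁ t₂ γ (fun t => ∑ k, f k t • e k t) ∧
    fieldDeriv t₁ t₂ γ (fun t => ∑ k, f k t • e k t) t =
      ∑ k, (f k t • fieldDeriv t₁ t₂ γ (e k) t +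
        derivWithin (f k) (Icc t₁ t₂) t • vec (n := n) (e k t)) := by
  have key : ∀ s ∈ Icc t₁ t₂, (fun τ => rep (γ s) (lift γ (fun t => ∑ k, f k t • e k t) τ))
      =ᶠ[nhdsWithin s (Icc t₁ t₂)] fun τ => ∑ k, f k τ • rep (γ s) (lift γ (e k) τ) := by
    intro s hs
    have h1 : ∀ᶠ τ in nhdsWithin s (Icc t₁ t₂), γ τ ∈ (chartAt (E n) (γ s)).source :=
      (hγ s hs).continuousWithinAt.preimage_mem_nhdsWithin
        ((chartAt (E n) (γ s)).open_source.mem_nhds (by simp))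
    filter_upwards [h1] with τ hτ
    rw [rep_eq_repL (by exact hτ)]
    simp only [fun k => rep_eq_repL (x₀ := γ s) (v := lift γ (e k) τ) hτ]
    erw [map_sum]
    exact Finset.sum_congr rfl fun k _ => map_smul _ _ _
  refine ⟨(isFieldAlong_iff hγ).2 fun s hs => ?_, ?_⟩
  · refine ContDiffWithinAt.congr_of_eventuallyEq ?_ (key s hs) ((key s hs).self_of_nhdsWithin hs)
    exact ContDiffWithinAt.sum fun k _ => (hf k s hs).smul ((isFieldAlong_iff hγ).1 (he k) s hs)
  · unfold fieldDeriv
    rw [Filter.EventuallyEq.derivWithin_eq (key t h) ((key t h).self_of_nhdsWithin h)]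
    refine (HasDerivWithinAt.fun_sum fun k _ => ?_).derivWithin (uniqueDiffOn_Icc ht t h)
    have h1 := ((hf k).differentiableOn one_ne_zero t h).hasDerivWithinAt
    have h2 := (((isFieldAlong_iff hγ).1 (he k) t h).differentiableWithinAt
      one_ne_zero).hasDerivWithinAt
    have h3 : rep (γ t) (lift γ (e k) t) = vec (n := n) (e k t) := rep_self (lift γ (e k) t)
    have := h1.smul h2
    rw [h3] at this
    exact this

end Charts

/-! ### Differentials and fibre derivatives on TQ; the tangent bundle of C -/

section Differentials

variable {n : ℕ} {Q : Type*} [TopologicalSpace Q] [ChartedSpace (E n) Q] [IsManifold (𝓡 n) ∞ Q]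

/-- The differential of a function on `TQ` at `v`, in the coordinates of the preferred chart. -/
noncomputable def diffL (F : TangentBundle (𝓡 n) Q → ℝ) (v : TangentBundle (𝓡 n) Q) :
    E n × E n →L[ℝ] ℝ :=
  differentialAt F v

/-- The local expression of a function on `TQ` in the natural chart at `v₀`. -/
noncomputable def localExpr (v₀ : TangentBundle (𝓡 n) Q) (F : TangentBundle (𝓡 n) Q → ℝ) :
    E n × E n → ℝ :=
  fun p => F ((extChartAt (𝓡 n).tangent v₀).symm p)

theorem localExpr_extChartAt {v₀ v : TangentBundle (𝓡 n) Q} (F : TangentBundle (𝓡 n) Q → ℝ)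
    (hv : v.proj ∈ (chartAt (E n) v₀.proj).source) :
    localExpr v₀ F (extChartAt (𝓡 n).tangent v₀ v) = F v := by
  unfold localExpr
  rw [(extChartAt (𝓡 n).tangent v₀).left_inv (mem_extChartAt_tangent_source.2 hv)]

theorem contDiffAt_localExpr {v₀ v : TangentBundle (𝓡 n) Q} {F : TangentBundle (𝓡 n) Q → ℝ}
    {k : WithTop ℕ∞} (hk : k ≤ 2) (hv : v.proj ∈ (chartAt (E n) v₀.proj).source)
    (hF : ContMDiffAt (𝓡 n).tangent 𝓘(ℝ, ℝ) k F v) :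
    ContDiffAt ℝ k (localExpr v₀ F) (extChartAt (𝓡 n).tangent v₀ v) := by
  have : IsManifold (𝓡 n).tangent k (TangentBundle (𝓡 n) Q) := IsManifold.of_le hk
  have hs := mem_extChartAt_tangent_source.2 hv
  have h1 : ContMDiffAt 𝓘(ℝ, E n × E n) (𝓡 n).tangent k (extChartAt (𝓡 n).tangent v₀).symm
      (extChartAt (𝓡 n).tangent v₀ v) :=
    (contMDiffOn_extChartAt_symm v₀).contMDiffAt
      ((isOpen_extChartAt_target v₀).mem_nhds ((extChartAt (𝓡 n).tangent v₀).map_source hs))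
  rw [← contMDiffAt_iff_contDiffAt]
  refine ContMDiffAt.comp _ (I' := (𝓡 n).tangent) ?_ h1
  rwa [(extChartAt (𝓡 n).tangent v₀).left_inv hs]

theorem hasFDerivAt_localExpr {v : TangentBundle (𝓡 n) Q} {F : TangentBundle (𝓡 n) Q → ℝ}
    (hF : ContMDiffAt (𝓡 n).tangent 𝓘(ℝ, ℝ) 1 F v) :
    HasFDerivAt (localExpr v F) (diffL F v) (extChartAt (𝓡 n).tangent v v) := by
  have h1 := (contDiffAt_localExpr one_le_two (mem_chart_source _ v.proj) hF).differentiableAt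
    one_ne_zero
  have h2 : diffL F v = fderiv ℝ (localExpr v F) (extChartAt (𝓡 n).tangent v v) := by
    have h3 := hF.mdifferentiableAt one_ne_zero
    refine (if_pos h3).trans ?_
    rw [← fderivWithin_univ]
    congr 1
    exact (𝓡 n).tangent.range_eq_univ
  rw [h2]
  exact h1.hasFDerivAt

theorem hasDerivWithinAt_comp {F : TangentBundle (𝓡 n) Q → ℝ} {c : ℝ → TangentBundle (𝓡 n) Q}
    {t : ℝ} {J : Set ℝ} {ξ : E n × E n} (hF : ContMDiffAt (𝓡 n).tangent 𝓘(ℝ, ℝ) 1 F (c t))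
    (hc : ContinuousWithinAt c J t) (htJ : t ∈ J)
    (h : HasDerivWithinAt (fun s => extChartAt (𝓡 n).tangent (c t) (c s)) ξ J t) :
    HasDerivWithinAt (fun s => F (c s)) (diffL F (c t) ξ) J t := by
  have h1 := (hasFDerivAt_localExpr hF).comp_hasDerivWithinAt t h
  have h2 : ∀ᶠ s in nhdsWithin t J, (c s).proj ∈ (chartAt (E n) (c t).proj).source := by
    have h3 := hc.preimage_mem_nhdsWithin (extChartAt_source_mem_nhds (I := (𝓡 n).tangent) (c t))
    filter_upwards [h3] with s hs
    exact mem_extChartAt_tangent_source.1 hs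
  have h4 : (fun s => F (c s)) =ᶠ[nhdsWithin t J]
      localExpr (c t) F ∘ fun s => extChartAt (𝓡 n).tangent (c t) (c s) := by
    filter_upwards [h2] with s hs
    exact (localExpr_extChartAt F hs).symm
  exact h1.congr_of_eventuallyEq h4 (h4.self_of_nhdsWithin htJ)

/-- The chart is fixed at v₀ while v moves. The expression in preferred coordinates uses a chart
that may jump with the base point, so it could not be differentiated along a path. -/
theorem fibreDerivative_eq {v₀ v : TangentBundle (𝓡 n) Q} {F : TangentBundle (𝓡 n) Q → ℝ}
    (hv : v.proj ∈ (chartAt (E n) v₀.proj).source)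
    (hF : ContMDiffAt (𝓡 n).tangent 𝓘(ℝ, ℝ) 1 F v) (u : E n) :
    fibreDerivative F v u = fderiv ℝ (localExpr v₀ F) (extChartAt (𝓡 n).tangent v₀ v)
      (0, repL v₀.proj v.proj u) := by
  have h1 := ((contDiffAt_localExpr one_le_two hv hF).differentiableAt one_ne_zero).hasFDerivAt
  let j : E n → E n × E n := fun u => (extChartAt (𝓡 n) v₀.proj v.proj, repL v₀.proj v.proj u)
  have hj : ∀ u : E n, F (⟨v.proj, u⟩ : TangentBundle (𝓡 n) Q) = localExpr v₀ F (j u) := fun u => by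
    rw [← localExpr_extChartAt (v₀ := v₀) (v := (⟨v.proj, u⟩ : TangentBundle (𝓡 n) Q)) F hv]
    rw [extChartAt_tangent, rep_eq_repL (v := (⟨v.proj, u⟩ : TangentBundle (𝓡 n) Q)) hv]
  have hjv : j (vec (n := n) v.2) = extChartAt (𝓡 n).tangent v₀ v := by
    rw [extChartAt_tangent, rep_eq_repL hv]
    rfl
  have hjd : HasFDerivAt j ((0 : E n →L[ℝ] E n).prod (repL v₀.proj v.proj)) (vec (n := n) v.2) :=
    (hasFDerivAt_const _ _).prodMk (repL v₀.proj v.proj).hasFDerivAt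
  rw [← hjv] at h1
  have h2 := h1.comp (vec (n := n) v.2) hjd
  have h3 : (fun u : E n => F (⟨v.proj, u⟩ : TangentBundle (𝓡 n) Q)) = localExpr v₀ F ∘ j :=
    funext hj
  have h4 : fibreDerivative F v u = fderiv ℝ (localExpr v₀ F ∘ j) (vec (n := n) v.2) u := by
    rw [← h3]; rfl
  rw [h4, h2.fderiv, hjv]
  rfl

theorem fibreDerivative_eq_diffL {v : TangentBundle (𝓡 n) Q} {F : TangentBundle (𝓡 n) Q → ℝ}
    (hF : ContMDiffAt (𝓡 n).tangent 𝓘(ℝ, ℝ) 1 F v) (u : E n) :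
    fibreDerivative F v u = diffL F v (0, u) := by
  rw [fibreDerivative_eq (mem_chart_source _ v.proj) hF, repL_self,
    (hasFDerivAt_localExpr hF).fderiv]

theorem diffL_extendedLagrangian {m : ℕ} {L : TangentBundle (𝓡 n) Q → ℝ}
    {φ : Fin m → TangentBundle (𝓡 n) Q → ℝ} (μ : Fin m → ℝ → ℝ) (t : ℝ)
    {v : TangentBundle (𝓡 n) Q} (hL : ContMDiffAt (𝓡 n).tangent 𝓘(ℝ, ℝ) 1 L v)
    (hφ : ∀ i, ContMDiffAt (𝓡 n).tangent 𝓘(ℝ, ℝ) 1 (φ i) v) :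
    ContMDiffAt (𝓡 n).tangent 𝓘(ℝ, ℝ) 1 (extendedLagrangian L φ μ t) v ∧
      diffL (extendedLagrangian L φ μ t) v = diffL L v + ∑ i, μ i t • diffL (φ i) v := by
  have h1 : ContMDiffAt (𝓡 n).tangent 𝓘(ℝ, ℝ) 1 (extendedLagrangian L φ μ t) v := by
    unfold extendedLagrangian
    refine hL.add (contMDiffAt_finsetSum fun i _ => ?_)
    exact (contMDiffAt_const (c := μ i t)).mul (hφ i)
  refine ⟨h1, (hasFDerivAt_localExpr h1).unique ?_⟩
  have h2 : localExpr v (extendedLagrangian L φ μ t) =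
      fun p => localExpr v L p + ∑ i, μ i t * localExpr v (φ i) p := rfl
  rw [h2]
  exact (hasFDerivAt_localExpr hL).fun_add
    (HasFDerivAt.fun_sum fun i _ => (hasFDerivAt_localExpr (hφ i)).const_mul (μ i t))

theorem contMDiffOn_dot {t₁ t₂ : ℝ} (ht : t₁ < t₂) {γ : ℝ → Q}
    (hγ : ContMDiffOn 𝓘(ℝ, ℝ) (𝓡 n) 2 γ (Icc t₁ t₂)) :
    ContMDiffOn 𝓘(ℝ, ℝ) (𝓡 n).tangent 1 (dot (n := n) t₁ t₂ γ) (Icc t₁ t₂) := by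
  have h1 := hγ.contMDiffOn_tangentMapWithin (m := 1) (by norm_num [one_add_one_eq_two])
    (uniqueMDiffOn_iff_uniqueDiffOn.2 (uniqueDiffOn_Icc ht))
  have h2 : ContMDiff 𝓘(ℝ, ℝ) 𝓘(ℝ, ℝ).tangent 1
      (fun t : ℝ => (⟨t, (1 : ℝ)⟩ : TangentBundle 𝓘(ℝ, ℝ) ℝ)) :=
    contMDiff_vectorSpace_iff_contDiff.2 contDiff_const
  exact h1.comp h2.contMDiffOn fun t h => h

/-- In a fixed chart this is the derivative of a C² function, evaluated along the C¹ curve γ̇ on the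
C¹ coordinates of w. Here the C² hypotheses on both F and γ enter. -/
theorem contDiffOn_fibreDerivative {t₁ t₂ : ℝ} (ht : t₁ < t₂) {γ : ℝ → Q}
    (hγ : ContMDiffOn 𝓘(ℝ, ℝ) (𝓡 n) 2 γ (Icc t₁ t₂)) {w : ∀ t : ℝ, TangentSpace (𝓡 n) (γ t)}
    (hw : IsFieldAlong t₁ t₂ γ w) {U : Set (TangentBundle (𝓡 n) Q)} (hU : IsOpen U)
    {F : TangentBundle (𝓡 n) Q → ℝ} (hF : ContMDiffOn (𝓡 n).tangent 𝓘(ℝ, ℝ) 2 F U) :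
    ContDiffOn ℝ 1 (fun t => fibreDerivative F (dot (n := n) t₁ t₂ γ t) (w t)) (timesIn t₁ t₂ γ U) := by
  rintro t ⟨h, htU⟩
  suffices H : ContDiffWithinAt ℝ 1
      (fun t => fibreDerivative F (dot (n := n) t₁ t₂ γ t) (w t)) (Icc t₁ t₂) t from
    H.mono fun s hs => hs.1
  have hdot := contMDiffOn_dot ht hγ t h
  have hF2 := fun v (hv : v ∈ U) => (hF v hv).contMDiffAt (hU.mem_nhds hv)
  set v₀ : TangentBundle (𝓡 n) Q := dot (n := n) t₁ t₂ γ t with hv₀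
  have h1 : ContDiffAt ℝ 2 (localExpr v₀ F) (extChartAt (𝓡 n).tangent v₀ v₀) :=
    contDiffAt_localExpr le_rfl (mem_chart_source _ v₀.proj) (hF2 v₀ htU)
  have h2 : ContDiffAt ℝ 1 (fderiv ℝ (localExpr v₀ F)) (extChartAt (𝓡 n).tangent v₀ v₀) :=
    h1.fderiv_right (by norm_num [one_add_one_eq_two])
  have h3 : ContDiffWithinAt ℝ 1 (fun τ => extChartAt (𝓡 n).tangent v₀ (dot (n := n) t₁ t₂ γ τ))
      (Icc t₁ t₂) t := by
    rw [← contMDiffWithinAt_iff_contDiffWithinAt]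
    exact (contMDiffAt_extChartAt (n := 1) (x := v₀)).comp_contMDiffWithinAt t hdot
  have h4 : ContDiffWithinAt ℝ 1 (fun τ => rep (γ t) (lift γ w τ)) (Icc t₁ t₂) t :=
    isFieldAlong_rep hw h (mem_chart_source _ _)
  have h5 : ContDiffWithinAt ℝ 1 (fun τ => fderiv ℝ (localExpr v₀ F)
      (extChartAt (𝓡 n).tangent v₀ (dot (n := n) t₁ t₂ γ τ)) ((0 : E n), rep (γ t) (lift γ w τ)))
      (Icc t₁ t₂) t :=
    (h2.comp_contDiffWithinAt t h3).clm_apply (contDiffWithinAt_const.prodMk h4)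
  have h6 : ∀ᶠ τ in nhdsWithin t (Icc t₁ t₂), γ τ ∈ (chartAt (E n) (γ t)).source :=
    (hγ t h).continuousWithinAt.preimage_mem_nhdsWithin
      ((chartAt (E n) (γ t)).open_source.mem_nhds (mem_chart_source _ _))
  have h7 : ∀ᶠ τ in nhdsWithin t (Icc t₁ t₂), dot (n := n) t₁ t₂ γ τ ∈ U :=
    hdot.continuousWithinAt.preimage_mem_nhdsWithin (hU.mem_nhds htU)
  have h8 : (fun τ => fibreDerivative F (dot (n := n) t₁ t₂ γ τ) (w τ)) =ᶠ[nhdsWithin t (Icc t₁ t₂)]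
      fun τ => fderiv ℝ (localExpr v₀ F)
      (extChartAt (𝓡 n).tangent v₀ (dot (n := n) t₁ t₂ γ τ)) ((0 : E n), rep (γ t) (lift γ w τ)) := by
    filter_upwards [h6, h7] with τ h6 h7
    rw [rep_eq_repL (v := lift γ w τ) h6]
    exact fibreDerivative_eq (v₀ := v₀) (v := dot (n := n) t₁ t₂ γ τ) h6
      ((hF2 _ h7).of_le one_le_two) _
  exact h5.congr_of_eventuallyEq h8 (h8.self_of_nhdsWithin h)

/-- A constraint of `C` is, to first order, a combination of the members of a system of
constraints. -/
theorem IsConstraintSystem.diffL_mem_span {m : ℕ} {C U V : Set (TangentBundle (𝓡 n) Q)}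
    {φ : Fin m → TangentBundle (𝓡 n) Q → ℝ} (hφ : IsConstraintSystem C U φ)
    {f : TangentBundle (𝓡 n) Q → ℝ} (hf : IsConstraint C V f) {v : TangentBundle (𝓡 n) Q}
    (hvC : v ∈ C) (hvU : v ∈ U) (hvV : v ∈ V) :
    ∃ c : Fin m → ℝ, diffL f v = ∑ i, c i • diffL (φ i) v := by
  have hφd : ∀ i, ContMDiffAt (𝓡 n).tangent 𝓘(ℝ, ℝ) 1 (φ i) v := fun i =>
    ((hφ.contMDiffOn i v hvU).contMDiffAt (hφ.isOpen.mem_nhds hvU)).of_le one_le_two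
  have hfd : ContMDiffAt (𝓡 n).tangent 𝓘(ℝ, ℝ) 1 f v :=
    ((hf.2.1 v hvV).contMDiffAt (hf.1.mem_nhds hvV)).of_le one_le_two
  have hs : ∀ {g : TangentBundle (𝓡 n) Q → ℝ}, ContMDiffAt (𝓡 n).tangent 𝓘(ℝ, ℝ) 1 g v →
      HasStrictFDerivAt (localExpr v g) (diffL g v) (extChartAt (𝓡 n).tangent v v) := fun {g} hg =>
    (contDiffAt_localExpr one_le_two (mem_chart_source _ v.proj) hg).hasStrictFDerivAt'
      (hasFDerivAt_localExpr hg) one_ne_zero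
  have hval : ∀ g : TangentBundle (𝓡 n) Q → ℝ,
      localExpr v g (extChartAt (𝓡 n).tangent v v) = g v := fun g =>
    localExpr_extChartAt g (mem_chart_source _ v.proj)
  have hcont : ContinuousAt (extChartAt (𝓡 n).tangent v).symm (extChartAt (𝓡 n).tangent v v) :=
    continuousAt_extChartAt_symm v
  have hUV : U ∩ V ∈ nhds ((extChartAt (𝓡 n).tangent v).symm (extChartAt (𝓡 n).tangent v v)) := by
    rw [extChartAt_to_inv]
    exact (hφ.isOpen.inter hf.1).mem_nhds ⟨hvU, hvV⟩
  -- As f vanishes on C, it is constant on the zero set of the φ^i near v. So v is a degenerate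
  -- constrained extremum, and Lagrange's multiplier rule applies.
  have hextr : IsLocalExtrOn (localExpr v f)
      {p | ∀ i, localExpr v (φ i) p = localExpr v (φ i) (extChartAt (𝓡 n).tangent v v)}
      (extChartAt (𝓡 n).tangent v v) := by
    left
    have h1 := hcont.preimage_mem_nhds hUV
    refine Filter.mem_of_superset (Filter.inter_mem (mem_nhdsWithin_of_mem_nhds h1)
      self_mem_nhdsWithin) ?_
    rintro p ⟨hp, hp'⟩
    have h2 : (extChartAt (𝓡 n).tangent v).symm p ∈ C := by
      refine (hφ.mem_iff _ hp.1).2 fun i => ?_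
      have := hp' i
      rw [hval, (hφ.mem_iff v hvU).1 hvC i] at this
      exact this
    have h3 : localExpr v f p = 0 := hf.2.2 _ ⟨h2, hp.2⟩
    have h4 : localExpr v f (extChartAt (𝓡 n).tangent v v) = 0 := by
      rw [hval]
      exact hf.2.2 v ⟨hvC, hvV⟩
    exact (h4.trans h3.symm).le
  obtain ⟨Λ, Λ₀, hne, hsum⟩ := hextr.exists_multipliers_of_hasStrictFDerivAt
    (fun i => hs (hφd i)) (hs hfd)
  have hli : LinearIndependent ℝ fun i => diffL (φ i) v := hφ.linearIndependent v ⟨hvC, hvU⟩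
  -- If the multiplier of f were zero, the rule would give a relation among the independent
  -- differentials of the φ^i.
  have hΛ₀ : Λ₀ ≠ 0 := by
    rintro rfl
    rw [zero_smul, add_zero] at hsum
    exact hne (Prod.ext (funext fun i => Fintype.linearIndependent_iff.1 hli Λ hsum i) rfl)
  refine ⟨fun i => -(Λ₀⁻¹ * Λ i), ?_⟩
  have h1 : Λ₀ • diffL f v = -∑ i, Λ i • diffL (φ i) v := eq_neg_of_add_eq_zero_right hsum
  calc diffL f v = Λ₀⁻¹ • (Λ₀ • diffL f v) := by rw [smul_smul, inv_mul_cancel₀ hΛ₀, one_smul]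
    _ = _ := by
      rw [h1, smul_neg, Finset.smul_sum, ← Finset.sum_neg_distrib]
      exact Finset.sum_congr rfl fun i _ =>
        (congrArg Neg.neg (smul_smul _ _ _)).trans (neg_smul _ _).symm

theorem IsConstraintSystem.isConstraint {m : ℕ} {C U : Set (TangentBundle (𝓡 n) Q)}
    {φ : Fin m → TangentBundle (𝓡 n) Q → ℝ} (hφ : IsConstraintSystem C U φ) (i : Fin m) :
    IsConstraint C U (φ i) :=
  ⟨hφ.isOpen, hφ.contMDiffOn i, fun v hv => (hφ.mem_iff v hv.2).1 hv.1 i⟩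

/-- `tangentSet` tests against all constraints; by `diffL_mem_span` the members of a single system
suffice. -/
theorem IsConstraintSystem.mem_tangentSet_iff {m : ℕ} {C U : Set (TangentBundle (𝓡 n) Q)}
    {φ : Fin m → TangentBundle (𝓡 n) Q → ℝ} (hφ : IsConstraintSystem C U φ)
    {v : TangentBundle (𝓡 n) Q} (hvC : v ∈ C) (hvU : v ∈ U) (ξ : E n × E n) :
    (⟨v, ξ⟩ : TangentBundle (𝓡 n).tangent (TangentBundle (𝓡 n) Q)) ∈ tangentSet C ↔
      ∀ i, diffL (φ i) v ξ = 0 := by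
  constructor
  · intro h i
    exact h.2 U (φ i) hvU (hφ.isConstraint i)
  · intro h
    refine ⟨hvC, fun V f hV hf => ?_⟩
    obtain ⟨c, hc⟩ := hφ.diffL_mem_span hf hvC hvU hV
    have h1 : diffL f v ξ = 0 := by
      rw [hc]
      simp [h]
    exact h1

theorem mfderiv_proj (v : TangentBundle (𝓡 n) Q) (ξ : E n × E n) :
    (mfderiv (𝓡 n).tangent (𝓡 n) (fun x : TangentBundle (𝓡 n) Q => x.proj) v ξ : E n) = ξ.1 := by
  have h1 : MDifferentiableAt (𝓡 n).tangent (𝓡 n) (fun x : TangentBundle (𝓡 n) Q => x.proj) v :=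
    (Bundle.contMDiff_proj (n := 1) (TangentSpace (𝓡 n) : Q → Type _) v).mdifferentiableAt
      one_ne_zero
  have h2 : HasFDerivAt (writtenInExtChartAt (𝓡 n).tangent (𝓡 n) v
      (fun x : TangentBundle (𝓡 n) Q => x.proj)) (ContinuousLinearMap.fst ℝ (E n) (E n))
      (extChartAt (𝓡 n).tangent v v) := by
    have h3 : writtenInExtChartAt (𝓡 n).tangent (𝓡 n) v
        (fun x : TangentBundle (𝓡 n) Q => x.proj) =ᶠ[nhds (extChartAt (𝓡 n).tangent v v)]
        Prod.fst := by
      filter_upwards [extChartAt_target_mem_nhds (I := (𝓡 n).tangent) v] with p hp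
      have h4 := (extChartAt (𝓡 n).tangent v).right_inv hp
      exact congrArg Prod.fst h4
    exact hasFDerivAt_fst.congr_of_eventuallyEq h3
  have h5 : mfderiv (𝓡 n).tangent (𝓡 n) (fun x : TangentBundle (𝓡 n) Q => x.proj) v =
      ContinuousLinearMap.fst ℝ (E n) (E n) := by
    refine (if_pos h1).trans ?_
    rw [(𝓡 n).tangent.range_eq_univ, fderivWithin_univ]
    exact h2.fderiv
  exact DFunLike.congr_fun h5 ξ

/-- If `C → Q` is a submersion, then the fibre derivatives of the constraints are independent. -/
theorem IsConstraintSystem.eq_zero_of_vertical {m : ℕ} {C U : Set (TangentBundle (𝓡 n) Q)}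
    {φ : Fin m → TangentBundle (𝓡 n) Q → ℝ} (hφ : IsConstraintSystem C U φ)
    (hsub : ProjectionIsSubmersion C) {v : TangentBundle (𝓡 n) Q} (hvC : v ∈ C) (hvU : v ∈ U)
    (c : Fin m → ℝ) (hc : ∀ u : E n, ∑ i, c i * diffL (φ i) v (0, u) = 0) : c = 0 := by
  have hli : LinearIndependent ℝ fun i => diffL (φ i) v := hφ.linearIndependent v ⟨hvC, hvU⟩
  refine funext fun i => Fintype.linearIndependent_iff.1 hli c ?_ i
  refine ContinuousLinearMap.ext fun ξ => ?_
  have h0 : ∀ ξ : E n × E n, (∑ i, c i • diffL (φ i) v) ξ = ∑ i, c i * diffL (φ i) v ξ := by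
    intro ξ
    simp
  rw [h0]
  obtain ⟨ξ₀, h1, h2⟩ := hsub v hvC ξ.1
  have h3 : ∃ ζ : E n × E n, (∀ i, diffL (φ i) v ζ = 0) ∧ ζ.1 = ξ.1 :=
    ⟨ξ₀, (hφ.mem_tangentSet_iff hvC hvU ξ₀).1 h1, (mfderiv_proj v ξ₀).symm.trans h2⟩
  obtain ⟨ζ, h4, h5⟩ := h3
  -- By the submersion hypothesis ξ is a vector tangent to C plus a vertical one. The combination
  -- vanishes on both, hence identically, and independence of the differentials yields c = 0.
  have h6 : ξ = ζ + (0, ξ.2 - ζ.2) := Prod.ext (by simp [h5]) (by simp)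
  rw [h6]
  simp only [map_add, h4, zero_add, hc]
  simp

end Differentials

/-! ### Mixed partial derivatives on a strip -/

section MixedDerivatives

variable {W : Type*} [NormedAddCommGroup W] [NormedSpace ℝ W] {t₁ t₂ δ : ℝ}

theorem uniqueDiffOn_strip (ht : t₁ < t₂) : UniqueDiffOn ℝ (Ioo (-δ) δ ×ˢ Icc t₁ t₂) :=
  isOpen_Ioo.uniqueDiffOn.prod (uniqueDiffOn_Icc ht)

theorem hasDerivWithinAt_strip_right {f : ℝ × ℝ → W} {ε t : ℝ} (hε : ε ∈ Ioo (-δ) δ)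
    (hf : DifferentiableWithinAt ℝ f (Ioo (-δ) δ ×ˢ Icc t₁ t₂) (ε, t)) :
    HasDerivWithinAt (fun τ => f (ε, τ)) (fderivWithin ℝ f (Ioo (-δ) δ ×ˢ Icc t₁ t₂) (ε, t) (0, 1))
      (Icc t₁ t₂) t := by
  have h1 : HasDerivWithinAt (fun τ : ℝ => (ε, τ)) ((0 : ℝ), (1 : ℝ)) (Icc t₁ t₂) t :=
    (hasDerivWithinAt_const t _ ε).prodMk (hasDerivWithinAt_id t _)
  exact hf.hasFDerivWithinAt.comp_hasDerivWithinAt t h1 fun τ hτ => ⟨hε, hτ⟩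

theorem hasDerivAt_strip_left {f : ℝ × ℝ → W} {ε t : ℝ} (hε : ε ∈ Ioo (-δ) δ)
    (ht : t ∈ Icc t₁ t₂)
    (hf : DifferentiableWithinAt ℝ f (Ioo (-δ) δ ×ˢ Icc t₁ t₂) (ε, t)) :
    HasDerivAt (fun e => f (e, t)) (fderivWithin ℝ f (Ioo (-δ) δ ×ˢ Icc t₁ t₂) (ε, t) (1, 0))
      ε := by
  have h1 : HasDerivWithinAt (fun e : ℝ => (e, t)) ((1 : ℝ), (0 : ℝ)) (Ioo (-δ) δ) ε :=
    (hasDerivWithinAt_id ε _).prodMk (hasDerivWithinAt_const ε _ t)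
  have h2 : MapsTo (fun e : ℝ => (e, t)) (Ioo (-δ) δ) (Ioo (-δ) δ ×ˢ Icc t₁ t₂) :=
    fun τ hτ => ⟨hτ, ht⟩
  exact (hf.hasFDerivWithinAt.comp_hasDerivWithinAt ε h1 h2).hasDerivAt
    (Ioo_mem_nhds hε.1 hε.2)

/-- Equality of mixed partial derivatives on a strip, up to its boundary. -/
theorem hasDerivAt_derivWithin_strip (hδ : 0 < δ) (ht : t₁ < t₂) {t : ℝ} (h : t ∈ Icc t₁ t₂)
    {f : ℝ × ℝ → W} (hf : ContDiffWithinAt ℝ 2 f (Ioo (-δ) δ ×ˢ Icc t₁ t₂) (0, t)) :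
    HasDerivAt (fun ε => derivWithin (fun τ => f (ε, τ)) (Icc t₁ t₂) t)
      (derivWithin (fun τ => deriv (fun ε => f (ε, τ)) 0) (Icc t₁ t₂) t) 0 := by
  set S := Ioo (-δ) δ ×ˢ Icc t₁ t₂ with hS
  have h0 : (0 : ℝ) ∈ Ioo (-δ) δ := ⟨by linarith, hδ⟩
  have hxS : ((0 : ℝ), t) ∈ S := ⟨h0, h⟩
  have hu : UniqueDiffOn ℝ S := uniqueDiffOn_strip ht
  have hg : ContDiffWithinAt ℝ 1 (fderivWithin ℝ f S) S (0, t) :=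
    hf.fderivWithin_right hu (by norm_num [one_add_one_eq_two]) hxS
  have hgd := hg.differentiableWithinAt one_ne_zero
  have hev : ∀ᶠ p in nhdsWithin ((0 : ℝ), t) S, DifferentiableWithinAt ℝ f S p := by
    have h1 := hf.eventually (by simp)
    rw [insert_eq_of_mem hxS] at h1
    filter_upwards [h1] with p hp
    exact hp.differentiableWithinAt two_ne_zero
  -- Symmetry of the second derivative also holds at t = t₁ and t = t₂, because these boundary
  -- points lie in the closure of the interior of the strip.
  have hsymm : IsSymmSndFDerivWithinAt ℝ f S (0, t) := by
    refine hf.isSymmSndFDerivWithinAt (by simp) hu ?_ hxS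
    rw [hS, interior_prod_eq, interior_Ioo, interior_Icc, closure_prod_eq, closure_Ioo ht.ne]
    exact ⟨subset_closure h0, h⟩
  have hl : HasDerivAt (fun ε => fderivWithin ℝ f S (ε, t) (0, 1))
      (fderivWithin ℝ (fderivWithin ℝ f S) S (0, t) (1, 0) (0, 1)) 0 := by
    have := (hasDerivAt_strip_left h0 h hgd).clm_apply (hasDerivAt_const 0 ((0 : ℝ), (1 : ℝ)))
    simpa using this
  have hr : HasDerivWithinAt (fun τ => fderivWithin ℝ f S (0, τ) (1, 0))
      (fderivWithin ℝ (fderivWithin ℝ f S) S (0, t) (0, 1) (1, 0)) (Icc t₁ t₂) t := by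
    have := (hasDerivWithinAt_strip_right h0 hgd).clm_apply
      (hasDerivWithinAt_const t (Icc t₁ t₂) ((1 : ℝ), (0 : ℝ)))
    simpa using this
  have el : ∀ᶠ ε in nhds (0 : ℝ), derivWithin (fun τ => f (ε, τ)) (Icc t₁ t₂) t =
      fderivWithin ℝ f S (ε, t) (0, 1) := by
    have hc : Filter.Tendsto (fun ε : ℝ => (ε, t)) (nhds 0) (nhdsWithin ((0 : ℝ), t) S) := by
      refine tendsto_nhdsWithin_iff.2 ⟨Continuous.tendsto (by fun_prop) 0, ?_⟩
      filter_upwards [Ioo_mem_nhds h0.1 h0.2] with ε hε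
      exact ⟨hε, h⟩
    filter_upwards [hc.eventually hev, Ioo_mem_nhds h0.1 h0.2] with ε h1 hε
    exact (hasDerivWithinAt_strip_right hε h1).derivWithin (uniqueDiffOn_Icc ht t h)
  have er : ∀ᶠ τ in nhdsWithin t (Icc t₁ t₂), deriv (fun ε => f (ε, τ)) 0 =
      fderivWithin ℝ f S (0, τ) (1, 0) := by
    have hc : Filter.Tendsto (fun τ : ℝ => ((0 : ℝ), τ)) (nhdsWithin t (Icc t₁ t₂))
        (nhdsWithin ((0 : ℝ), t) S) := by
      refine tendsto_nhdsWithin_iff.2 ⟨Filter.Tendsto.mono_left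
        (Continuous.tendsto (by fun_prop) t) nhdsWithin_le_nhds, ?_⟩
      filter_upwards [self_mem_nhdsWithin] with τ hτ
      exact ⟨h0, hτ⟩
    filter_upwards [hc.eventually hev, self_mem_nhdsWithin] with τ h1 hτ
    exact (hasDerivAt_strip_left h0 hτ h1).deriv
  have er' := (hr.congr_of_eventuallyEq er (er.self_of_nhdsWithin h)).derivWithin
    (uniqueDiffOn_Icc ht t h)
  rw [er', hsymm.eq]
  exact hl.congr_of_eventuallyEq el

end MixedDerivatives

/-! ### The first variation of the action -/

section FirstVariation

variable {n : ℕ} {Q : Type*} [TopologicalSpace Q] [ChartedSpace (E n) Q] [IsManifold (𝓡 n) ∞ Q]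
  {t₁ t₂ δ : ℝ} {γ : ℝ → Q} {Γ : ℝ → ℝ → Q} {w : ∀ t : ℝ, TangentSpace (𝓡 n) (γ t)}

/-- The velocities of a `C²` variation are of class `C¹` in both variables. -/
theorem contMDiffOn_dot_strip (ht : t₁ < t₂)
    (hΓ : ContMDiffOn 𝓘(ℝ, ℝ × ℝ) (𝓡 n) 2 (fun p : ℝ × ℝ => Γ p.1 p.2)
      (Ioo (-δ) δ ×ˢ Icc t₁ t₂)) :
    ContMDiffOn 𝓘(ℝ, ℝ × ℝ) (𝓡 n).tangent 1
      (fun p : ℝ × ℝ => dot (n := n) t₁ t₂ (Γ p.1) p.2) (Ioo (-δ) δ ×ˢ Icc t₁ t₂) := by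
  set S := Ioo (-δ) δ ×ˢ Icc t₁ t₂ with hS
  have h1 := hΓ.contMDiffOn_tangentMapWithin (m := 1) (by norm_num [one_add_one_eq_two])
    (uniqueMDiffOn_iff_uniqueDiffOn.2 (uniqueDiffOn_strip ht))
  -- The velocities are the image under the tangent map of Γ of the constant field (0, 1) on the
  -- strip.
  have h2 : ContMDiff 𝓘(ℝ, ℝ × ℝ) 𝓘(ℝ, ℝ × ℝ).tangent 1
      (fun p : ℝ × ℝ => (⟨p, ((0 : ℝ), (1 : ℝ))⟩ : TangentBundle 𝓘(ℝ, ℝ × ℝ) (ℝ × ℝ))) :=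
    contMDiff_vectorSpace_iff_contDiff.2 contDiff_const
  refine (h1.comp h2.contMDiffOn fun t h => h).congr ?_
  rintro ⟨ε, t⟩ ⟨hε, h⟩
  have h3 : MDifferentiableWithinAt 𝓘(ℝ, ℝ × ℝ) (𝓡 n) (fun p : ℝ × ℝ => Γ p.1 p.2) S (ε, t) :=
    (hΓ (ε, t) ⟨hε, h⟩).mdifferentiableWithinAt two_ne_zero
  have h4 : HasDerivWithinAt (fun τ : ℝ => (ε, τ)) ((0 : ℝ), (1 : ℝ)) (Icc t₁ t₂) t :=
    (hasDerivWithinAt_const t _ ε).prodMk (hasDerivWithinAt_id t _)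
  have h5 := h3.hasMFDerivWithinAt.comp t h4.hasFDerivWithinAt.hasMFDerivWithinAt
    (fun τ hτ => (⟨hε, hτ⟩ : (ε, τ) ∈ S))
  have h6 := h5.mfderivWithin
    ((uniqueMDiffOn_iff_uniqueDiffOn.2 (uniqueDiffOn_Icc ht)) t h)
  have h7 : (mfderivWithin 𝓘(ℝ, ℝ) (𝓡 n) (Γ ε) (Icc t₁ t₂) t (1 : ℝ) : E n) =
      mfderivWithin 𝓘(ℝ, ℝ × ℝ) (𝓡 n) (fun p : ℝ × ℝ => Γ p.1 p.2) S (ε, t)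
        (((1 : ℝ) • ((0 : ℝ), (1 : ℝ)) : ℝ × ℝ)) := DFunLike.congr_fun h6 (1 : ℝ)
  rw [one_smul] at h7
  exact congrArg (fun u : E n => (⟨Γ ε t, u⟩ : TangentBundle (𝓡 n) Q)) h7

theorem dot_congr (hz : ∀ t ∈ Icc t₁ t₂, Γ 0 t = γ t) {t : ℝ} (h : t ∈ Icc t₁ t₂) :
    dot (n := n) t₁ t₂ (Γ 0) t = dot (n := n) t₁ t₂ γ t := by
  have h1 : mfderivWithin 𝓘(ℝ, ℝ) (𝓡 n) (Γ 0) (Icc t₁ t₂) t =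
      mfderivWithin 𝓘(ℝ, ℝ) (𝓡 n) γ (Icc t₁ t₂) t :=
    mfderivWithin_congr hz (hz t h)
  have h2 : ∀ (x y : Q) (u v : E n), x = y → u = v →
      (⟨x, u⟩ : TangentBundle (𝓡 n) Q) = ⟨y, v⟩ := by
    rintro x y u v rfl rfl
    rfl
  exact h2 _ _ _ _ (hz t h) (DFunLike.congr_fun h1 (1 : ℝ))

/-- The derivative of a function along the velocities of a variation. -/
theorem hasDerivAt_comp_dot (hδ : 0 < δ) (ht : t₁ < t₂)
    (hΓ : ContMDiffOn 𝓘(ℝ, ℝ × ℝ) (𝓡 n) 2 (fun p : ℝ × ℝ => Γ p.1 p.2)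
      (Ioo (-δ) δ ×ˢ Icc t₁ t₂))
    (hz : ∀ t ∈ Icc t₁ t₂, Γ 0 t = γ t) (hw : IsVariationFieldOf t₁ t₂ γ Γ w)
    {t : ℝ} (h : t ∈ Icc t₁ t₂) {F : TangentBundle (𝓡 n) Q → ℝ}
    (hF : ContMDiffAt (𝓡 n).tangent 𝓘(ℝ, ℝ) 1 F (dot (n := n) t₁ t₂ γ t)) :
    HasDerivAt (fun ε => F (dot (n := n) t₁ t₂ (Γ ε) t))
      (diffL F (dot (n := n) t₁ t₂ γ t) (vec (n := n) (w t), fieldDeriv t₁ t₂ γ w t)) 0 := by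
  set S := Ioo (-δ) δ ×ˢ Icc t₁ t₂ with hS
  have h0 : (0 : ℝ) ∈ Ioo (-δ) δ := ⟨by linarith, hδ⟩
  have hxS : ((0 : ℝ), t) ∈ S := ⟨h0, h⟩
  have hc0 := dot_congr (n := n) hz h
  -- the local expression of the variation
  let f : ℝ × ℝ → E n := fun p => extChartAt (𝓡 n) (γ t) (Γ p.1 p.2)
  have hΓt : ContMDiffWithinAt 𝓘(ℝ, ℝ × ℝ) (𝓡 n) 2 (fun p : ℝ × ℝ => Γ p.1 p.2) S (0, t) :=
    hΓ (0, t) hxS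
  have hsrc0 : Γ 0 t ∈ (chartAt (E n) (γ t)).source := by
    rw [hz t h]
    exact mem_chart_source _ _
  have hf : ContDiffWithinAt ℝ 2 f S (0, t) := by
    rw [← contMDiffWithinAt_iff_contDiffWithinAt]
    exact (contMDiffAt_extChartAt' (n := 2) hsrc0).comp_contMDiffWithinAt (0, t) hΓt
  have hsrc : ∀ᶠ p in nhdsWithin ((0 : ℝ), t) S, Γ p.1 p.2 ∈ (chartAt (E n) (γ t)).source :=
    hΓt.continuousWithinAt.preimage_mem_nhdsWithin
      ((chartAt (E n) (γ t)).open_source.mem_nhds hsrc0)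
  have hcl : Filter.Tendsto (fun ε : ℝ => (ε, t)) (nhds 0) (nhdsWithin ((0 : ℝ), t) S) := by
    refine tendsto_nhdsWithin_iff.2 ⟨Continuous.tendsto (by fun_prop) 0, ?_⟩
    filter_upwards [Ioo_mem_nhds h0.1 h0.2] with ε hε
    exact ⟨hε, h⟩
  have hcr : Filter.Tendsto (fun τ : ℝ => ((0 : ℝ), τ)) (nhdsWithin t (Icc t₁ t₂))
      (nhdsWithin ((0 : ℝ), t) S) := by
    refine tendsto_nhdsWithin_iff.2 ⟨Filter.Tendsto.mono_left
      (Continuous.tendsto (by fun_prop) t) nhdsWithin_le_nhds, ?_⟩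
    filter_upwards [self_mem_nhdsWithin] with τ hτ
    exact ⟨h0, hτ⟩
  have hmd : ∀ p ∈ S, MDifferentiableWithinAt 𝓘(ℝ, ℝ × ℝ) (𝓡 n) (fun p : ℝ × ℝ => Γ p.1 p.2) S p :=
    fun p hp => (hΓ p hp).mdifferentiableWithinAt two_ne_zero
  -- the variation field
  have hwf : ∀ τ ∈ Icc t₁ t₂, Γ 0 τ ∈ (chartAt (E n) (γ t)).source →
      HasDerivAt (fun ε => f (ε, τ)) (rep (γ t) (lift γ w τ)) 0 := by
    intro τ hτ hs
    have h1 : MDifferentiableAt 𝓘(ℝ, ℝ) (𝓡 n) (fun ε => Γ ε τ) 0 := by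
      have h2 : HasDerivWithinAt (fun e : ℝ => (e, τ)) ((1 : ℝ), (0 : ℝ)) (Ioo (-δ) δ) 0 :=
        (hasDerivWithinAt_id 0 _).prodMk (hasDerivWithinAt_const 0 _ τ)
      have h3' : Ioo (-δ) δ ⊆ (fun e : ℝ => (e, τ)) ⁻¹' S := fun e he => ⟨he, hτ⟩
      have h3 := (hmd (0, τ) ⟨h0, hτ⟩).comp (0 : ℝ)
        h2.differentiableWithinAt.mdifferentiableWithinAt h3'
      exact h3.mdifferentiableAt (Ioo_mem_nhds h0.1 h0.2)
    have h4 := rep_mfderiv h1 hs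
    rw [hw τ hτ, rep_eq_repL (by exact hs)]
    exact h4
  -- the derivatives of the two components
  have e1 : HasDerivAt (fun ε => extChartAt (𝓡 n) (γ t) (Γ ε t)) (vec (n := n) (w t)) 0 := by
    have h1 : rep (γ t) (lift γ w t) = vec (n := n) (w t) := rep_self (lift γ w t)
    rw [← h1]
    exact hwf t h hsrc0
  have e2 : HasDerivAt (fun ε => rep (γ t) (dot (n := n) t₁ t₂ (Γ ε) t))
      (fieldDeriv t₁ t₂ γ w t) 0 := by
    -- Exchanging the derivatives in ε and t identifies the variation of the velocity coordinates
    -- with the time derivative of w; this is where s comes from.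
    have h1 := hasDerivAt_derivWithin_strip hδ ht h hf
    have h2 : derivWithin (fun τ => deriv (fun ε => f (ε, τ)) 0) (Icc t₁ t₂) t =
        fieldDeriv t₁ t₂ γ w t := by
      have h3 : (fun τ => deriv (fun ε => f (ε, τ)) 0) =ᶠ[nhdsWithin t (Icc t₁ t₂)]
          fun τ => rep (γ t) (lift γ w τ) := by
        filter_upwards [hcr.eventually hsrc, self_mem_nhdsWithin] with τ hs hτ
        exact (hwf τ hτ hs).deriv
      exact h3.derivWithin_eq (h3.self_of_nhdsWithin h)
    rw [h2] at h1
    refine h1.congr_of_eventuallyEq ?_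
    filter_upwards [hcl.eventually hsrc, Ioo_mem_nhds h0.1 h0.2] with ε hs hε
    have h4 : MDifferentiableWithinAt 𝓘(ℝ, ℝ) (𝓡 n) (Γ ε) (Icc t₁ t₂) t := by
      have h5 : HasDerivWithinAt (fun τ : ℝ => (ε, τ)) ((0 : ℝ), (1 : ℝ)) (Icc t₁ t₂) t :=
        (hasDerivWithinAt_const t _ ε).prodMk (hasDerivWithinAt_id t _)
      exact (hmd (ε, t) ⟨hε, h⟩).comp t h5.differentiableWithinAt.mdifferentiableWithinAt
        (fun e he => (⟨hε, he⟩ : (ε, e) ∈ S))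
    exact ((rep_velocity h4 hs).derivWithin (uniqueDiffOn_Icc ht t h)).symm
  have hcc : ContinuousAt (fun ε => dot (n := n) t₁ t₂ (Γ ε) t) 0 := by
    have h1 := ((contMDiffOn_dot_strip ht hΓ) (0, t) hxS).continuousWithinAt
    exact h1.tendsto.comp hcl
  have key := hasDerivWithinAt_comp (F := F) (c := fun ε => dot (n := n) t₁ t₂ (Γ ε) t) (t := 0)
    (J := univ) (ξ := (vec (n := n) (w t), fieldDeriv t₁ t₂ γ w t)) (by rw [hc0]; exact hF)
    hcc.continuousWithinAt (mem_univ _) (by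
      rw [hasDerivWithinAt_univ, hc0]
      exact e1.prodMk e2)
  rw [hasDerivWithinAt_univ, hc0] at key
  exact key

theorem contDiffWithinAt_comp_dot (ht : t₁ < t₂)
    (hΓ : ContMDiffOn 𝓘(ℝ, ℝ × ℝ) (𝓡 n) 2 (fun p : ℝ × ℝ => Γ p.1 p.2)
      (Ioo (-δ) δ ×ˢ Icc t₁ t₂)) {F : TangentBundle (𝓡 n) Q → ℝ} {p : ℝ × ℝ}
    (hp : p ∈ Ioo (-δ) δ ×ˢ Icc t₁ t₂)
    (hF : ContMDiffAt (𝓡 n).tangent 𝓘(ℝ, ℝ) 1 F (dot (n := n) t₁ t₂ (Γ p.1) p.2)) :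
    ContDiffWithinAt ℝ 1 (fun p : ℝ × ℝ => F (dot (n := n) t₁ t₂ (Γ p.1) p.2))
      (Ioo (-δ) δ ×ˢ Icc t₁ t₂) p := by
  rw [← contMDiffWithinAt_iff_contDiffWithinAt]
  exact hF.comp_contMDiffWithinAt p (contMDiffOn_dot_strip ht hΓ p hp)

/-- `diffL` and `fieldDeriv` are taken in the preferred chart at γ(t), which may jump with t, so
continuity is not visible from the formula. The contraction is, however, the ε-derivative at 0 of
F(Γ̇_ε(t)), a C¹ function on the strip. -/
theorem continuousOn_diffL_of_variation (hδ : 0 < δ) (ht : t₁ < t₂)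
    (hΓ : ContMDiffOn 𝓘(ℝ, ℝ × ℝ) (𝓡 n) 2 (fun p : ℝ × ℝ => Γ p.1 p.2)
      (Ioo (-δ) δ ×ˢ Icc t₁ t₂))
    (hz : ∀ t ∈ Icc t₁ t₂, Γ 0 t = γ t) (hw : IsVariationFieldOf t₁ t₂ γ Γ w)
    {U : Set (TangentBundle (𝓡 n) Q)} (hU : IsOpen U) {F : TangentBundle (𝓡 n) Q → ℝ}
    (hF : ContMDiffOn (𝓡 n).tangent 𝓘(ℝ, ℝ) 1 F U) :
    ContinuousOn (fun t => diffL F (dot (n := n) t₁ t₂ γ t)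
      (vec (n := n) (w t), fieldDeriv t₁ t₂ γ w t)) (timesIn t₁ t₂ γ U) := by
  rintro t ⟨h, htU⟩
  suffices H : ContinuousWithinAt (fun t => diffL F (dot (n := n) t₁ t₂ γ t)
      (vec (n := n) (w t), fieldDeriv t₁ t₂ γ w t)) (Icc t₁ t₂) t from H.mono fun s hs => hs.1
  set S := Ioo (-δ) δ ×ˢ Icc t₁ t₂ with hS
  have h0 : (0 : ℝ) ∈ Ioo (-δ) δ := ⟨by linarith, hδ⟩
  have hxS : ∀ τ ∈ Icc t₁ t₂, ((0 : ℝ), τ) ∈ S := fun τ hτ => ⟨h0, hτ⟩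
  have hu : UniqueDiffOn ℝ S := uniqueDiffOn_strip ht
  let g : ℝ × ℝ → ℝ := fun p => F (dot (n := n) t₁ t₂ (Γ p.1) p.2)
  have hFd : ∀ v ∈ U, ContMDiffAt (𝓡 n).tangent 𝓘(ℝ, ℝ) 1 F v := fun v hv =>
    (hF v hv).contMDiffAt (hU.mem_nhds hv)
  have hg : ∀ τ ∈ Icc t₁ t₂, dot (n := n) t₁ t₂ γ τ ∈ U → ContDiffWithinAt ℝ 1 g S (0, τ) :=
    fun τ hτ hτU => contDiffWithinAt_comp_dot ht hΓ (hxS τ hτ)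
      (by rw [dot_congr hz hτ]; exact hFd _ hτU)
  have h1 : ContinuousWithinAt (fderivWithin ℝ g S) S (0, t) :=
    ((hg t h htU).fderivWithin_right (m := 0) hu (by simp) (hxS t h)).continuousWithinAt
  have hcr : Filter.Tendsto (fun τ : ℝ => ((0 : ℝ), τ)) (nhdsWithin t (Icc t₁ t₂))
      (nhdsWithin ((0 : ℝ), t) S) := by
    refine tendsto_nhdsWithin_iff.2 ⟨Filter.Tendsto.mono_left
      (Continuous.tendsto (by fun_prop) t) nhdsWithin_le_nhds, ?_⟩
    filter_upwards [self_mem_nhdsWithin] with τ hτ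
    exact hxS τ hτ
  have h2 : ContinuousWithinAt (fun τ => fderivWithin ℝ g S (0, τ) (1, 0)) (Icc t₁ t₂) t :=
    ((ContinuousLinearMap.apply ℝ ℝ ((1 : ℝ), (0 : ℝ))).continuous.tendsto _).comp
      (h1.tendsto.comp hcr)
  have hUt : ∀ᶠ τ in nhdsWithin t (Icc t₁ t₂), dot (n := n) t₁ t₂ γ τ ∈ U := by
    have h3 : ContinuousWithinAt (fun τ => dot (n := n) t₁ t₂ (Γ 0) τ) (Icc t₁ t₂) t :=
      ((contMDiffOn_dot_strip ht hΓ) (0, t) (hxS t h)).continuousWithinAt.tendsto.comp hcr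
    have h4 := h3.preimage_mem_nhdsWithin (hU.mem_nhds (by rw [dot_congr hz h]; exact htU))
    filter_upwards [h4, self_mem_nhdsWithin] with τ h5 h6
    rw [← dot_congr hz h6]
    exact h5
  have h5 : (fun t => diffL F (dot (n := n) t₁ t₂ γ t)
      (vec (n := n) (w t), fieldDeriv t₁ t₂ γ w t)) =ᶠ[nhdsWithin t (Icc t₁ t₂)]
      fun τ => fderivWithin ℝ g S (0, τ) (1, 0) := by
    filter_upwards [hUt, self_mem_nhdsWithin] with τ hτU hτ
    have h6 := hasDerivAt_comp_dot hδ ht hΓ hz hw hτ (hFd _ hτU)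
    have h7 := hasDerivAt_strip_left h0 hτ ((hg τ hτ hτU).differentiableWithinAt one_ne_zero)
    exact h6.unique h7
  exact h2.congr_of_eventuallyEq h5 (h5.self_of_nhdsWithin h)

/-- The first variation of the action. -/
theorem hasDerivAt_action (hδ : 0 < δ) (ht : t₁ < t₂)
    (hΓ : ContMDiffOn 𝓘(ℝ, ℝ × ℝ) (𝓡 n) 2 (fun p : ℝ × ℝ => Γ p.1 p.2)
      (Ioo (-δ) δ ×ˢ Icc t₁ t₂))
    (hz : ∀ t ∈ Icc t₁ t₂, Γ 0 t = γ t) (hw : IsVariationFieldOf t₁ t₂ γ Γ w)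
    {L : TangentBundle (𝓡 n) Q → ℝ} (hL : ContMDiff (𝓡 n).tangent 𝓘(ℝ, ℝ) 2 L) :
    HasDerivAt (fun ε => action L t₁ t₂ (Γ ε))
      (∫ t in t₁..t₂, diffL L (dot (n := n) t₁ t₂ γ t)
        (vec (n := n) (w t), fieldDeriv t₁ t₂ γ w t)) 0 := by
  set S := Ioo (-δ) δ ×ˢ Icc t₁ t₂ with hS
  have h0 : (0 : ℝ) ∈ Ioo (-δ) δ := ⟨by linarith, hδ⟩
  have hu : UniqueDiffOn ℝ S := uniqueDiffOn_strip ht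
  have hL1 : ∀ v, ContMDiffAt (𝓡 n).tangent 𝓘(ℝ, ℝ) 1 L v := fun v => (hL v).of_le one_le_two
  let g : ℝ × ℝ → ℝ := fun p => L (dot (n := n) t₁ t₂ (Γ p.1) p.2)
  have hg : ContDiffOn ℝ 1 g S := fun p hp => contDiffWithinAt_comp_dot ht hΓ hp (hL1 _)
  have hg' : ContinuousOn (fderivWithin ℝ g S) S := hg.continuousOn_fderivWithin hu le_rfl
  have hgd : ∀ p ∈ S, DifferentiableWithinAt ℝ g S p := hg.differentiableOn one_ne_zero
  -- Half the width of the strip gives a compact rectangle, on which the ε-derivative is bounded;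
  -- the constant bound dominates for differentiation under the integral.
  have hK : IsCompact (Icc (-(δ / 2)) (δ / 2) ×ˢ Icc t₁ t₂) := isCompact_Icc.prod isCompact_Icc
  have hKS : Icc (-(δ / 2)) (δ / 2) ×ˢ Icc t₁ t₂ ⊆ S := by
    rintro ⟨e, s⟩ ⟨he, hs⟩
    exact ⟨⟨by linarith [he.1], by linarith [he.2]⟩, hs⟩
  obtain ⟨B, hB⟩ := hK.exists_bound_of_continuousOn
    (f := fun p => fderivWithin ℝ g S p (1, 0))
    ((hg'.mono hKS).clm_apply continuousOn_const)
  have hIoc : Set.uIoc t₁ t₂ ⊆ Icc t₁ t₂ := by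
    rw [uIoc_of_le ht.le]
    exact Ioc_subset_Icc_self
  have hcont : ∀ ε ∈ Ioo (-δ) δ, ContinuousOn (fun t => g (ε, t)) (Icc t₁ t₂) := fun ε hε =>
    hg.continuousOn.comp (by fun_prop) fun t h => ⟨hε, h⟩
  have hcont' : ∀ ε ∈ Ioo (-δ) δ, ContinuousOn (fun t => fderivWithin ℝ g S (ε, t) (1, 0))
      (Icc t₁ t₂) := fun ε hε =>
    ((hg'.comp (f := fun t => (ε, t)) (by fun_prop) fun t h => ⟨hε, h⟩)).clm_apply continuousOn_const
  have main := intervalIntegral.hasDerivAt_integral_of_dominated_loc_of_deriv_le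
    (μ := volume) (a := t₁) (b := t₂) (F := fun ε t => g (ε, t)) (x₀ := (0 : ℝ))
    (F' := fun ε t => fderivWithin ℝ g S (ε, t) (1, 0)) (bound := fun _ => B)
    (s := Ioo (-(δ / 2)) (δ / 2)) (Ioo_mem_nhds (by linarith) (by linarith))
    (by
      filter_upwards [Ioo_mem_nhds h0.1 h0.2] with ε hε
      exact ((hcont ε hε).mono hIoc).aestronglyMeasurable measurableSet_uIoc)
    (((hcont 0 h0).mono (by rw [uIcc_of_le ht.le])).intervalIntegrable)
    (((hcont' 0 h0).mono hIoc).aestronglyMeasurable measurableSet_uIoc)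
    (by
      refine Filter.Eventually.of_forall fun t h ε hε => ?_
      exact hB (ε, t) ⟨Ioo_subset_Icc_self hε, hIoc h⟩)
    intervalIntegrable_const
    (by
      refine Filter.Eventually.of_forall fun t h ε hε => ?_
      have hε' : ε ∈ Ioo (-δ) δ := ⟨by linarith [hε.1], by linarith [hε.2]⟩
      exact hasDerivAt_strip_left hε' (hIoc h) (hgd (ε, t) ⟨hε', hIoc h⟩))
  refine main.2.congr_deriv ?_
  refine intervalIntegral.integral_congr fun t h => ?_
  rw [uIcc_of_le ht.le] at h
  have h6 := hasDerivAt_comp_dot hδ ht hΓ hz hw h (hL1 _)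
  have h7 := hasDerivAt_strip_left h0 h (hgd (0, t) ⟨h0, h⟩)
  exact h7.unique h6

end FirstVariation

/-! ### C² deformations with an initial velocity that is only C¹ -/

section Extension

variable {W : Type*} [NormedAddCommGroup W] [NormedSpace ℝ W] [CompleteSpace W]

/-- A `C¹` function on a compact interval has a primitive of class `C²` on the whole line. -/
theorem exists_contDiff_two_primitive {a b : ℝ} (hab : a < b) {g : ℝ → W}
    (hg : ContDiffOn ℝ 1 g (Icc a b)) :
    ∃ f : ℝ → W, ContDiff ℝ 2 f ∧ ∀ t ∈ Icc a b, HasDerivAt f (g t) t := by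
  have hg' := (contDiffOn_one_iff_derivWithin (uniqueDiffOn_Icc hab)).1 hg
  -- Extending the derivative of g by constants and integrating gives a C¹ extension of g to ℝ; its
  -- primitive is the required f.
  set h : ℝ → W := IccExtend hab.le ((Icc a b).domRestrict (derivWithin g (Icc a b))) with hh
  have hc : Continuous h := (continuousOn_iff_continuous_domRestrict.1 hg'.2).Icc_extend'
  have he : ∀ t ∈ Icc a b, h t = derivWithin g (Icc a b) t := fun t ht => by
    rw [hh, IccExtend_of_mem hab.le _ ht]; rfl
  let g₁ : ℝ → W := fun t => g a + ∫ s in a..t, h s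
  have hg₁ : ∀ t, HasDerivAt g₁ (h t) t := fun t =>
    (hc.integral_hasStrictDerivAt a t).hasDerivAt.const_add _
  have hg₁c : ContDiff ℝ 1 g₁ := by
    refine contDiff_one_iff_deriv.2 ⟨fun t => (hg₁ t).differentiableAt, ?_⟩
    rwa [funext fun t => (hg₁ t).deriv]
  have heq : ∀ t ∈ Icc a b, g₁ t = g t := by
    intro t ht
    have h1 := eq_of_hasDerivWithinAt_zero (f := fun t => g₁ t - g t) (t₁ := a) (t₂ := b)
      (fun s hs => by
        have h2 := (hg₁ s).hasDerivWithinAt.sub (hg'.1 s hs).hasDerivWithinAt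
        rwa [he s hs, sub_self] at h2) t ht
    have h3 : g₁ a = g a := by simp [g₁]
    rw [h3, sub_self] at h1
    exact sub_eq_zero.1 h1
  refine ⟨fun t => ∫ s in a..t, g₁ s, ?_, fun t ht => ?_⟩
  · have h1 : ∀ t, HasDerivAt (fun t => ∫ s in a..t, g₁ s) (g₁ t) t := fun t =>
      (hg₁c.continuous.integral_hasStrictDerivAt a t).hasDerivAt
    rw [← one_add_one_eq_two, contDiff_succ_iff_deriv]
    refine ⟨fun t => (h1 t).differentiableAt, by simp, ?_⟩
    rwa [funext fun t => (h1 t).deriv]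
  · rw [← heq t ht]
    exact (hg₁c.continuous.integral_hasStrictDerivAt a t).hasDerivAt

/-- A `C¹` function on a compact interval is the initial velocity of a `C²` deformation
(the solution of the wave equation). -/
theorem exists_contDiff_two_deformation {a b : ℝ} (hab : a < b) {g : ℝ → W}
    (hg : ContDiffOn ℝ 1 g (Icc a b)) :
    ∃ G : ℝ × ℝ → W, ContDiff ℝ 2 G ∧ (∀ t, G (0, t) = 0) ∧
      (∀ t ∈ Icc a b, HasDerivAt (fun ε => G (ε, t)) (g t) 0) ∧
      (g a = 0 → ∀ ε, G (ε, a) = 0) ∧ (g b = 0 → ∀ ε, G (ε, b) = 0) := by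
  classical
  obtain ⟨f, hf, hfd⟩ := exists_contDiff_two_primitive hab hg
  -- d'Alembert's formula: since f' = g on [a, b], the derivative in ε at 0 is g(t), while G₀ is as
  -- smooth as f. The obvious choice ε g(t) would be only of class C¹.
  let G₀ : ℝ × ℝ → W := fun p => (1 / 2 : ℝ) • (f (p.2 + p.1) - f (p.2 - p.1))
  have hG₀ : ContDiff ℝ 2 G₀ := by
    refine contDiff_const.smul (ContDiff.sub ?_ ?_)
    · exact hf.comp (contDiff_snd.add contDiff_fst)
    · exact hf.comp (contDiff_snd.sub contDiff_fst)
  have hz : ∀ t, G₀ (0, t) = 0 := fun t => by simp [G₀]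
  have hd : ∀ t ∈ Icc a b, HasDerivAt (fun ε => G₀ (ε, t)) (g t) 0 := by
    intro t ht
    have h1 : HasDerivAt (fun ε => f (t + ε)) (g t) 0 := by
      have := HasDerivAt.comp_const_add (f := f) (f' := g t) t (0 : ℝ) (by simpa using hfd t ht)
      exact this
    have h2 : HasDerivAt (fun ε => f (t - ε)) (-g t) 0 := by
      have := HasDerivAt.comp_const_sub (f := f) (f' := g t) t (0 : ℝ) (by simpa using hfd t ht)
      exact this
    have h3 := (h1.sub h2).const_smul (1 / 2 : ℝ)
    refine h3.congr_deriv ?_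
    rw [sub_neg_eq_add, ← two_smul ℝ (g t), smul_smul]
    norm_num
  -- The values of G₀ at the ends are removed by linear interpolation in t. This is switched on only
  -- at an end where g vanishes, so it leaves the derivative at ε = 0 unchanged.
  let ca : ℝ := if g a = 0 then 1 else 0
  let cb : ℝ := if g b = 0 then 1 else 0
  have hca : ca • g a = 0 := by
    by_cases h : g a = 0 <;> simp [ca, h]
  have hcb : cb • g b = 0 := by
    by_cases h : g b = 0 <;> simp [cb, h]
  have hba : b - a ≠ 0 := (sub_pos.2 hab).ne'
  refine ⟨fun p => G₀ p - ((b - p.2) / (b - a)) • ca • G₀ (p.1, a) -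
    ((p.2 - a) / (b - a)) • cb • G₀ (p.1, b), ?_, fun t => by simp [hz], fun t ht => ?_,
    fun h ε => ?_, fun h ε => ?_⟩
  · refine (hG₀.sub (ContDiff.smul ?_ (contDiff_const.smul ?_))).sub
      (ContDiff.smul ?_ (contDiff_const.smul ?_))
    · exact (contDiff_const.sub contDiff_snd).div_const _
    · exact hG₀.comp (contDiff_fst.prodMk contDiff_const)
    · exact (contDiff_snd.sub contDiff_const).div_const _
    · exact hG₀.comp (contDiff_fst.prodMk contDiff_const)
  · have h1 := ((hd t ht).sub (((hd a (left_mem_Icc.2 hab.le)).const_smul ca).const_smul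
      ((b - t) / (b - a)))).sub (((hd b (right_mem_Icc.2 hab.le)).const_smul cb).const_smul
      ((t - a) / (b - a)))
    rw [hca, hcb, smul_zero, smul_zero, sub_zero, sub_zero] at h1
    exact h1
  · simp [ca, h, div_self hba]
  · simp [cb, h, div_self hba]

end Extension

/-! ### Every C¹ field along γ is a variation field -/

section Variations

variable {n : ℕ} {Q : Type*} [TopologicalSpace Q] [ChartedSpace (E n) Q] [IsManifold (𝓡 n) ∞ Q]
  {t₁ t₂ : ℝ} {γ : ℝ → Q}

theorem eq_of_rep_eq {x₀ : Q} {v v' : TangentBundle (𝓡 n) Q} (hp : v.proj = v'.proj)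
    (hx : v.proj ∈ (chartAt (E n) x₀).source) (h : rep x₀ v = rep x₀ v') : v = v' := by
  obtain ⟨x, u⟩ := v
  obtain ⟨x', u'⟩ := v'
  obtain rfl : x = x' := hp
  rw [rep_eq_repL (by exact hx), rep_eq_repL (by exact hx)] at h
  exact congrArg (fun u : E n => (⟨x, u⟩ : TangentBundle (𝓡 n) Q)) (repL_injective hx h)

theorem rep_lift_add_smul {x₀ : Q} {w₁ w : ∀ t : ℝ, TangentSpace (𝓡 n) (γ t)} {t : ℝ}
    (hx : γ t ∈ (chartAt (E n) x₀).source) (c : ℝ) :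
    rep x₀ (lift γ (fun t => w₁ t + c • w t) t) =
      rep x₀ (lift γ w₁ t) + c • rep x₀ (lift γ w t) := by
  rw [rep_eq_repL (by exact hx), rep_eq_repL (by exact hx), rep_eq_repL (by exact hx)]
  exact (map_add _ _ _).trans (congrArg _ (map_smul _ _ _))

/-- A variation can be modified so as to add to its variation field a field that is supported in
the domain of a chart. -/
theorem exists_variation_add (ht : t₁ < t₂)
    {w w₁ : ∀ t : ℝ, TangentSpace (𝓡 n) (γ t)} (hw : IsFieldAlong t₁ t₂ γ w)
    {δ : ℝ} (hδ : 0 < δ) {Γ : ℝ → ℝ → Q}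
    (hΓ : ContMDiffOn 𝓘(ℝ, ℝ × ℝ) (𝓡 n) 2 (fun p : ℝ × ℝ => Γ p.1 p.2)
      (Ioo (-δ) δ ×ˢ Icc t₁ t₂))
    (hz : ∀ t ∈ Icc t₁ t₂, Γ 0 t = γ t) (hw₁ : IsVariationFieldOf t₁ t₂ γ Γ w₁)
    (hl : w t₁ = 0 → ∀ ε ∈ Ioo (-δ) δ, Γ ε t₁ = γ t₁)
    (hr : w t₂ = 0 → ∀ ε ∈ Ioo (-δ) δ, Γ ε t₂ = γ t₂)
    {x₀ : Q} {p q : ℝ} (hpq : max t₁ p < min t₂ q)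
    (hsrc : ∀ t ∈ Icc t₁ t₂ ∩ Icc p q, γ t ∈ (chartAt (E n) x₀).source)
    {χ : ℝ → ℝ} (hχ : ContDiff ℝ 2 χ) (hχs : tsupport χ ⊆ Ioo p q) :
    ∃ (δ' : ℝ) (Γ' : ℝ → ℝ → Q), 0 < δ' ∧
      ContMDiffOn 𝓘(ℝ, ℝ × ℝ) (𝓡 n) 2 (fun p : ℝ × ℝ => Γ' p.1 p.2)
        (Ioo (-δ') δ' ×ˢ Icc t₁ t₂) ∧
      (∀ t ∈ Icc t₁ t₂, Γ' 0 t = γ t) ∧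
      IsVariationFieldOf t₁ t₂ γ Γ' (fun t => w₁ t + χ t • w t) ∧
      (w t₁ = 0 → ∀ ε ∈ Ioo (-δ') δ', Γ' ε t₁ = γ t₁) ∧
      (w t₂ = 0 → ∀ ε ∈ Ioo (-δ') δ', Γ' ε t₂ = γ t₂) := by
  classical
  -- [a, b] is the part of the window [p, q] that lies in I; γ stays in the chart there.
  set a := max t₁ p with ha
  set b := min t₂ q with hb
  have hab : Icc a b = Icc t₁ t₂ ∩ Icc p q := by rw [Icc_inter_Icc]
  obtain ⟨G, hG, hG0, hGd, hGa, hGb⟩ := exists_contDiff_two_deformation hpq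
    (g := fun t => rep x₀ (lift γ w t)) (fun t h => by
      rw [hab] at h ⊢
      exact (isFieldAlong_rep hw h.1 (hsrc t h)).mono inter_subset_left)
  have hrep0 : ∀ t, γ t ∈ (chartAt (E n) x₀).source → w t = 0 → rep x₀ (lift γ w t) = 0 := by
    intro t hx h
    rw [rep_eq_repL (by exact hx)]
    exact (congrArg (repL x₀ (γ t)) h).trans (map_zero _)
  set e := extChartAt (𝓡 n) x₀ with he
  have hes : e.source = (chartAt (E n) x₀).source := extChartAt_source (I := 𝓡 n) x₀
  let P : ℝ × ℝ → E n := fun z => e (Γ z.1 z.2) + χ z.2 • G z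
  -- The deformation χ G is added in the coordinates of the chart, and Γ is kept off the support of
  -- χ, where the chart need not be available.
  let Γ' : ℝ → ℝ → Q := fun ε t => if t ∈ tsupport χ then e.symm (P (ε, t)) else Γ ε t
  have hχ0 : ∀ t, t ∉ tsupport χ → χ t = 0 := fun t h => image_eq_zero_of_notMem_tsupport h
  have h00 : (0 : ℝ) ∈ Ioo (-δ) δ := ⟨by linarith, hδ⟩
  -- the region where the modification makes sense
  have hev : ∀ᶠ ε in nhds (0 : ℝ), ∀ t ∈ Icc t₁ t₂ ∩ Icc p q, ε ∈ Ioo (-δ) δ →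
      Γ ε t ∈ e.source ∧ P (ε, t) ∈ e.target := by
    have hK : IsCompact (Icc t₁ t₂ ∩ Icc p q) := isCompact_Icc.inter isCompact_Icc
    have hlift : ∀ t ∈ Icc t₁ t₂ ∩ Icc p q, ∀ᶠ z in nhds ((0 : ℝ), t),
        z.2 ∈ Icc t₁ t₂ ∩ Icc p q → z.1 ∈ Ioo (-δ) δ →
          Γ z.1 z.2 ∈ e.source ∧ P z ∈ e.target := by
      intro t h
      have h1 := hΓ (0, t) ⟨h00, h.1⟩
      have h2 : Γ 0 t ∈ e.source := by
        rw [hz t h.1, hes]; exact hsrc t h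
      have h3 : ∀ᶠ z in nhdsWithin ((0 : ℝ), t) (Ioo (-δ) δ ×ˢ Icc t₁ t₂),
          Γ z.1 z.2 ∈ e.source :=
        h1.continuousWithinAt.preimage_mem_nhdsWithin
          ((isOpen_extChartAt_source x₀).mem_nhds h2)
      have h4 : ContinuousWithinAt P (Ioo (-δ) δ ×ˢ Icc t₁ t₂) (0, t) := by
        refine ContinuousWithinAt.add ?_ ?_
        · exact (continuousAt_extChartAt' h2).comp_continuousWithinAt
            (f := fun z : ℝ × ℝ => Γ z.1 z.2) h1.continuousWithinAt
        · exact (Continuous.continuousWithinAt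
            ((hχ.continuous.comp continuous_snd).smul hG.continuous))
      have h5 : P (0, t) ∈ e.target := by
        simp only [P, hG0, smul_zero, add_zero]
        exact e.map_source h2
      have h6 : ∀ᶠ z in nhdsWithin ((0 : ℝ), t) (Ioo (-δ) δ ×ˢ Icc t₁ t₂), P z ∈ e.target :=
        h4.preimage_mem_nhdsWithin ((isOpen_extChartAt_target x₀).mem_nhds h5)
      filter_upwards [eventually_nhdsWithin_iff.1 (h3.and h6)] with z hz' hz2 hz1
      exact hz' ⟨hz1, hz2.1⟩
    have := hK.eventually_forall_of_forall_eventually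
      (P := fun ε t => t ∈ Icc t₁ t₂ ∩ Icc p q → ε ∈ Ioo (-δ) δ →
        Γ ε t ∈ e.source ∧ P (ε, t) ∈ e.target) hlift
    filter_upwards [this] with ε h t h'
    exact h t h' h'
  obtain ⟨η, hη, hηP⟩ := Metric.eventually_nhds_iff.1 hev
  set δ' := min δ η with hδ'
  have hδ'0 : 0 < δ' := lt_min hδ hη
  have hin : ∀ ε ∈ Ioo (-δ') δ', ε ∈ Ioo (-δ) δ := fun ε h =>
    ⟨by linarith [h.1, min_le_left δ η], by linarith [h.2, min_le_left δ η]⟩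
  have hgood : ∀ ε ∈ Ioo (-δ') δ', ∀ t ∈ Icc t₁ t₂ ∩ Icc p q,
      Γ ε t ∈ e.source ∧ P (ε, t) ∈ e.target := by
    intro ε h t ht'
    refine hηP (y := ε) ?_ t ht' (hin ε h)
    rw [Real.dist_eq, sub_zero, abs_lt]
    exact ⟨by linarith [h.1, min_le_right δ η], by linarith [h.2, min_le_right δ η]⟩
  -- On the whole window both branches are given by the chart formula, as χ = 0 off its support;
  -- hence Γ' is smooth across the boundary of that support.
  have hsame : ∀ ε ∈ Ioo (-δ') δ', ∀ t ∈ Icc t₁ t₂ ∩ Icc p q, Γ' ε t = e.symm (P (ε, t)) := by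
    intro ε h t ht'
    by_cases hs : t ∈ tsupport χ
    · simp only [Γ', if_pos hs]
    · simp only [Γ', if_neg hs, P, hχ0 t hs, zero_smul, add_zero]
      exact (e.left_inv (hgood ε h t ht').1).symm
  have h00' : (0 : ℝ) ∈ Ioo (-δ') δ' := ⟨by linarith, hδ'0⟩
  have hz' : ∀ t ∈ Icc t₁ t₂, Γ' 0 t = γ t := by
    intro t h
    by_cases hs : t ∈ tsupport χ
    · have ht' : t ∈ Icc t₁ t₂ ∩ Icc p q := ⟨h, Ioo_subset_Icc_self (hχs hs)⟩
      rw [hsame 0 h00' t ht']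
      simp only [P, hG0, smul_zero, add_zero]
      rw [e.left_inv (hgood 0 h00' t ht').1, hz t h]
    · simp only [Γ', if_neg hs]
      exact hz t h
  have hfix : ∀ t ∈ Icc t₁ t₂, (∀ ε ∈ Ioo (-δ) δ, Γ ε t = γ t) →
      (t ∈ tsupport χ → ∀ ε, G (ε, t) = 0) → ∀ ε ∈ Ioo (-δ') δ', Γ' ε t = γ t := by
    intro t h h1 h2 ε hε
    by_cases hs : t ∈ tsupport χ
    · have ht' : t ∈ Icc t₁ t₂ ∩ Icc p q := ⟨h, Ioo_subset_Icc_self (hχs hs)⟩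
      rw [hsame ε hε t ht']
      simp only [P, h2 hs ε, smul_zero, add_zero]
      rw [e.left_inv (hgood ε hε t ht').1, h1 ε (hin ε hε)]
    · simp only [Γ', if_neg hs]
      exact h1 ε (hin ε hε)
  refine ⟨δ', Γ', hδ'0, ?_, hz', ?_, fun h0 => ?_, fun h0 => ?_⟩
  · rintro ⟨ε, t⟩ ⟨hε, h⟩
    have hsub : Ioo (-δ') δ' ×ˢ Icc t₁ t₂ ⊆ Ioo (-δ) δ ×ˢ Icc t₁ t₂ := fun z hz =>
      ⟨hin _ hz.1, hz.2⟩
    have hΓt : ContMDiffWithinAt 𝓘(ℝ, ℝ × ℝ) (𝓡 n) 2 (fun p : ℝ × ℝ => Γ p.1 p.2)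
        (Ioo (-δ') δ' ×ˢ Icc t₁ t₂) (ε, t) := (hΓ (ε, t) ⟨hin ε hε, h⟩).mono hsub
    by_cases hs : t ∈ tsupport χ
    · have ht' : t ∈ Icc t₁ t₂ ∩ Icc p q := ⟨h, Ioo_subset_Icc_self (hχs hs)⟩
      obtain ⟨h1, h2⟩ := hgood ε hε t ht'
      have h3 : ContMDiffWithinAt 𝓘(ℝ, ℝ × ℝ) 𝓘(ℝ, E n) 2 P
          (Ioo (-δ') δ' ×ˢ Icc t₁ t₂) (ε, t) := by
        have h4 : ContMDiffWithinAt 𝓘(ℝ, ℝ × ℝ) 𝓘(ℝ, E n) 2 (fun z : ℝ × ℝ => e (Γ z.1 z.2))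
            (Ioo (-δ') δ' ×ˢ Icc t₁ t₂) (ε, t) :=
          (contMDiffAt_extChartAt' (n := 2) (by rwa [← hes])).comp_contMDiffWithinAt (ε, t) hΓt
        have h5 : ContDiff ℝ 2 (fun z : ℝ × ℝ => χ z.2 • G z) :=
          (hχ.comp contDiff_snd).smul hG
        rw [contMDiffWithinAt_iff_contDiffWithinAt] at h4 ⊢
        exact h4.add h5.contDiffWithinAt
      have h6 : ContMDiffAt 𝓘(ℝ, E n) (𝓡 n) 2 e.symm (P (ε, t)) :=
        (contMDiffOn_extChartAt_symm (n := 2) x₀ _ h2).contMDiffAt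
          ((isOpen_extChartAt_target x₀).mem_nhds h2)
      have h7 := h6.comp_contMDiffWithinAt (ε, t) h3
      refine h7.congr_of_eventuallyEq ?_ (hsame ε hε t ht')
      have h8 : ∀ᶠ z in nhds (ε, t), z.2 ∈ Ioo p q :=
        continuous_snd.continuousAt.preimage_mem_nhds (isOpen_Ioo.mem_nhds (hχs hs))
      filter_upwards [nhdsWithin_le_nhds h8, self_mem_nhdsWithin] with z hz1 hz2
      exact hsame z.1 hz2.1 z.2 ⟨hz2.2, Ioo_subset_Icc_self hz1⟩
    · refine hΓt.congr_of_eventuallyEq ?_ (by simp only [Γ', if_neg hs])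
      have h8 : ∀ᶠ z in nhds (ε, t), z.2 ∈ (tsupport χ)ᶜ :=
        continuous_snd.continuousAt.preimage_mem_nhds
          ((isClosed_tsupport χ).isOpen_compl.mem_nhds hs)
      filter_upwards [nhdsWithin_le_nhds h8] with z hz1
      simp only [Γ', if_neg (show z.2 ∉ tsupport χ from hz1)]
  · intro t h
    by_cases hs : t ∈ tsupport χ
    · have ht' : t ∈ Icc t₁ t₂ ∩ Icc p q := ⟨h, Ioo_subset_Icc_self (hχs hs)⟩
      have hx := hsrc t ht'
      have hmd : ∀ {Γ₁ : ℝ → ℝ → Q}, MDifferentiableAt 𝓘(ℝ, ℝ) (𝓡 n) (fun ε => Γ₁ ε t) 0 →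
          Γ₁ 0 t = γ t →
          HasDerivAt (fun ε => e (Γ₁ ε t)) (rep x₀ (⟨Γ₁ 0 t,
            mfderiv 𝓘(ℝ, ℝ) (𝓡 n) (fun ε => Γ₁ ε t) 0 (1 : ℝ)⟩ : TangentBundle (𝓡 n) Q)) 0 := by
        intro Γ₁ h1 h2
        have h3 : Γ₁ 0 t ∈ (chartAt (E n) x₀).source := by rw [h2]; exact hx
        rw [rep_eq_repL (by exact h3)]
        exact rep_mfderiv h1 h3
      have h2 : HasDerivWithinAt (fun e : ℝ => (e, t)) ((1 : ℝ), (0 : ℝ)) (Ioo (-δ) δ) 0 :=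
        (hasDerivWithinAt_id 0 _).prodMk (hasDerivWithinAt_const 0 _ t)
      have h1 : MDifferentiableAt 𝓘(ℝ, ℝ) (𝓡 n) (fun ε => Γ ε t) 0 := by
        have h3' : Ioo (-δ) δ ⊆ (fun e : ℝ => (e, t)) ⁻¹' (Ioo (-δ) δ ×ˢ Icc t₁ t₂) :=
          fun e he => ⟨he, h⟩
        have h3 := ((hΓ (0, t) ⟨h00, h⟩).mdifferentiableWithinAt two_ne_zero).comp (0 : ℝ)
          h2.differentiableWithinAt.mdifferentiableWithinAt h3'
        exact h3.mdifferentiableAt (Ioo_mem_nhds h00.1 h00.2)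
      have h4 := hmd h1 (hz t h)
      rw [← hw₁ t h] at h4
      have hab' : t ∈ Icc a b := by rw [hab]; exact ht'
      have h5 : HasDerivAt (fun ε => P (ε, t))
          (rep x₀ (lift γ w₁ t) + χ t • rep x₀ (lift γ w t)) 0 :=
        h4.add ((hGd t hab').const_smul (χ t))
      have hP : P (0, t) ∈ e.target := (hgood 0 h00' t ht').2
      have h6 : MDifferentiableAt 𝓘(ℝ, ℝ) (𝓡 n) (fun ε => Γ' ε t) 0 := by
        have h7 : MDifferentiableAt 𝓘(ℝ, E n) (𝓡 n) e.symm (P (0, t)) :=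
          ((contMDiffOn_extChartAt_symm (n := 2) x₀ _ hP).contMDiffAt
            ((isOpen_extChartAt_target x₀).mem_nhds hP)).mdifferentiableAt two_ne_zero
        have h8 := h7.comp (0 : ℝ) h5.differentiableAt.mdifferentiableAt
        refine h8.congr_of_eventuallyEq (Filter.Eventually.of_forall fun ε => ?_)
        simp only [Γ', if_pos hs]
        rfl
      have h9 := hmd h6 (hz' t h)
      have h10 : (fun ε => e (Γ' ε t)) =ᶠ[nhds 0] fun ε => P (ε, t) := by
        filter_upwards [Ioo_mem_nhds h00'.1 h00'.2] with ε hε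
        rw [hsame ε hε t ht']
        exact e.right_inv (hgood ε hε t ht').2
      have h11 := h9.unique (h5.congr_of_eventuallyEq h10)
      refine eq_of_rep_eq (x₀ := x₀) (hz' t h).symm hx ?_
      rw [h11]
      exact rep_lift_add_smul hx (χ t)
    · have h1 : (fun ε => Γ' ε t) = fun ε => Γ ε t := by
        funext ε
        simp only [Γ', if_neg hs]
      have h2 := hw₁ t h
      have h3 : lift γ (fun t => w₁ t + χ t • w t) t = lift γ w₁ t := by
        have h4 : w₁ t + χ t • w t = w₁ t := by rw [hχ0 t hs, zero_smul, add_zero]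
        exact congrArg (fun u : E n => (⟨γ t, u⟩ : TangentBundle (𝓡 n) Q)) h4
      have h4 : ∀ c c' : ℝ → Q, c = c' →
          (⟨c 0, mfderiv 𝓘(ℝ, ℝ) (𝓡 n) c 0 (1 : ℝ)⟩ : TangentBundle (𝓡 n) Q) =
            ⟨c' 0, mfderiv 𝓘(ℝ, ℝ) (𝓡 n) c' 0 (1 : ℝ)⟩ := by
        rintro c _ rfl
        rfl
      exact (h3.trans h2).trans (h4 _ _ h1.symm)
  -- If t₁ meets the support of χ, then a = t₁, so t₁ is an end of the interval of the deformation
  -- and G vanishes there with w.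
  · refine hfix t₁ (left_mem_Icc.2 ht.le) (hl h0) fun hs => ?_
    have h1 := hχs hs
    have h2 : a = t₁ := max_eq_left h1.1.le
    have h3 : γ t₁ ∈ (chartAt (E n) x₀).source :=
      hsrc t₁ ⟨left_mem_Icc.2 ht.le, Ioo_subset_Icc_self h1⟩
    rw [h2] at hGa
    exact hGa (hrep0 t₁ h3 h0)
  · refine hfix t₂ (right_mem_Icc.2 ht.le) (hr h0) fun hs => ?_
    have h1 := hχs hs
    have h2 : b = t₂ := min_eq_left h1.2.le
    have h3 : γ t₂ ∈ (chartAt (E n) x₀).source :=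
      hsrc t₂ ⟨right_mem_Icc.2 ht.le, Ioo_subset_Icc_self h1⟩
    rw [h2] at hGb
    exact hGb (hrep0 t₂ h3 h0)

/-- Every `C¹` field along a `C²` path is the variation field of a `C²` variation, which fixes the
end-points at which the field vanishes. -/
theorem exists_variation (ht : t₁ < t₂) (hγ : ContMDiffOn 𝓘(ℝ, ℝ) (𝓡 n) 2 γ (Icc t₁ t₂))
    {w : ∀ t : ℝ, TangentSpace (𝓡 n) (γ t)} (hw : IsFieldAlong t₁ t₂ γ w) :
    ∃ (δ : ℝ) (Γ : ℝ → ℝ → Q), 0 < δ ∧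
      ContMDiffOn 𝓘(ℝ, ℝ × ℝ) (𝓡 n) 2 (fun p : ℝ × ℝ => Γ p.1 p.2)
        (Ioo (-δ) δ ×ˢ Icc t₁ t₂) ∧
      (∀ t ∈ Icc t₁ t₂, Γ 0 t = γ t) ∧ IsVariationFieldOf t₁ t₂ γ Γ w ∧
      (w t₁ = 0 → ∀ ε ∈ Ioo (-δ) δ, Γ ε t₁ = γ t₁) ∧
      (w t₂ = 0 → ∀ ε ∈ Ioo (-δ) δ, Γ ε t₂ = γ t₂) := by
  classical
  have hloc : ∀ s ∈ Icc t₁ t₂, ∃ r > 0, ∀ t ∈ Icc t₁ t₂ ∩ Icc (s - r) (s + r),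
      γ t ∈ (chartAt (E n) (γ s)).source := by
    intro s hs
    have h1 : ∀ᶠ t in nhdsWithin s (Icc t₁ t₂), γ t ∈ (chartAt (E n) (γ s)).source :=
      (hγ s hs).continuousWithinAt.preimage_mem_nhdsWithin
        ((chartAt (E n) (γ s)).open_source.mem_nhds (by simp))
    obtain ⟨r, hr, h2⟩ := Metric.eventually_nhds_iff.1 (eventually_nhdsWithin_iff.1 h1)
    refine ⟨r / 2, by positivity, fun t h => h2 ?_ h.1⟩
    rw [Real.dist_eq, abs_lt]
    constructor <;> linarith [h.2.1, h.2.2]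
  choose! r hr hrs using hloc
  obtain ⟨T, hT⟩ := isCompact_Icc.elim_finite_subcover
    (fun s : Icc t₁ t₂ => Ioo (s.1 - r s.1) (s.1 + r s.1)) (fun _ => isOpen_Ioo)
    (fun s hs => mem_iUnion.2 ⟨⟨s, hs⟩, by linarith [hr s hs], by linarith [hr s hs]⟩)
  obtain ⟨ρ, hρ⟩ := SmoothPartitionOfUnity.exists_isSubordinate 𝓘(ℝ, ℝ) (isClosed_Icc (a := t₁) (b := t₂))
    (fun s : T => Ioo (s.1.1 - r s.1.1) (s.1.1 + r s.1.1)) (fun _ => isOpen_Ioo)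
    (fun s hs => by
      obtain ⟨i, hi, hsi⟩ := mem_iUnion₂.1 (hT hs)
      exact mem_iUnion.2 ⟨⟨i, hi⟩, hsi⟩)
  -- With a finite partition of unity subordinate to windows that γ maps into single charts, the
  -- pieces ρ_i w are added one at a time to the constant variation.
  have key : ∀ A : Finset T, ∃ (δ : ℝ) (Γ : ℝ → ℝ → Q), 0 < δ ∧
      ContMDiffOn 𝓘(ℝ, ℝ × ℝ) (𝓡 n) 2 (fun p : ℝ × ℝ => Γ p.1 p.2)
        (Ioo (-δ) δ ×ˢ Icc t₁ t₂) ∧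
      (∀ t ∈ Icc t₁ t₂, Γ 0 t = γ t) ∧
      IsVariationFieldOf t₁ t₂ γ Γ (fun t => (∑ i ∈ A, ρ i t) • w t) ∧
      (w t₁ = 0 → ∀ ε ∈ Ioo (-δ) δ, Γ ε t₁ = γ t₁) ∧
      (w t₂ = 0 → ∀ ε ∈ Ioo (-δ) δ, Γ ε t₂ = γ t₂) := by
    intro A
    induction A using Finset.induction_on with
    | empty =>
      refine ⟨1, fun _ => γ, one_pos, ?_, fun _ _ => rfl, fun t h => ?_, fun _ _ _ => rfl,
        fun _ _ _ => rfl⟩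
      · exact hγ.comp contDiff_snd.contMDiff.contMDiffOn fun z hz => hz.2
      · have h1 : mfderiv 𝓘(ℝ, ℝ) (𝓡 n) (fun _ : ℝ => γ t) 0 = 0 := mfderiv_const
        have h2 : (∑ i ∈ (∅ : Finset T), ρ i t) • w t = 0 := by rw [Finset.sum_empty, zero_smul]
        exact congrArg (fun u : E n => (⟨γ t, u⟩ : TangentBundle (𝓡 n) Q))
          (h2.trans (DFunLike.congr_fun h1 (1 : ℝ)).symm)
    | insert i A hi ih =>
      obtain ⟨δ, Γ, hδ, hΓ, hz, hv, hl, hr'⟩ := ih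
      have hi' := i.1.2
      have hri := hr _ hi'
      obtain ⟨δ', Γ', h1, h2, h3, h4, h5, h6⟩ := exists_variation_add ht hw hδ hΓ hz hv hl hr'
        (x₀ := γ i.1.1) (p := i.1.1 - r i.1.1) (q := i.1.1 + r i.1.1)
        (by rw [max_lt_iff, lt_min_iff, lt_min_iff]
            exact ⟨⟨ht, by linarith [hi'.1]⟩, by linarith [hi'.2], by linarith⟩)
        (hrs _ hi') (χ := ρ i) ((ρ i).contMDiff.contDiff.of_le two_le_infty) (hρ i)
      refine ⟨δ', Γ', h1, h2, h3, ?_, h5, h6⟩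
      convert! h4 using 1
      funext t
      rw [Finset.sum_insert hi, add_comm]
      exact add_smul _ _ _
  obtain ⟨δ, Γ, hδ, hΓ, hz, hv, hl, hr'⟩ := key Finset.univ
  refine ⟨δ, Γ, hδ, hΓ, hz, fun t h => ?_, hl, hr'⟩
  rw [← hv t h]
  have h1 : (∑ i, ρ i t) • w t = w t := by
    rw [← finsum_eq_sum_of_fintype, ρ.sum_eq_one h, one_smul]
  exact congrArg (fun u : E n => (⟨γ t, u⟩ : TangentBundle (𝓡 n) Q)) h1.symm

/-- The contraction of the differential of a function with the derivative of a field is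
continuous. -/
theorem continuousOn_diffL (ht : t₁ < t₂) (hγ : ContMDiffOn 𝓘(ℝ, ℝ) (𝓡 n) 2 γ (Icc t₁ t₂))
    {w : ∀ t : ℝ, TangentSpace (𝓡 n) (γ t)} (hw : IsFieldAlong t₁ t₂ γ w)
    {U : Set (TangentBundle (𝓡 n) Q)} (hU : IsOpen U) {F : TangentBundle (𝓡 n) Q → ℝ}
    (hF : ContMDiffOn (𝓡 n).tangent 𝓘(ℝ, ℝ) 1 F U) :
    ContinuousOn (fun t => diffL F (dot (n := n) t₁ t₂ γ t)
      (vec (n := n) (w t), fieldDeriv t₁ t₂ γ w t)) (timesIn t₁ t₂ γ U) := by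
  obtain ⟨δ, Γ, hδ, hΓ, hz, hv, -, -⟩ := exists_variation ht hγ hw
  exact continuousOn_diffL_of_variation hδ ht hΓ hz hv hU hF

end Variations

/-! ### Cut-off functions and adapted bases -/

section Cutoff

/-- The function f is supported where P holds and equals 1 near s, so data defined only near s
become global along I without being altered near s. -/
theorem exists_cutoff {S : Set ℝ} {s : ℝ} {P : ℝ → Prop} (h : ∀ᶠ t in nhdsWithin s S, P t) :
    ∃ (f : ℝ → ℝ) (O J : Set ℝ), ContDiff ℝ 1 f ∧ IsOpen O ∧ tsupport f ⊆ O ∧ IsOpen J ∧ s ∈ J ∧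
      J ⊆ O ∧ (∀ t ∈ J, f t = 1) ∧ ∀ t ∈ S ∩ O, P t := by
  obtain ⟨r, hr, h2⟩ := Metric.eventually_nhds_iff.1 (eventually_nhdsWithin_iff.1 h)
  let f : ContDiffBump s := ⟨r / 4, r / 2, by positivity, by linarith⟩
  refine ⟨f, Metric.ball s r, Metric.ball s (r / 4), f.contDiff, Metric.isOpen_ball, ?_,
    Metric.isOpen_ball, Metric.mem_ball_self (by positivity),
    Metric.ball_subset_ball (by linarith), fun t ht =>
      f.one_of_mem_closedBall (Metric.ball_subset_closedBall ht), fun t ht => h2 ht.2 ht.1⟩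
  rw [f.tsupport_eq]
  exact Metric.closedBall_subset_ball (by simp only [f]; linarith)

theorem contDiffOn_cutoff_smul {W : Type*} [NormedAddCommGroup W] [NormedSpace ℝ W] {S O : Set ℝ}
    (hO : IsOpen O) {f : ℝ → ℝ} (hf : ContDiff ℝ 1 f) (hfO : tsupport f ⊆ O) {g : ℝ → W}
    (hg : ContDiffOn ℝ 1 g (S ∩ O)) : ContDiffOn ℝ 1 (fun t => f t • g t) S := by
  intro t ht
  by_cases h : t ∈ tsupport f
  · have h1 := hg t ⟨ht, hfO h⟩
    exact hf.contDiffWithinAt.smul ((contDiffWithinAt_inter (hO.mem_nhds (hfO h))).1 h1)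
  · have h1 : ∀ᶠ s in nhdsWithin t S, f s • g s = 0 := by
      filter_upwards [nhdsWithin_le_nhds ((isClosed_tsupport f).isOpen_compl.mem_nhds h)] with s hs
      rw [image_eq_zero_of_notMem_tsupport hs, zero_smul]
    refine (contDiffWithinAt_const (c := (0 : W))).congr_of_eventuallyEq h1 ?_
    rw [image_eq_zero_of_notMem_tsupport h, zero_smul]

/-- A surjective map has a basis adapted to its kernel. -/
theorem exists_basis_adapted_ker {n m : ℕ} (B : (Fin n → ℝ) →ₗ[ℝ] (Fin m → ℝ))
    (hB : Function.Surjective B) :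
    ∃ bs : Module.Basis (Fin m ⊕ Fin (n - m)) ℝ (Fin n → ℝ),
      ∀ v, B v = 0 ↔ ∀ j, bs.repr v (Sum.inl j) = 0 := by
  obtain ⟨S, hS⟩ := Submodule.exists_isCompl (LinearMap.ker B)
  have h1 := LinearMap.finrank_range_add_finrank_ker B
  rw [LinearMap.range_eq_top.2 hB, finrank_top, Module.finrank_fin_fun, Module.finrank_fin_fun] at h1
  have h2 := Submodule.finrank_add_eq_of_isCompl hS
  rw [Module.finrank_fin_fun] at h2
  let b₁ := Module.finBasisOfFinrankEq ℝ S (show Module.finrank ℝ S = m by omega)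
  let b₂ := Module.finBasisOfFinrankEq ℝ (LinearMap.ker B)
    (show Module.finrank ℝ (LinearMap.ker B) = n - m by omega)
  let e := Submodule.prodEquivOfIsCompl S (LinearMap.ker B) hS.symm
  refine ⟨(b₁.prod b₂).map e, fun v => ?_⟩
  obtain ⟨⟨x, y⟩, rfl⟩ := e.surjective v
  have h3 : B (e (x, y)) = B x := by
    have : e (x, y) = (x : Fin n → ℝ) + y := by simp [e]
    rw [this, map_add, LinearMap.mem_ker.1 y.2, add_zero]
  have h4 : B (x : Fin n → ℝ) = 0 ↔ x = 0 := by
    constructor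
    · intro h
      have h5 : (x : Fin n → ℝ) ∈ LinearMap.ker B ⊓ S := ⟨h, x.2⟩
      rw [hS.inf_eq_bot] at h5
      exact Subtype.ext ((Submodule.mem_bot ℝ).1 h5)
    · rintro rfl
      simp
  rw [h3, h4, ← b₁.repr.map_eq_zero_iff, Finsupp.ext_iff]
  simp

theorem isInvertible_of_injective {V W : Type*} [NormedAddCommGroup V] [NormedSpace ℝ V]
    [FiniteDimensional ℝ V] [NormedAddCommGroup W] [NormedSpace ℝ W] [FiniteDimensional ℝ W]
    (h : Module.finrank ℝ V = Module.finrank ℝ W) {A : V →L[ℝ] W} (hA : Function.Injective A) :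
    A.IsInvertible :=
  ⟨(LinearEquiv.ofInjectiveOfFinrankEq (A : V →ₗ[ℝ] W) hA h).toContinuousLinearEquiv, by
    ext v; rfl⟩

end Cutoff

/-! ### Frames along γ -/

section Frames

variable {n : ℕ} {Q : Type*} [TopologicalSpace Q] [ChartedSpace (E n) Q] [IsManifold (𝓡 n) ∞ Q]
  {t₁ t₂ : ℝ} {γ : ℝ → Q} {κ : Type*} [Fintype κ]

theorem repL_isInvertible {x₀ x : Q} (hx : x ∈ (chartAt (E n) x₀).source) :
    (repL x₀ x : E n →L[ℝ] E n).IsInvertible :=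
  isInvertible_of_injective rfl (repL_injective hx)

/-- The linear combinations of a family of fields along a path, at the time `t`. -/
noncomputable def frameMap (e : κ → ∀ t : ℝ, TangentSpace (𝓡 n) (γ t)) (t : ℝ) :
    (κ → ℝ) →L[ℝ] E n :=
  ∑ k, (ContinuousLinearMap.proj k : (κ → ℝ) →L[ℝ] ℝ).smulRight (vec (n := n) (e k t))

theorem frameMap_apply (e : κ → ∀ t : ℝ, TangentSpace (𝓡 n) (γ t)) (t : ℝ) (x : κ → ℝ) :
    frameMap e t x = ∑ k, x k • vec (n := n) (e k t) := by
  simp [frameMap]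

theorem frameMap_isInvertible_iff (hκ : Fintype.card κ = n)
    (e : κ → ∀ t : ℝ, TangentSpace (𝓡 n) (γ t)) (t : ℝ) :
    (frameMap e t).IsInvertible ↔ LinearIndependent ℝ fun k => e k t := by
  have h1 : (LinearIndependent ℝ fun k => e k t) ↔
      LinearIndependent ℝ fun k => vec (n := n) (e k t) := Iff.rfl
  rw [h1, Fintype.linearIndependent_iff]
  constructor
  · intro h x hx k
    have h2 : frameMap e t x = frameMap e t 0 := by rw [frameMap_apply, hx, map_zero]
    exact congrFun (h.injective h2) k
  · intro h
    refine isInvertible_of_injective (by simp [hκ]) ?_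
    rw [injective_iff_map_eq_zero]
    intro x hx
    rw [frameMap_apply] at hx
    exact funext (h x hx)

theorem rep_eq_sum {x₀ : Q} {t : ℝ} (hx : γ t ∈ (chartAt (E n) x₀).source)
    (e : κ → ∀ t : ℝ, TangentSpace (𝓡 n) (γ t)) (x : κ → ℝ) :
    repL x₀ (γ t) (frameMap e t x) = ∑ k, x k • rep x₀ (lift γ (e k) t) := by
  rw [frameMap_apply, map_sum]
  refine Finset.sum_congr rfl fun k _ => ?_
  rw [map_smul, rep_eq_repL (by exact hx)]
  rfl

/-- A field along a path with prescribed coordinates in a chart. -/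
theorem exists_field_rep (hγ : ContMDiffOn 𝓘(ℝ, ℝ) (𝓡 n) 1 γ (Icc t₁ t₂)) {x₀ : Q} {O : Set ℝ}
    (hO : IsOpen O) (hsrc : ∀ t ∈ Icc t₁ t₂ ∩ O, γ t ∈ (chartAt (E n) x₀).source) {f : ℝ → ℝ}
    (hf : ContDiff ℝ 1 f) (hfO : tsupport f ⊆ O) (u : E n) :
    ∃ w : ∀ t : ℝ, TangentSpace (𝓡 n) (γ t), IsFieldAlong t₁ t₂ γ w ∧
      ∀ t ∈ Icc t₁ t₂ ∩ O, rep x₀ (lift γ w t) = f t • u := by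
  -- For t ∈ I outside O the map `repL` may fail to be invertible, but there f t = 0 and the value
  -- is 0 in any case.
  let w : ∀ t : ℝ, TangentSpace (𝓡 n) (γ t) := fun t =>
    ((repL x₀ (γ t)).inverse (f t • u) : E n)
  have hw : ∀ t ∈ Icc t₁ t₂ ∩ O, rep x₀ (lift γ w t) = f t • u := by
    intro t ht
    rw [rep_eq_repL (by exact hsrc t ht)]
    exact (repL_isInvertible (hsrc t ht)).self_apply_inverse _
  refine ⟨w, (isFieldAlong_iff hγ).2 fun s hs => ?_, hw⟩
  by_cases h : s ∈ tsupport f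
  · have hsO := hfO h
    have hx := hsrc s ⟨hs, hsO⟩
    have hN : ∀ᶠ t in nhdsWithin s (Icc t₁ t₂), t ∈ Icc t₁ t₂ ∩ O := by
      filter_upwards [self_mem_nhdsWithin, nhdsWithin_le_nhds (hO.mem_nhds hsO)] with t h1 h2
      exact ⟨h1, h2⟩
    let v₀ : TangentBundle (𝓡 n) Q := ⟨x₀, (0 : E n)⟩
    let c : ℝ → E n × E n := fun t => (extChartAt (𝓡 n) x₀ (γ t), f t • u)
    have hc : ∀ t ∈ Icc t₁ t₂ ∩ O, extChartAt (𝓡 n).tangent v₀ (lift γ w t) = c t := by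
      intro t ht
      rw [extChartAt_tangent]
      exact congrArg (Prod.mk _) (hw t ht)
    have hcs : ∀ t ∈ Icc t₁ t₂ ∩ O, lift γ w t ∈ (extChartAt (𝓡 n).tangent v₀).source :=
      fun t ht => mem_extChartAt_tangent_source.2 (hsrc t ht)
    have h1 : ContMDiffWithinAt 𝓘(ℝ, ℝ) 𝓘(ℝ, E n × E n) 1 c (Icc t₁ t₂) s := by
      have h2 : ContMDiffWithinAt 𝓘(ℝ, ℝ) 𝓘(ℝ, E n) 1 (fun t => extChartAt (𝓡 n) x₀ (γ t))
          (Icc t₁ t₂) s := (contMDiffAt_extChartAt' (n := 1) hx).comp_contMDiffWithinAt s (hγ s hs)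
      rw [contMDiffWithinAt_iff_contDiffWithinAt] at h2 ⊢
      exact h2.prodMk (hf.smul contDiff_const).contDiffWithinAt
    have h3 : c s ∈ (extChartAt (𝓡 n).tangent v₀).target := by
      rw [← hc s ⟨hs, hsO⟩]
      exact (extChartAt (𝓡 n).tangent v₀).map_source (hcs s ⟨hs, hsO⟩)
    have h4 : ContMDiffAt 𝓘(ℝ, E n × E n) (𝓡 n).tangent 1 (extChartAt (𝓡 n).tangent v₀).symm (c s) :=
      ((contMDiffOn_extChartAt_symm (n := 2) v₀ _ h3).contMDiffAt
        ((isOpen_extChartAt_target v₀).mem_nhds h3)).of_le one_le_two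
    have h5 : ContMDiffWithinAt 𝓘(ℝ, ℝ) (𝓡 n).tangent 1 (lift γ w) (Icc t₁ t₂) s := by
      refine (h4.comp_contMDiffWithinAt s h1).congr_of_eventuallyEq ?_ ?_
      · filter_upwards [hN] with t ht
        rw [Function.comp_apply, ← hc t ht]
        exact ((extChartAt (𝓡 n).tangent v₀).left_inv (hcs t ht)).symm
      · rw [Function.comp_apply, ← hc s ⟨hs, hsO⟩]
        exact ((extChartAt (𝓡 n).tangent v₀).left_inv (hcs s ⟨hs, hsO⟩)).symm
    have h6 := (Bundle.contMDiffWithinAt_totalSpace.1 h5).2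
    rw [contMDiffWithinAt_iff_contDiffWithinAt] at h6
    exact h6
  · have h0 : ∀ t, t ∉ tsupport f → γ t ∈ (chartAt (E n) (γ s)).source →
        rep (γ s) (lift γ w t) = 0 := by
      intro t ht hx
      have h1 : w t = 0 := by
        have h2 : (repL x₀ (γ t)).inverse (f t • u) = 0 := by
          rw [image_eq_zero_of_notMem_tsupport ht, zero_smul, map_zero]
        exact h2
      rw [rep_eq_repL (by exact hx)]
      exact (congrArg (repL (γ s) (γ t)) h1).trans (map_zero _)
    refine (contDiffWithinAt_const (c := (0 : E n))).congr_of_eventuallyEq ?_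
      (h0 s h (mem_chart_source _ _))
    have h1 : ∀ᶠ τ in nhdsWithin s (Icc t₁ t₂), γ τ ∈ (chartAt (E n) (γ s)).source :=
      (hγ s hs).continuousWithinAt.preimage_mem_nhdsWithin
        ((chartAt (E n) (γ s)).open_source.mem_nhds (by simp))
    filter_upwards [h1, nhdsWithin_le_nhds ((isClosed_tsupport f).isOpen_compl.mem_nhds h)]
      with t h2 h3
    exact h0 t h3 h2

end Frames

/-! ### Local frames adapted to the constraints -/

section LocalFrames

variable {n : ℕ} {Q : Type*} [TopologicalSpace Q] [ChartedSpace (E n) Q] [IsManifold (𝓡 n) ∞ Q]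
  {t₁ t₂ : ℝ} {γ : ℝ → Q} {m : ℕ} {C : Set (TangentBundle (𝓡 n) Q)}

/-- `u` is a vector at `γ(t)` whose vertical lift is tangent to `C`. -/
def IsVertical (C : Set (TangentBundle (𝓡 n) Q)) (t₁ t₂ : ℝ) (γ : ℝ → Q) (t : ℝ) (u : E n) : Prop :=
  (⟨dot (n := n) t₁ t₂ γ t, ((0, u) : E n × E n)⟩ :
    TangentBundle (𝓡 n).tangent (TangentBundle (𝓡 n) Q)) ∈ tangentSet C

theorem frameMap_smul_sum {κ κ' : Type*} [Fintype κ] [Fintype κ'] (Y : κ → κ' → ℝ → ℝ)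
    (w : κ' → ∀ t : ℝ, TangentSpace (𝓡 n) (γ t)) (t : ℝ) (x : κ → ℝ) :
    frameMap (fun k t => ∑ j, Y k j t • w j t) t x = frameMap w t (∑ k, x k • fun j => Y k j t) := by
  rw [map_sum, frameMap_apply]
  refine Finset.sum_congr rfl fun k _ => ?_
  rw [map_smul, frameMap_apply]
  rfl

/-- The constraints in the vertical directions are of maximal rank. -/
theorem IsConstraintSystem.vertical_surjective {U : Set (TangentBundle (𝓡 n) Q)}
    {φ : Fin m → TangentBundle (𝓡 n) Q → ℝ} (hφ : IsConstraintSystem C U φ)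
    (hsub : ProjectionIsSubmersion C) {v : TangentBundle (𝓡 n) Q} (hvC : v ∈ C) (hvU : v ∈ U)
    (y : Fin m → ℝ) : ∃ u : E n, ∀ i, diffL (φ i) v (0, u) = y i := by
  let B : E n →ₗ[ℝ] (Fin m → ℝ) := LinearMap.pi fun i =>
    ((diffL (φ i) v : E n × E n →ₗ[ℝ] ℝ).comp (LinearMap.inr ℝ (E n) (E n)))
  have hB : LinearMap.range B = ⊤ := by
    -- A proper range is annihilated by a nonzero functional, whose coefficients form a relation
    -- among the fibre derivatives, which `eq_zero_of_vertical` excludes.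
    by_contra hne
    obtain ⟨f, hf0, hf⟩ := Submodule.exists_le_ker_of_lt_top _ (lt_top_iff_ne_top.2 hne)
    refine hf0 ?_
    have h1 : (fun i => f (Pi.single i 1)) = 0 := by
      refine hφ.eq_zero_of_vertical hsub hvC hvU _ fun u => ?_
      have h2 : f (B u) = 0 := hf ⟨u, rfl⟩
      rw [LinearMap.pi_apply_eq_sum_univ] at h2
      rw [← h2]
      refine Finset.sum_congr rfl fun i _ => ?_
      rw [mul_comm, smul_eq_mul]
      refine congrArg (fun z => B u i * z) (congrArg f (funext fun j => ?_))
      by_cases h : i = j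
      · subst h; simp
      · simp [h, Ne.symm h]
    refine LinearMap.pi_ext' fun i => LinearMap.ext_ring ?_
    exact congrFun h1 i
  obtain ⟨u, hu⟩ := LinearMap.range_eq_top.1 hB y
  exact ⟨u, fun i => congrFun hu i⟩

/-- Let B(t) be the matrix of the fibre derivatives of the constraints in a frame that is constant
in a chart. It is surjective at s; with a right inverse R, the map Z(t) = 1 + R(B(t) - B(s))
satisfies B(s) Z(t) = B(t) and is invertible near s. So Z(t)⁻¹ carries ker B(s) onto ker B(t), and a
basis adapted to ker B(s) becomes a C¹ frame adapted to all ker B(t) near s. -/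
theorem exists_local_adapted_frame (ht : t₁ < t₂) (hm : m < n) (hC : IsSubmanifoldOfCodim m C)
    (hsub : ProjectionIsSubmersion C) (hγ : ContMDiffOn 𝓘(ℝ, ℝ) (𝓡 n) 2 γ (Icc t₁ t₂))
    (hdC : ∀ t ∈ Icc t₁ t₂, dot (n := n) t₁ t₂ γ t ∈ C) {s : ℝ} (hs : s ∈ Icc t₁ t₂) :
    ∃ (J : Set ℝ) (e : Fin m ⊕ Fin (n - m) → ∀ t : ℝ, TangentSpace (𝓡 n) (γ t)),
      IsOpen J ∧ s ∈ J ∧ (∀ k, IsFieldAlong t₁ t₂ γ (e k)) ∧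
      ∀ t ∈ Icc t₁ t₂ ∩ J, (frameMap e t).IsInvertible ∧
        ∀ x, IsVertical C t₁ t₂ γ t (frameMap e t x) ↔ ∀ j, x (Sum.inl j) = 0 := by
  classical
  have hγ1 := hγ.of_le one_le_two
  obtain ⟨U, φ, hsU, hφ⟩ := hC _ (hdC s hs)
  -- constant fields in a chart
  have h1 : ∀ᶠ t in nhdsWithin s (Icc t₁ t₂), γ t ∈ (chartAt (E n) (γ s)).source :=
    (hγ s hs).continuousWithinAt.preimage_mem_nhdsWithin
      ((chartAt (E n) (γ s)).open_source.mem_nhds (by simp))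
  obtain ⟨f, O, J₁, hf, hO, hfO, hJ₁, hsJ₁, hJO, hf1, hsrc⟩ := exists_cutoff h1
  choose w hw hwr using fun k : Fin n =>
    exists_field_rep hγ1 hO hsrc hf hfO (EuclideanSpace.single k (1 : ℝ))
  have hwJ : ∀ t ∈ Icc t₁ t₂ ∩ J₁, (frameMap w t).IsInvertible := by
    intro t h
    have hx := hsrc t ⟨h.1, hJO h.2⟩
    refine isInvertible_of_injective (by simp) ?_
    rw [injective_iff_map_eq_zero]
    intro x hx0
    have h2 := rep_eq_sum hx w x
    rw [hx0, map_zero] at h2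
    funext k
    have h3 := congrArg (fun v : E n => v k) h2
    simp only [fun k => hwr k t ⟨h.1, hJO h.2⟩, hf1 t h.2, one_smul] at h3
    simpa [Pi.single_apply, eq_comm] using h3.symm
  -- the constraints in the vertical directions
  have hUo : ∀ᶠ t in nhdsWithin s (Icc t₁ t₂), dot (n := n) t₁ t₂ γ t ∈ U :=
    ((contMDiffOn_dot ht hγ) s hs).continuousWithinAt.preimage_mem_nhdsWithin
      (hφ.isOpen.mem_nhds hsU)
  let b : Fin m → Fin n → ℝ → ℝ := fun i k t =>
    fibreDerivative (φ i) (dot (n := n) t₁ t₂ γ t) (w k t)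
  have hb : ∀ i k, ContDiffOn ℝ 1 (b i k) (timesIn t₁ t₂ γ U) := fun i k =>
    contDiffOn_fibreDerivative ht hγ (hw k) hφ.isOpen (hφ.contMDiffOn i)
  let T : Fin m → Fin n → (Fin n → ℝ) →L[ℝ] (Fin m → ℝ) := fun i k =>
    (ContinuousLinearMap.proj k : (Fin n → ℝ) →L[ℝ] ℝ).smulRight (Pi.single i 1)
  let B : ℝ → (Fin n → ℝ) →L[ℝ] (Fin m → ℝ) := fun t => ∑ i, ∑ k, b i k t • T i k
  have hB : ContDiffOn ℝ 1 B (timesIn t₁ t₂ γ U) :=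
    ContDiffOn.sum fun i _ => ContDiffOn.sum fun k _ => (hb i k).smul contDiffOn_const
  have hBv : ∀ t ∈ timesIn t₁ t₂ γ U, ∀ x i,
      B t x i = diffL (φ i) (dot (n := n) t₁ t₂ γ t) (0, frameMap w t x) := by
    intro t h x i
    have hF : ContMDiffAt (𝓡 n).tangent 𝓘(ℝ, ℝ) 1 (φ i) (dot (n := n) t₁ t₂ γ t) :=
      ((hφ.contMDiffOn i _ h.2).contMDiffAt (hφ.isOpen.mem_nhds h.2)).of_le one_le_two
    rw [← fibreDerivative_eq_diffL hF, frameMap_apply]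
    refine Eq.trans ?_ (map_sum _ _ _).symm
    simp only [B, T, sum_apply, smul_apply,
      ContinuousLinearMap.smulRight_apply, ContinuousLinearMap.proj_apply, Finset.sum_apply,
      Pi.smul_apply, smul_eq_mul, Pi.single_apply]
    rw [Finset.sum_eq_single i (fun j _ hj => by simp [Ne.symm hj]) (by simp)]
    refine Finset.sum_congr rfl fun k _ => ?_
    rw [if_pos rfl, mul_one, mul_comm]
    exact (map_smul (fibreDerivative (φ i) (dot (n := n) t₁ t₂ γ t)) (x k) (w k t)).symm
  have hsU' : s ∈ timesIn t₁ t₂ γ U := ⟨hs, hsU⟩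
  have hBs : Function.Surjective (B s) := by
    intro y
    obtain ⟨u, hu⟩ := hφ.vertical_surjective hsub (hdC s hs) hsU y
    obtain ⟨x, rfl⟩ := (hwJ s ⟨hs, hsJ₁⟩).surjective u
    exact ⟨x, funext fun i => (hBv s hsU' x i).trans (hu i)⟩
  obtain ⟨bs, hbs⟩ := exists_basis_adapted_ker (B s : (Fin n → ℝ) →ₗ[ℝ] (Fin m → ℝ)) hBs
  obtain ⟨R, hR⟩ := (B s : (Fin n → ℝ) →ₗ[ℝ] (Fin m → ℝ)).exists_rightInverse_of_surjective
    (LinearMap.range_eq_top.2 hBs)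
  -- a change of coordinates that makes the constraints constant
  let Z : ℝ → (Fin n → ℝ) →L[ℝ] (Fin n → ℝ) := fun t =>
    1 + (LinearMap.toContinuousLinearMap R).comp (B t - B s)
  have hZ : ContDiffOn ℝ 1 Z (timesIn t₁ t₂ γ U) :=
    contDiffOn_const.add (contDiffOn_const.clm_comp (hB.sub contDiffOn_const))
  have hBZ : ∀ t, (B s).comp (Z t) = B t := by
    intro t
    refine ContinuousLinearMap.ext fun x => ?_
    have h2 : ∀ y, B s (R y) = y := fun y => LinearMap.congr_fun hR y
    simp [Z, h2]
  have hZs : Z s = 1 := by simp [Z]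
  have hZu : ∀ᶠ t in nhdsWithin s (Icc t₁ t₂), IsUnit (Z t) := by
    have h2 : ContinuousWithinAt Z (Icc t₁ t₂) s := by
      refine (hZ.continuousOn s hsU').mono_of_mem_nhdsWithin ?_
      filter_upwards [hUo, self_mem_nhdsWithin] with t h3 h4
      exact ⟨h4, h3⟩
    refine h2.preimage_mem_nhdsWithin (Units.isOpen.mem_nhds ?_)
    change IsUnit (Z s)
    rw [hZs]
    exact isUnit_one
  obtain ⟨f', O', J₂, hf', hO', hfO', hJ₂, hsJ₂, hJO', hf1', hgood⟩ := exists_cutoff (hUo.and hZu)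
  let Y : Fin m ⊕ Fin (n - m) → Fin n → ℝ → ℝ := fun k j t =>
    f' t • (Ring.inverse (Z t) (bs k) j)
  have hY : ∀ k j, ContDiffOn ℝ 1 (Y k j) (Icc t₁ t₂) := by
    intro k j
    refine contDiffOn_cutoff_smul hO' hf' hfO' fun t h => ?_
    obtain ⟨h2, u, h3⟩ := hgood t h
    have h4 : ContDiffWithinAt ℝ 1 Z (Icc t₁ t₂ ∩ O') t :=
      (hZ t ⟨h.1, h2⟩).mono fun τ hτ => ⟨hτ.1, (hgood τ hτ).1⟩
    have h5 : ContDiffAt ℝ 1 Ring.inverse (Z t) := by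
      rw [← h3]
      exact contDiffAt_ringInverse ℝ u
    have h6 := (h5.comp_contDiffWithinAt t h4).clm_apply (contDiffWithinAt_const (c := bs k))
    exact contDiffWithinAt_pi.1 h6 j
  refine ⟨J₁ ∩ J₂, fun k t => ∑ j, Y k j t • w j t, hJ₁.inter hJ₂, ⟨hsJ₁, hsJ₂⟩,
    fun k => (fieldDeriv_sum ht hs hγ1 (Y k) w (hY k) hw).1, fun t h => ?_⟩
  obtain ⟨h2, h3⟩ := hgood t ⟨h.1, hJO' h.2.2⟩
  have h4 : ∀ x : Fin m ⊕ Fin (n - m) → ℝ, (∑ k, x k • fun j => Y k j t) = Ring.inverse (Z t) (∑ k, x k • bs k) := by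
    intro x
    rw [map_sum]
    refine Finset.sum_congr rfl fun k _ => ?_
    rw [map_smul]
    refine congrArg (x k • ·) (funext fun j => ?_)
    simp only [Y, hf1' t h.2.2, one_smul]
  have h5 : ∀ x, frameMap (fun k t => ∑ j, Y k j t • w j t) t x =
      frameMap w t (Ring.inverse (Z t) (∑ k, x k • bs k)) := fun x => by
    rw [frameMap_smul_sum, h4]
  have hZZ : ∀ y, Z t (Ring.inverse (Z t) y) = y := fun y =>
    DFunLike.congr_fun (Ring.mul_inverse_cancel _ h3) y
  refine ⟨?_, fun x => ?_⟩
  · refine isInvertible_of_injective (by simp; omega) ?_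
    rw [injective_iff_map_eq_zero]
    intro x hx
    rw [h5, (hwJ t ⟨h.1, h.2.1⟩).injective.eq_iff' (map_zero _)] at hx
    have h6 := hZZ (∑ k, x k • bs k)
    rw [hx, map_zero] at h6
    exact funext (Fintype.linearIndependent_iff.1 bs.linearIndependent x h6.symm)
  · unfold IsVertical
    rw [hφ.mem_tangentSet_iff (hdC t h.1) h2, h5]
    have h6 : ∀ i, diffL (φ i) (dot (n := n) t₁ t₂ γ t)
        (0, frameMap w t (Ring.inverse (Z t) (∑ k, x k • bs k))) = B s (∑ k, x k • bs k) i := by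
      intro i
      rw [← hBv t ⟨h.1, h2⟩, ← hBZ t, ContinuousLinearMap.comp_apply, hZZ]
    simp only [h6]
    rw [← funext_iff (f := B s (∑ k, x k • bs k)) (g := fun _ => 0)]
    refine (hbs _).trans ?_
    simp only [bs.repr_sum_self]

end LocalFrames

/-! ### Global adapted frames -/

section GlobalFrames

variable {n : ℕ} {Q : Type*} [TopologicalSpace Q] [ChartedSpace (E n) Q] [IsManifold (𝓡 n) ∞ Q]
  {t₁ t₂ : ℝ} {γ : ℝ → Q} {m : ℕ} {C : Set (TangentBundle (𝓡 n) Q)}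

theorem sum_elim_eta {κ κ' : Type*} (e : κ ⊕ κ' → ∀ t : ℝ, TangentSpace (𝓡 n) (γ t)) (t : ℝ) :
    (Sum.elim (fun j => e (Sum.inl j) t) fun l => e (Sum.inr l) t) = fun k => e k t := by
  funext k
  cases k <;> rfl

theorem span_eq_top_of_isInvertible {κ : Type*} [Fintype κ]
    {e : κ → ∀ t : ℝ, TangentSpace (𝓡 n) (γ t)} {t : ℝ} (h : (frameMap e t).IsInvertible) :
    Submodule.span ℝ (range fun k => e k t) = ⊤ := by
  have h1 : Submodule.span ℝ (range fun k => vec (n := n) (e k t)) = ⊤ := by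
    rw [eq_top_iff]
    intro u _
    obtain ⟨x, rfl⟩ := h.surjective u
    rw [frameMap_apply]
    exact Submodule.sum_mem _ fun k _ =>
      Submodule.smul_mem _ _ (Submodule.subset_span (mem_range_self k))
  exact h1

/-- A `C¹` local expression of a frame. -/
theorem contDiffWithinAt_repL_comp_frameMap {κ : Type*} [Fintype κ]
    (hγ : ContMDiffOn 𝓘(ℝ, ℝ) (𝓡 n) 1 γ (Icc t₁ t₂))
    {e : κ → ∀ t : ℝ, TangentSpace (𝓡 n) (γ t)} (he : ∀ k, IsFieldAlong t₁ t₂ γ (e k))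
    {s : ℝ} (hs : s ∈ Icc t₁ t₂) :
    ContDiffWithinAt ℝ 1 (fun t => (repL (γ s) (γ t)).comp (frameMap e t)) (Icc t₁ t₂) s := by
  have h1 : ∀ᶠ t in nhdsWithin s (Icc t₁ t₂), γ t ∈ (chartAt (E n) (γ s)).source :=
    (hγ s hs).continuousWithinAt.preimage_mem_nhdsWithin
      ((chartAt (E n) (γ s)).open_source.mem_nhds (by simp))
  have h2 : ∀ t, γ t ∈ (chartAt (E n) (γ s)).source →
      (repL (γ s) (γ t)).comp (frameMap e t) = ∑ k, ContinuousLinearMap.smulRightL ℝ (κ → ℝ) (E n)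
        (ContinuousLinearMap.proj k) (rep (γ s) (lift γ (e k) t)) := by
    intro t hx
    refine ContinuousLinearMap.ext fun x => ?_
    rw [ContinuousLinearMap.comp_apply, rep_eq_sum hx, sum_apply]
    rfl
  refine ContDiffWithinAt.congr_of_eventuallyEq ?_ (h1.mono h2) (h2 s (mem_chart_source _ _))
  refine ContDiffWithinAt.sum fun k _ => ?_
  exact (ContinuousLinearMap.contDiff _).comp_contDiffWithinAt
    (isFieldAlong_rep (he k) hs (mem_chart_source _ _))

/-- The transition maps between local adapted frames form a C¹ cocycle that preserves the coordinate
subspace S of the vertical directions tangent to C. A splitting N makes (local frame c) ∘ N c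
independent of c, and N c preserves S, so the result is global and still adapted. -/
theorem exists_adapted_frame (ht : t₁ < t₂) (hm : m < n) (hC : IsSubmanifoldOfCodim m C)
    (hsub : ProjectionIsSubmersion C) (hγ : ContMDiffOn 𝓘(ℝ, ℝ) (𝓡 n) 2 γ (Icc t₁ t₂))
    (hdC : ∀ t ∈ Icc t₁ t₂, dot (n := n) t₁ t₂ γ t ∈ C) :
    ∃ (a : Fin m → ∀ t : ℝ, TangentSpace (𝓡 n) (γ t))
      (b : Fin (n - m) → ∀ t : ℝ, TangentSpace (𝓡 n) (γ t)), IsAdaptedFrame C t₁ t₂ γ a b := by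
  classical
  have hγ1 := hγ.of_le one_le_two
  choose J e hJ hsJ he hgood using fun s : Icc t₁ t₂ =>
    exists_local_adapted_frame ht hm hC hsub hγ hdC s.2
  let S : Submodule ℝ (Fin m ⊕ Fin (n - m) → ℝ) :=
    { carrier := {x | ∀ j, x (Sum.inl j) = 0}
      zero_mem' := fun _ => rfl
      add_mem' := fun {x y} hx hy j => by rw [Pi.add_apply, hx j, hy j, add_zero]
      smul_mem' := fun c x hx j => by rw [Pi.smul_apply, hx j, smul_zero] }
  let M : Icc t₁ t₂ → Icc t₁ t₂ → ℝ →
      (Fin m ⊕ Fin (n - m) → ℝ) →L[ℝ] (Fin m ⊕ Fin (n - m) → ℝ) := fun c c' t =>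
    (frameMap (e c) t).inverse.comp (frameMap (e c') t)
  have hEM : ∀ c c' t x, t ∈ Icc t₁ t₂ ∩ J c →
      frameMap (e c) t (M c c' t x) = frameMap (e c') t x := fun c c' t x h =>
    (hgood c t h).1.self_apply_inverse _
  obtain ⟨N, hN⟩ := exists_isSplitting (S := S) (M := M) ht.le hJ
    (fun t h => ⟨⟨t, h⟩, hsJ ⟨t, h⟩⟩) (fun c c' s h => by
      have hinv : ∀ {t : ℝ}, γ t ∈ (chartAt (E n) (γ s)).source →
          (repL (γ s) (γ t)).IsInvertible := fun hx => repL_isInvertible hx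
      have h1 : ∀ᶠ t in nhdsWithin s (Icc t₁ t₂ ∩ (J c ∩ J c')),
          γ t ∈ (chartAt (E n) (γ s)).source :=
        ((hγ s h.1).continuousWithinAt.mono inter_subset_left).preimage_mem_nhdsWithin
          ((chartAt (E n) (γ s)).open_source.mem_nhds (by simp))
      -- The factor `repL` cancels in the transition map, but it replaces the jumping preferred
      -- charts by the fixed chart at γ(s), in which each frame is of class C¹.
      have h2 : ∀ t, γ t ∈ (chartAt (E n) (γ s)).source → M c c' t =
          ((repL (γ s) (γ t)).comp (frameMap (e c) t)).inverse.comp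
            ((repL (γ s) (γ t)).comp (frameMap (e c') t)) := by
        intro t hx
        rw [(hinv hx).inverse_comp_of_left]
        refine ContinuousLinearMap.ext fun x => ?_
        simp only [M, ContinuousLinearMap.comp_apply]
        rw [(hinv hx).inverse_apply_self]
      refine ContDiffWithinAt.congr_of_eventuallyEq ?_ (h1.mono h2) (h2 s (mem_chart_source _ _))
      have h3 : ((repL (γ s) (γ s)).comp (frameMap (e c) s)).IsInvertible :=
        (hinv (mem_chart_source _ _)).comp (hgood c s ⟨h.1, h.2.1⟩).1
      have h4 := contDiffWithinAt_repL_comp_frameMap hγ1 (he c) h.1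
      have h5 := contDiffWithinAt_repL_comp_frameMap hγ1 (he c') h.1
      exact ((h3.contDiffAt_map_inverse.comp_contDiffWithinAt s h4).clm_comp h5).mono
        inter_subset_left)
    (fun c t h => (hgood c t h).1.inverse_comp_self)
    (fun c c' c'' t h => by
      refine ContinuousLinearMap.ext fun x => ?_
      refine (hgood c t ⟨h.1, h.2.1.1⟩).1.injective ?_
      change frameMap (e c) t (M c c' t (M c' c'' t x)) = _
      rw [hEM c c' t _ ⟨h.1, h.2.1.1⟩, hEM c' c'' t _ ⟨h.1, h.2.1.2⟩,
        hEM c c'' t _ ⟨h.1, h.2.1.1⟩])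
    (fun c c' t h x hx => by
      refine ((hgood c t ⟨h.1, h.2.1⟩).2 _).1 ?_
      rw [hEM c c' t _ ⟨h.1, h.2.1⟩]
      exact ((hgood c' t ⟨h.1, h.2.2⟩).2 x).2 hx)
  -- The local frame used at the time t is the one indexed by t itself; `hw` shows that any other
  -- frame available at t gives the same vector, whence the regularity.
  let w : Fin m ⊕ Fin (n - m) → ∀ t : ℝ, TangentSpace (𝓡 n) (γ t) := fun k t =>
    if h : t ∈ Icc t₁ t₂ then
      (frameMap (e ⟨t, h⟩) t (N ⟨t, h⟩ t (Pi.single k 1)) : E n) else (0 : E n)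
  have hw : ∀ c k t, t ∈ Icc t₁ t₂ ∩ J c →
      vec (n := n) (w k t) = frameMap (e c) t (N c t (Pi.single k 1)) := by
    intro c k t h
    have h1 : vec (n := n) (w k t) =
        frameMap (e ⟨t, h.1⟩) t (N ⟨t, h.1⟩ t (Pi.single k 1)) := dif_pos h.1
    rw [h1, ← hN.mul_eq c ⟨t, h.1⟩ t ⟨h.1, h.2, hsJ _⟩]
    exact (hEM c ⟨t, h.1⟩ t _ h).symm
  have hwf : ∀ c t x, t ∈ Icc t₁ t₂ ∩ J c → frameMap w t x = frameMap (e c) t (N c t x) := by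
    intro c t x h
    rw [frameMap_apply]
    simp only [hw c _ t h]
    conv_rhs => rw [pi_eq_sum_univ' x, map_sum, map_sum]
    refine Finset.sum_congr rfl fun k _ => ?_
    rw [map_smul, map_smul]
  have hwi : ∀ t ∈ Icc t₁ t₂, (frameMap w t).IsInvertible := by
    intro t h
    have h1 : t ∈ Icc t₁ t₂ ∩ J ⟨t, h⟩ := ⟨h, hsJ _⟩
    refine isInvertible_of_injective (by simp; omega) ?_
    rw [injective_iff_map_eq_zero]
    intro x hx
    rw [hwf ⟨t, h⟩ t x h1, (hgood _ t h1).1.injective.eq_iff' (map_zero _)] at hx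
    have h2 := DFunLike.congr_fun (Ring.inverse_mul_cancel _ (hN.isUnit ⟨t, h⟩ t h1)) x
    refine h2.symm.trans ?_
    change Ring.inverse (N ⟨t, h⟩ t) (N ⟨t, h⟩ t x) = 0
    rw [hx, map_zero]
  have hwF : ∀ k, IsFieldAlong t₁ t₂ γ (w k) := by
    intro k
    refine (isFieldAlong_iff hγ1).2 fun s hs => ?_
    let c : Icc t₁ t₂ := ⟨s, hs⟩
    have h1 : ∀ᶠ t in nhdsWithin s (Icc t₁ t₂),
        γ t ∈ (chartAt (E n) (γ s)).source ∧ t ∈ Icc t₁ t₂ ∩ J c := by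
      filter_upwards [(hγ s hs).continuousWithinAt.preimage_mem_nhdsWithin
        ((chartAt (E n) (γ s)).open_source.mem_nhds (by simp)), self_mem_nhdsWithin,
        nhdsWithin_le_nhds ((hJ c).mem_nhds (hsJ c))] with t h2 h3 h4
      exact ⟨h2, h3, h4⟩
    have h2 : ∀ t, γ t ∈ (chartAt (E n) (γ s)).source ∧ t ∈ Icc t₁ t₂ ∩ J c →
        rep (γ s) (lift γ (w k) t) =
          (repL (γ s) (γ t)).comp (frameMap (e c) t) (N c t (Pi.single k 1)) := by
      intro t h
      rw [rep_eq_repL (by exact h.1)]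
      exact congrArg (repL (γ s) (γ t)) (hw c k t h.2)
    refine ContDiffWithinAt.congr_of_eventuallyEq ?_ (h1.mono h2)
      (h2 s ⟨mem_chart_source _ _, hs, hsJ c⟩)
    refine (contDiffWithinAt_repL_comp_frameMap hγ1 (he c) hs).clm_apply ?_
    refine ContDiffWithinAt.clm_apply ?_ contDiffWithinAt_const
    exact (contDiffWithinAt_inter ((hJ c).mem_nhds (hsJ c))).1 (hN.contDiffOn c s ⟨hs, hsJ c⟩)
  refine ⟨fun j => w (Sum.inl j), fun l => w (Sum.inr l), fun j => hwF _, fun l => hwF _,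
    fun t h => ?_, fun t h => ?_, fun l t h => ?_⟩
  · rw [sum_elim_eta]
    exact (frameMap_isInvertible_iff (by simp; omega) w t).1 (hwi t h)
  · rw [sum_elim_eta]
    exact span_eq_top_of_isInvertible (hwi t h)
  · have h1 : t ∈ Icc t₁ t₂ ∩ J ⟨t, h⟩ := ⟨h, hsJ _⟩
    have h2 : IsVertical C t₁ t₂ γ t (frameMap (e ⟨t, h⟩) t (N ⟨t, h⟩ t (Pi.single (Sum.inr l) 1))) :=
      ((hgood _ t h1).2 _).2 (hN.mem _ t h1 _ fun j => Pi.single_eq_of_ne (by simp) _)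
    rw [← hw ⟨t, h⟩ _ t h1] at h2
    exact h2

end GlobalFrames

/-! ### The coframe of constraints dual to an adapted frame -/

section MatrixInverse

variable {ι : Type*} [Fintype ι] [DecidableEq ι] {s : Set ℝ}

theorem contDiffOn_det {A : ℝ → Matrix ι ι ℝ}
    (hA : ∀ i j, ContDiffOn ℝ 1 (fun t => A t i j) s) : ContDiffOn ℝ 1 (fun t => (A t).det) s := by
  simp only [Matrix.det_apply']
  exact ContDiffOn.sum fun σ _ => contDiffOn_const.mul (contDiffOn_prod fun i _ => hA _ _)

theorem contDiffOn_matrix_inv {A : ℝ → Matrix ι ι ℝ}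
    (hA : ∀ i j, ContDiffOn ℝ 1 (fun t => A t i j) s) (hu : ∀ t ∈ s, IsUnit (A t).det) (i j : ι) :
    ContDiffOn ℝ 1 (fun t => (A t)⁻¹ i j) s := by
  simp only [Matrix.inv_def, Ring.inverse_eq_inv', Matrix.smul_apply, Matrix.adjugate_apply]
  refine ((contDiffOn_det hA).inv fun t ht => (hu t ht).ne_zero).smul (contDiffOn_det fun k l => ?_)
  by_cases h : k = j
  · simp only [h, Matrix.updateRow_self]
    exact contDiffOn_const
  · simp only [Matrix.updateRow_ne h]
    exact hA k l

end MatrixInverse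

section Coframe

variable {n : ℕ} {Q : Type*} [TopologicalSpace Q] [ChartedSpace (E n) Q] [IsManifold (𝓡 n) ∞ Q]
  {t₁ t₂ : ℝ} {γ : ℝ → Q} {m : ℕ} {C U : Set (TangentBundle (𝓡 n) Q)}
  {a : Fin m → ∀ t : ℝ, TangentSpace (𝓡 n) (γ t)}
  {b : Fin (n - m) → ∀ t : ℝ, TangentSpace (𝓡 n) (γ t)}
  {φ : Fin m → TangentBundle (𝓡 n) Q → ℝ}

theorem timesIn_mem_nhdsWithin (ht : t₁ < t₂)
    (hγ : ContMDiffOn 𝓘(ℝ, ℝ) (𝓡 n) 2 γ (Icc t₁ t₂)) (hU : IsOpen U) {t : ℝ}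
    (h : t ∈ timesIn t₁ t₂ γ U) : timesIn t₁ t₂ γ U ∈ nhdsWithin t (Icc t₁ t₂) := by
  have h1 := ((contMDiffOn_dot ht hγ) t h.1).continuousWithinAt.preimage_mem_nhdsWithin
    (hU.mem_nhds h.2)
  filter_upwards [h1, self_mem_nhdsWithin] with s h2 h3
  exact ⟨h3, h2⟩

theorem IsConstraintSystem.contMDiffAt (hφ : IsConstraintSystem C U φ) (i : Fin m)
    {v : TangentBundle (𝓡 n) Q} (hv : v ∈ U) :
    ContMDiffAt (𝓡 n).tangent 𝓘(ℝ, ℝ) 1 (φ i) v :=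
  ((hφ.contMDiffOn i v hv).contMDiffAt (hφ.isOpen.mem_nhds hv)).of_le one_le_two

/-- The derivatives of the constraints in the directions of the fields `aⱼ`. -/
noncomputable def constraintMatrix (φ : Fin m → TangentBundle (𝓡 n) Q → ℝ) (t₁ t₂ : ℝ)
    (a : Fin m → ∀ t : ℝ, TangentSpace (𝓡 n) (γ t)) (t : ℝ) : Matrix (Fin m) (Fin m) ℝ :=
  Matrix.of fun i j => fibreDerivative (φ i) (dot (n := n) t₁ t₂ γ t) (a j t)

/-- The combinations of the differentials of the constraints that are dual to the fields `aⱼ`. -/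
noncomputable def dualConstraint (φ : Fin m → TangentBundle (𝓡 n) Q → ℝ) (t₁ t₂ : ℝ)
    (a : Fin m → ∀ t : ℝ, TangentSpace (𝓡 n) (γ t)) (j : Fin m) (t : ℝ) : E n × E n →L[ℝ] ℝ :=
  ∑ i, (constraintMatrix φ t₁ t₂ a t)⁻¹ j i • diffL (φ i) (dot (n := n) t₁ t₂ γ t)

theorem IsAdaptedFrame.frameMap_isInvertible (hm : m < n) (hab : IsAdaptedFrame C t₁ t₂ γ a b)
    {t : ℝ} (h : t ∈ Icc t₁ t₂) : (frameMap (Sum.elim a b) t).IsInvertible := by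
  rw [frameMap_isInvertible_iff (by simp; omega)]
  have h1 := hab.linearIndependent t h
  have h2 : (fun k => (Sum.elim a b : Fin m ⊕ Fin (n - m) → ∀ t : ℝ, TangentSpace (𝓡 n) (γ t)) k t) =
      Sum.elim (fun j => a j t) fun l => b l t := by
    funext k
    cases k <;> rfl
  rw [h2]
  exact h1

theorem constraintMatrix_apply (hφ : IsConstraintSystem C U φ) {t : ℝ}
    (hU : dot (n := n) t₁ t₂ γ t ∈ U) (i j : Fin m) :
    constraintMatrix φ t₁ t₂ a t i j =
      diffL (φ i) (dot (n := n) t₁ t₂ γ t) (0, vec (n := n) (a j t)) :=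
  fibreDerivative_eq_diffL (hφ.contMDiffAt i hU) _

theorem diffL_right (hφ : IsConstraintSystem C U φ) (hab : IsAdaptedFrame C t₁ t₂ γ a b) {t : ℝ}
    (h : t ∈ Icc t₁ t₂) (hC : dot (n := n) t₁ t₂ γ t ∈ C) (hU : dot (n := n) t₁ t₂ γ t ∈ U)
    (i : Fin m) (l : Fin (n - m)) :
    diffL (φ i) (dot (n := n) t₁ t₂ γ t) (0, vec (n := n) (b l t)) = 0 :=
  (hφ.mem_tangentSet_iff hC hU _).1 (hab.vertical l t h) i

/-- A relation among the rows is a combination of the dφ^i that vanishes on the lifts of the a_j. It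
vanishes on those of the b_l too, which are tangent to C, hence on all vertical vectors, and the
submersion property makes it trivial. -/
theorem isUnit_det_constraintMatrix (hm : m < n) (hsub : ProjectionIsSubmersion C)
    (hφ : IsConstraintSystem C U φ) (hab : IsAdaptedFrame C t₁ t₂ γ a b) {t : ℝ}
    (h : t ∈ Icc t₁ t₂) (hC : dot (n := n) t₁ t₂ γ t ∈ C) (hU : dot (n := n) t₁ t₂ γ t ∈ U) :
    IsUnit (constraintMatrix φ t₁ t₂ a t).det := by
  rw [isUnit_iff_ne_zero]
  intro h0
  obtain ⟨c, hc0, hc⟩ := Matrix.exists_vecMul_eq_zero_iff.2 h0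
  refine hc0 (hφ.eq_zero_of_vertical hsub hC hU c fun u => ?_)
  obtain ⟨x, rfl⟩ := (hab.frameMap_isInvertible hm h).surjective u
  have h1 : ∀ j, ∑ i, c i * diffL (φ i) (dot (n := n) t₁ t₂ γ t) (0, vec (n := n) (a j t)) = 0 := by
    intro j
    have h2 := congrFun hc j
    simp only [Matrix.vecMul, dotProduct, constraintMatrix_apply hφ hU] at h2
    exact h2
  let ℓ : E n × E n →L[ℝ] ℝ := ∑ i, c i • diffL (φ i) (dot (n := n) t₁ t₂ γ t)
  have hℓ : ∀ ξ, ℓ ξ = ∑ i, c i * diffL (φ i) (dot (n := n) t₁ t₂ γ t) ξ := by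
    intro ξ
    simp [ℓ]
  rw [← hℓ, frameMap_apply]
  have h2 := map_sum (ℓ.comp (ContinuousLinearMap.inr ℝ (E n) (E n)))
    (fun k => x k • vec (n := n)
      ((Sum.elim a b : Fin m ⊕ Fin (n - m) → ∀ t : ℝ, TangentSpace (𝓡 n) (γ t)) k t)) Finset.univ
  refine h2.trans (Finset.sum_eq_zero fun k _ => ?_)
  rw [map_smul]
  change x k • ℓ (0, _) = 0
  rw [hℓ]
  cases k with
  | inl j => exact (congrArg (x (Sum.inl j) • ·) (h1 j)).trans (smul_zero _)
  | inr l =>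
    refine (congrArg (x (Sum.inr l) • ·) ?_).trans (smul_zero _)
    refine Finset.sum_eq_zero fun i _ => ?_
    exact (congrArg (c i * ·) (diffL_right hφ hab h hC hU i l)).trans (mul_zero _)

/-- `β` is the coframe of constraints that is dual to the adapted frame `(a, b)`. -/
structure IsConstraintCoframe (C : Set (TangentBundle (𝓡 n) Q)) (t₁ t₂ : ℝ) (γ : ℝ → Q)
    (a : Fin m → ∀ t : ℝ, TangentSpace (𝓡 n) (γ t))
    (b : Fin (n - m) → ∀ t : ℝ, TangentSpace (𝓡 n) (γ t))
    (β : Fin m → ℝ → E n × E n →L[ℝ] ℝ) : Prop where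
  left : ∀ j k, ∀ t ∈ Icc t₁ t₂, β j t (0, vec (n := n) (a k t)) = if j = k then 1 else 0
  right : ∀ j l, ∀ t ∈ Icc t₁ t₂, β j t (0, vec (n := n) (b l t)) = 0
  mem_iff : ∀ t ∈ Icc t₁ t₂, ∀ ξ : E n × E n,
    (⟨dot (n := n) t₁ t₂ γ t, ξ⟩ : TangentBundle (𝓡 n).tangent (TangentBundle (𝓡 n) Q)) ∈
      tangentSet C ↔ ∀ j, β j t ξ = 0
  diffL_eq : ∀ U φ, IsConstraintSystem (m := m) C U φ → ∀ t ∈ timesIn t₁ t₂ γ U, ∀ i,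
    diffL (φ i) (dot (n := n) t₁ t₂ γ t) =
      ∑ j, diffL (φ i) (dot (n := n) t₁ t₂ γ t) (0, vec (n := n) (a j t)) • β j t
  eq_sum : ∀ U φ, IsConstraintSystem (m := m) C U φ → ∀ t ∈ timesIn t₁ t₂ γ U, ∀ j,
    β j t = dualConstraint φ t₁ t₂ a j t

theorem dualConstraint_left (hm : m < n) (hsub : ProjectionIsSubmersion C)
    (hφ : IsConstraintSystem C U φ) (hab : IsAdaptedFrame C t₁ t₂ γ a b) {t : ℝ}
    (h : t ∈ Icc t₁ t₂) (hC : dot (n := n) t₁ t₂ γ t ∈ C) (hU : dot (n := n) t₁ t₂ γ t ∈ U)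
    (j k : Fin m) :
    dualConstraint φ t₁ t₂ a j t (0, vec (n := n) (a k t)) = if j = k then 1 else 0 := by
  have h1 := congrFun (congrFun (Matrix.nonsing_inv_mul _
    (isUnit_det_constraintMatrix hm hsub hφ hab h hC hU)) j) k
  rw [Matrix.mul_apply, Matrix.one_apply] at h1
  rw [← h1, dualConstraint, sum_apply]
  refine Finset.sum_congr rfl fun i _ => ?_
  rw [constraintMatrix_apply hφ hU]
  rfl

theorem diffL_eq_sum_dualConstraint (hm : m < n) (hsub : ProjectionIsSubmersion C)
    (hφ : IsConstraintSystem C U φ) (hab : IsAdaptedFrame C t₁ t₂ γ a b) {t : ℝ}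
    (h : t ∈ Icc t₁ t₂) (hC : dot (n := n) t₁ t₂ γ t ∈ C) (hU : dot (n := n) t₁ t₂ γ t ∈ U)
    (i : Fin m) :
    diffL (φ i) (dot (n := n) t₁ t₂ γ t) =
      ∑ j, diffL (φ i) (dot (n := n) t₁ t₂ γ t) (0, vec (n := n) (a j t)) •
        dualConstraint φ t₁ t₂ a j t := by
  have h1 := Matrix.mul_nonsing_inv _ (isUnit_det_constraintMatrix hm hsub hφ hab h hC hU)
  simp only [dualConstraint, Finset.smul_sum, smul_smul]
  rw [Finset.sum_comm]
  have h2 : ∀ k, ∑ j, diffL (φ i) (dot (n := n) t₁ t₂ γ t) (0, vec (n := n) (a j t)) *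
      (constraintMatrix φ t₁ t₂ a t)⁻¹ j k = if i = k then 1 else 0 := by
    intro k
    have h3 := congrFun (congrFun h1 i) k
    rw [Matrix.mul_apply, Matrix.one_apply] at h3
    rw [← h3]
    refine Finset.sum_congr rfl fun j _ => ?_
    rw [constraintMatrix_apply hφ hU]
  simp only [← Finset.sum_smul, h2]
  simp

/-- The duality relations determine β^j inside the span of the differentials of the constraints, and
this span is the same for all systems at γ̇(t). So a system may be chosen separately for each t,
without regard to continuity, and the result agrees with the formula from any other system. -/
theorem exists_constraintCoframe (hm : m < n) (hC : IsSubmanifoldOfCodim m C)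
    (hsub : ProjectionIsSubmersion C) (hdC : ∀ t ∈ Icc t₁ t₂, dot (n := n) t₁ t₂ γ t ∈ C)
    (hab : IsAdaptedFrame C t₁ t₂ γ a b) : ∃ β, IsConstraintCoframe C t₁ t₂ γ a b β := by
  classical
  choose! V ψ hV hψ using hC
  let β : Fin m → ℝ → E n × E n →L[ℝ] ℝ := fun j t =>
    dualConstraint (ψ (dot (n := n) t₁ t₂ γ t)) t₁ t₂ a j t
  have hβ : ∀ U φ, IsConstraintSystem (m := m) C U φ → ∀ t ∈ timesIn t₁ t₂ γ U, ∀ j,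
      β j t = dualConstraint φ t₁ t₂ a j t := by
    intro U φ hφ t h j
    have hCt := hdC t h.1
    have hVt := hV _ hCt
    have hψt := hψ _ hCt
    have h1 : ∀ i, ∃ c : Fin m → ℝ, diffL (ψ (dot (n := n) t₁ t₂ γ t) i) (dot (n := n) t₁ t₂ γ t) =
        ∑ k, c k • diffL (φ k) (dot (n := n) t₁ t₂ γ t) := fun i =>
      hφ.diffL_mem_span (hψt.isConstraint i) hCt h.2 hVt
    -- The covector built from the chosen system lies in the span of the dual covectors of φ;
    -- evaluation on the lifts of the a_k then reads off its coefficients.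
    have h2 : β j t ∈ Submodule.span ℝ (range fun k => dualConstraint φ t₁ t₂ a k t) := by
      refine Submodule.sum_mem _ fun i _ => Submodule.smul_mem _ _ ?_
      obtain ⟨c, hc⟩ := h1 i
      rw [hc]
      refine Submodule.sum_mem _ fun k _ => Submodule.smul_mem _ _ ?_
      rw [diffL_eq_sum_dualConstraint hm hsub hφ hab h.1 hCt h.2 k]
      exact Submodule.sum_mem _ fun l _ => Submodule.smul_mem _ _
        (Submodule.subset_span (mem_range_self l))
    obtain ⟨d, hd⟩ := (Submodule.mem_span_range_iff_exists_fun ℝ).1 h2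
    have h3 : ∀ k, d k = if j = k then 1 else 0 := by
      intro k
      rw [← dualConstraint_left hm hsub hψt hab h.1 hCt hVt j k]
      change _ = β j t _
      rw [← hd, sum_apply]
      simp only [smul_apply, dualConstraint_left hm hsub hφ hab h.1 hCt h.2]
      simp
    rw [← hd]
    simp [h3]
  have hψ' : ∀ t ∈ Icc t₁ t₂, t ∈ timesIn t₁ t₂ γ (V (dot (n := n) t₁ t₂ γ t)) := fun t h =>
    ⟨h, hV _ (hdC t h)⟩
  have hd : ∀ U φ, IsConstraintSystem (m := m) C U φ → ∀ t ∈ timesIn t₁ t₂ γ U, ∀ i,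
      diffL (φ i) (dot (n := n) t₁ t₂ γ t) =
        ∑ j, diffL (φ i) (dot (n := n) t₁ t₂ γ t) (0, vec (n := n) (a j t)) • β j t := by
    intro U φ hφ t h i
    simp only [hβ U φ hφ t h]
    exact diffL_eq_sum_dualConstraint hm hsub hφ hab h.1 (hdC t h.1) h.2 i
  refine ⟨β, fun j k t h => ?_, fun j l t h => ?_, fun t h ξ => ?_, hd, hβ⟩
  · exact dualConstraint_left hm hsub (hψ _ (hdC t h)) hab h (hdC t h) (hV _ (hdC t h)) j k
  · change dualConstraint _ t₁ t₂ a j t _ = 0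
    rw [dualConstraint, sum_apply]
    refine Finset.sum_eq_zero fun i _ => ?_
    rw [smul_apply, diffL_right (hψ _ (hdC t h)) hab h (hdC t h) (hV _ (hdC t h)), smul_zero]
  · rw [(hψ _ (hdC t h)).mem_tangentSet_iff (hdC t h) (hV _ (hdC t h))]
    constructor
    · intro h1 j
      change dualConstraint _ t₁ t₂ a j t _ = 0
      rw [dualConstraint, sum_apply]
      refine Finset.sum_eq_zero fun i _ => ?_
      rw [smul_apply, h1 i, smul_zero]
    · intro h1 i
      rw [hd _ _ (hψ _ (hdC t h)) t (hψ' t h) i, sum_apply]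
      refine Finset.sum_eq_zero fun j _ => ?_
      rw [smul_apply, h1 j, smul_zero]

theorem contDiffOn_constraintMatrix_inv (ht : t₁ < t₂) (hm : m < n)
    (hsub : ProjectionIsSubmersion C) (hγ : ContMDiffOn 𝓘(ℝ, ℝ) (𝓡 n) 2 γ (Icc t₁ t₂))
    (hdC : ∀ t ∈ Icc t₁ t₂, dot (n := n) t₁ t₂ γ t ∈ C)
    (hφ : IsConstraintSystem C U φ) (hab : IsAdaptedFrame C t₁ t₂ γ a b) (i j : Fin m) :
    ContDiffOn ℝ 1 (fun t => (constraintMatrix φ t₁ t₂ a t)⁻¹ i j) (timesIn t₁ t₂ γ U) :=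
  contDiffOn_matrix_inv (fun k l => contDiffOn_fibreDerivative ht hγ (hab.isFieldAlong_left l)
    hφ.isOpen (hφ.contMDiffOn k)) (fun t h =>
    isUnit_det_constraintMatrix hm hsub hφ hab h.1 (hdC t h.1) h.2) i j

/-- Near each time the coframe may be computed from one fixed system, with C¹ coefficients, and
`continuousOn_diffL` handles the differentials. -/
theorem IsConstraintCoframe.continuousOn {β : Fin m → ℝ → E n × E n →L[ℝ] ℝ} (ht : t₁ < t₂)
    (hm : m < n) (hC : IsSubmanifoldOfCodim m C)
    (hsub : ProjectionIsSubmersion C) (hγ : ContMDiffOn 𝓘(ℝ, ℝ) (𝓡 n) 2 γ (Icc t₁ t₂))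
    (hdC : ∀ t ∈ Icc t₁ t₂, dot (n := n) t₁ t₂ γ t ∈ C)
    (hab : IsAdaptedFrame C t₁ t₂ γ a b) (hβ : IsConstraintCoframe C t₁ t₂ γ a b β)
    {w : ∀ t : ℝ, TangentSpace (𝓡 n) (γ t)} (hw : IsFieldAlong t₁ t₂ γ w) (j : Fin m) :
    ContinuousOn (fun t => β j t (vec (n := n) (w t), fieldDeriv t₁ t₂ γ w t)) (Icc t₁ t₂) := by
  intro t h
  obtain ⟨U, φ, htU, hφ⟩ := hC _ (hdC t h)
  have h1 : ContinuousOn (fun t => ∑ i, (constraintMatrix φ t₁ t₂ a t)⁻¹ j i *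
      diffL (φ i) (dot (n := n) t₁ t₂ γ t) (vec (n := n) (w t), fieldDeriv t₁ t₂ γ w t))
      (timesIn t₁ t₂ γ U) :=
    continuousOn_finsetSum _ fun i _ =>
      (contDiffOn_constraintMatrix_inv ht hm hsub hγ hdC hφ hab j i).continuousOn.mul
        (continuousOn_diffL ht hγ hw hφ.isOpen fun v hv =>
          (hφ.contMDiffAt i hv).contMDiffWithinAt)
  have h2 : ContinuousOn (fun t => β j t (vec (n := n) (w t), fieldDeriv t₁ t₂ γ w t))
      (timesIn t₁ t₂ γ U) := by
    refine h1.congr fun s hs => ?_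
    rw [hβ.eq_sum U φ hφ s hs, dualConstraint, sum_apply]
    rfl
  exact (h2 t ⟨h, htU⟩).mono_of_mem_nhdsWithin (timesIn_mem_nhdsWithin ht hγ hφ.isOpen ⟨h, htU⟩)

end Coframe

/-! ### Fields and equations expressed in a frame -/

section Coefficients

variable {n : ℕ} {Q : Type*} [TopologicalSpace Q] [ChartedSpace (E n) Q] [IsManifold (𝓡 n) ∞ Q]
  {t₁ t₂ t : ℝ} {γ : ℝ → Q} {κ : Type*} [Fintype κ]
  {e : κ → ∀ t : ℝ, TangentSpace (𝓡 n) (γ t)} {w w' : ∀ t : ℝ, TangentSpace (𝓡 n) (γ t)}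

theorem lift_congr (h : w t = w' t) : lift γ w t = lift γ w' t :=
  congrArg (fun u : E n => (⟨γ t, u⟩ : TangentBundle (𝓡 n) Q)) h

theorem fieldDeriv_congr (hw : ∀ t ∈ Icc t₁ t₂, w t = w' t) (h : t ∈ Icc t₁ t₂) :
    fieldDeriv t₁ t₂ γ w t = fieldDeriv t₁ t₂ γ w' t :=
  derivWithin_congr (fun s hs => congrArg (rep (γ t)) (lift_congr (hw s hs)))
    (congrArg (rep (γ t)) (lift_congr (hw t h)))

/-- The coefficients of a `C¹` field in a `C¹` frame are of class `C¹`. -/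
theorem exists_coefficients (hγ : ContMDiffOn 𝓘(ℝ, ℝ) (𝓡 n) 1 γ (Icc t₁ t₂))
    (he : ∀ k, IsFieldAlong t₁ t₂ γ (e k))
    (hinv : ∀ t ∈ Icc t₁ t₂, (frameMap e t).IsInvertible) (hw : IsFieldAlong t₁ t₂ γ w) :
    ∃ x : κ → ℝ → ℝ, (∀ k, ContDiffOn ℝ 1 (x k) (Icc t₁ t₂)) ∧
      ∀ t ∈ Icc t₁ t₂, w t = ∑ k, x k t • e k t := by
  let x : ℝ → κ → ℝ := fun t => (frameMap e t).inverse (vec (n := n) (w t))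
  have hx : ContDiffOn ℝ 1 x (Icc t₁ t₂) := by
    intro s hs
    have h1 : ∀ᶠ t in nhdsWithin s (Icc t₁ t₂), γ t ∈ (chartAt (E n) (γ s)).source :=
      (hγ s hs).continuousWithinAt.preimage_mem_nhdsWithin
        ((chartAt (E n) (γ s)).open_source.mem_nhds (by simp))
    have h2 : ∀ t, γ t ∈ (chartAt (E n) (γ s)).source → x t =
        ((repL (γ s) (γ t)).comp (frameMap e t)).inverse (rep (γ s) (lift γ w t)) := by
      intro t hx
      rw [(repL_isInvertible hx).inverse_comp_of_left, ContinuousLinearMap.comp_apply,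
        rep_eq_repL (by exact hx)]
      exact congrArg (frameMap e t).inverse ((repL_isInvertible hx).inverse_apply_self _).symm
    refine ContDiffWithinAt.congr_of_eventuallyEq ?_ (h1.mono h2) (h2 s (mem_chart_source _ _))
    have h3 : ((repL (γ s) (γ s)).comp (frameMap e s)).IsInvertible :=
      (repL_isInvertible (mem_chart_source _ _)).comp (hinv s hs)
    exact (h3.contDiffAt_map_inverse.comp_contDiffWithinAt s
      (contDiffWithinAt_repL_comp_frameMap hγ he hs)).clm_apply
      (isFieldAlong_rep hw hs (mem_chart_source _ _))
  refine ⟨fun k t => x t k, fun k t h => contDiffWithinAt_pi.1 (hx t h) k, fun t h => ?_⟩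
  have h1 := (hinv t h).self_apply_inverse (vec (n := n) (w t))
  rw [frameMap_apply] at h1
  exact h1.symm

/-- Leibniz rule: s ẇ = ∑ (x_k s(ė_k) + x_k' vl(e_k)). The derivatives of the coefficients enter
only through vertical lifts, so the coframe isolates those of the κ^j. -/
theorem apply_fieldDeriv_sum (ht : t₁ < t₂) (h : t ∈ Icc t₁ t₂)
    (hγ : ContMDiffOn 𝓘(ℝ, ℝ) (𝓡 n) 1 γ (Icc t₁ t₂)) (he : ∀ k, IsFieldAlong t₁ t₂ γ (e k))
    {x : κ → ℝ → ℝ} (hx : ∀ k, ContDiffOn ℝ 1 (x k) (Icc t₁ t₂))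
    (hw : ∀ t ∈ Icc t₁ t₂, w t = ∑ k, x k t • e k t) (ℓ : E n × E n →L[ℝ] ℝ) :
    ℓ (vec (n := n) (w t), fieldDeriv t₁ t₂ γ w t) =
      ∑ k, (x k t * ℓ (vec (n := n) (e k t), fieldDeriv t₁ t₂ γ (e k) t) +
        derivWithin (x k) (Icc t₁ t₂) t * ℓ (0, vec (n := n) (e k t))) := by
  have h1 : (vec (n := n) (w t), fieldDeriv t₁ t₂ γ w t) =
      ∑ k, (x k t • (vec (n := n) (e k t), fieldDeriv t₁ t₂ γ (e k) t) +
        derivWithin (x k) (Icc t₁ t₂) t • ((0 : E n), vec (n := n) (e k t))) := by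
    refine Prod.ext ?_ ?_
    · rw [Prod.fst_sum]
      simp only [Prod.smul_mk, Prod.mk_add_mk, smul_zero, add_zero]
      exact hw t h
    · rw [Prod.snd_sum]
      simp only [Prod.smul_mk, Prod.mk_add_mk]
      rw [fieldDeriv_congr hw h, (fieldDeriv_sum ht h hγ x e hx he).2]
  rw [h1, map_sum]
  simp only [map_add, map_smul, smul_eq_mul]

theorem apply_vertical_sum {x : κ → ℝ → ℝ} (hw : w t = ∑ k, x k t • e k t)
    (ℓ : E n × E n →L[ℝ] ℝ) :
    ℓ (0, vec (n := n) (w t)) = ∑ k, x k t * ℓ (0, vec (n := n) (e k t)) := by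
  have h1 : ((0 : E n), vec (n := n) (w t)) = ∑ k, x k t • ((0 : E n), vec (n := n) (e k t)) := by
    refine Prod.ext ?_ ?_
    · rw [Prod.fst_sum]
      simp
    · rw [Prod.snd_sum]
      exact hw
  rw [h1, map_sum]
  simp only [map_smul, smul_eq_mul]

/-- It suffices to check Euler-Lagrange equations on a frame. -/
theorem forall_field_hasDerivWithinAt_iff (ht : t₁ < t₂) (h : t ∈ Icc t₁ t₂)
    (hγ : ContMDiffOn 𝓘(ℝ, ℝ) (𝓡 n) 1 γ (Icc t₁ t₂)) (he : ∀ k, IsFieldAlong t₁ t₂ γ (e k))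
    (hinv : ∀ t ∈ Icc t₁ t₂, (frameMap e t).IsInvertible) (ℓ : ℝ → E n × E n →L[ℝ] ℝ) :
    (∀ w : ∀ t : ℝ, TangentSpace (𝓡 n) (γ t), IsFieldAlong t₁ t₂ γ w →
      HasDerivWithinAt (fun τ => ℓ τ (0, vec (n := n) (w τ)))
        (ℓ t (vec (n := n) (w t), fieldDeriv t₁ t₂ γ w t)) (Icc t₁ t₂) t) ↔
    ∀ k, HasDerivWithinAt (fun τ => ℓ τ (0, vec (n := n) (e k τ)))
        (ℓ t (vec (n := n) (e k t), fieldDeriv t₁ t₂ γ (e k) t)) (Icc t₁ t₂) t := by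
  refine ⟨fun H k => H (e k) (he k), fun H w hw => ?_⟩
  obtain ⟨x, hx, hwx⟩ := exists_coefficients hγ he hinv hw
  rw [apply_fieldDeriv_sum ht h hγ he hx hwx]
  -- Both sides obey the same Leibniz rule in w: the terms with x_k' cancel, so the equation is
  -- linear over C¹ functions and can be tested on a frame.
  have h1 : HasDerivWithinAt (fun τ => ∑ k, x k τ * ℓ τ (0, vec (n := n) (e k τ)))
      (∑ k, (x k t * ℓ t (vec (n := n) (e k t), fieldDeriv t₁ t₂ γ (e k) t) +
        derivWithin (x k) (Icc t₁ t₂) t * ℓ t (0, vec (n := n) (e k t)))) (Icc t₁ t₂) t := by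
    refine HasDerivWithinAt.fun_sum fun k _ => ?_
    have h2 := (((hx k).differentiableOn one_ne_zero) t h).hasDerivWithinAt.mul (H k)
    refine h2.congr_deriv ?_
    ring
  exact h1.congr (fun τ hτ => apply_vertical_sum (hwx τ hτ) (ℓ τ)) (apply_vertical_sum (hwx t h) (ℓ t))

end Coefficients

/-! ### Admissible variation fields as solutions of a linear system -/

section Admissible

variable {n : ℕ} {Q : Type*} [TopologicalSpace Q] [ChartedSpace (E n) Q] [IsManifold (𝓡 n) ∞ Q]
  {t₁ t₂ : ℝ} {γ : ℝ → Q} {m : ℕ} {C : Set (TangentBundle (𝓡 n) Q)}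
  {a : Fin m → ∀ t : ℝ, TangentSpace (𝓡 n) (γ t)}
  {b : Fin (n - m) → ∀ t : ℝ, TangentSpace (𝓡 n) (γ t)}
  {β : Fin m → ℝ → E n × E n →L[ℝ] ℝ}

theorem IsAdaptedFrame.isFieldAlong (hab : IsAdaptedFrame C t₁ t₂ γ a b)
    (k : Fin m ⊕ Fin (n - m)) :
    IsFieldAlong t₁ t₂ γ
      ((Sum.elim a b : Fin m ⊕ Fin (n - m) → ∀ t : ℝ, TangentSpace (𝓡 n) (γ t)) k) := by
  cases k with
  | inl j => exact hab.isFieldAlong_left j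
  | inr l => exact hab.isFieldAlong_right l

/-- Admissible variation fields in terms of their coefficients in an adapted frame. -/
theorem isAdmissibleField_iff (ht : t₁ < t₂) (hm : m < n)
    (hγ : ContMDiffOn 𝓘(ℝ, ℝ) (𝓡 n) 1 γ (Icc t₁ t₂)) (hab : IsAdaptedFrame C t₁ t₂ γ a b)
    (hβ : IsConstraintCoframe C t₁ t₂ γ a b β) {kap : Fin m → ℝ → ℝ} {lam : Fin (n - m) → ℝ → ℝ}
    (hkap : ∀ j, ContDiffOn ℝ 1 (kap j) (Icc t₁ t₂))
    (hlam : ∀ l, ContDiffOn ℝ 1 (lam l) (Icc t₁ t₂))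
    {w : ∀ t : ℝ, TangentSpace (𝓡 n) (γ t)} (hw : IsFieldAlong t₁ t₂ γ w)
    (hwx : ∀ t ∈ Icc t₁ t₂, w t = ∑ j, kap j t • a j t + ∑ l, lam l t • b l t) :
    IsAdmissibleField C t₁ t₂ γ w ↔
      ((∀ j, kap j t₁ = 0 ∧ kap j t₂ = 0) ∧ ∀ l, lam l t₁ = 0 ∧ lam l t₂ = 0) ∧
      ∀ j, ∀ t ∈ Icc t₁ t₂, HasDerivWithinAt (kap j)
        (-(∑ i, β j t (vec (n := n) (a i t), fieldDeriv t₁ t₂ γ (a i) t) * kap i t +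
          ∑ l, β j t (vec (n := n) (b l t), fieldDeriv t₁ t₂ γ (b l) t) * lam l t))
        (Icc t₁ t₂) t := by
  classical
  let e : Fin m ⊕ Fin (n - m) → ∀ t : ℝ, TangentSpace (𝓡 n) (γ t) := Sum.elim a b
  let x : Fin m ⊕ Fin (n - m) → ℝ → ℝ := Sum.elim kap lam
  have hx : ∀ k, ContDiffOn ℝ 1 (x k) (Icc t₁ t₂) := by
    rintro (j | l)
    exacts [hkap j, hlam l]
  have hwe : ∀ t ∈ Icc t₁ t₂, w t = ∑ k, x k t • e k t := by
    intro t h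
    rw [Fintype.sum_sum_type]
    exact hwx t h
  have hzero : ∀ t ∈ Icc t₁ t₂, w t = 0 ↔ (∀ j, kap j t = 0) ∧ ∀ l, lam l t = 0 := by
    intro t h
    rw [hwe t h]
    constructor
    · intro h0
      have h1 : frameMap e t (fun k => x k t) = 0 := (frameMap_apply _ _ _).trans h0
      have h2 := (hab.frameMap_isInvertible hm h).injective (h1.trans (map_zero _).symm)
      exact ⟨fun j => congrFun h2 (Sum.inl j), fun l => congrFun h2 (Sum.inr l)⟩
    · rintro ⟨h1, h2⟩
      refine Finset.sum_eq_zero fun k _ => ?_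
      have h3 : x k t = 0 := by
        cases k with
        | inl j => exact h1 j
        | inr l => exact h2 l
      rw [h3, zero_smul]
  -- Duality of β and the frame leaves κ_j' as the only derivative, with coefficient 1; the tangency
  -- condition is therefore an explicit equation for κ.
  have hd : ∀ j, ∀ t ∈ Icc t₁ t₂, β j t (vec (n := n) (w t), fieldDeriv t₁ t₂ γ w t) =
      (∑ i, β j t (vec (n := n) (a i t), fieldDeriv t₁ t₂ γ (a i) t) * kap i t +
          ∑ l, β j t (vec (n := n) (b l t), fieldDeriv t₁ t₂ γ (b l) t) * lam l t) +
        derivWithin (kap j) (Icc t₁ t₂) t := by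
    intro j t h
    rw [apply_fieldDeriv_sum ht h hγ hab.isFieldAlong hx hwe, Fintype.sum_sum_type]
    simp only [x, Sum.elim_inl, Sum.elim_inr, hβ.left _ _ t h, hβ.right _ _ t h, mul_zero, add_zero,
      Finset.sum_add_distrib, mul_ite, mul_one, Finset.sum_ite_eq, Finset.mem_univ, if_true]
    simp only [mul_comm (β j t _)]
    ring
  have hder : ∀ j, ∀ t ∈ Icc t₁ t₂, ∀ c : ℝ,
      HasDerivWithinAt (kap j) (-c) (Icc t₁ t₂) t ↔ c + derivWithin (kap j) (Icc t₁ t₂) t = 0 := by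
    intro j t h c
    have h1 := (((hkap j).differentiableOn one_ne_zero) t h).hasDerivWithinAt
    constructor
    · intro h2
      rw [h2.derivWithin (uniqueDiffOn_Icc ht t h)]
      ring
    · intro h2
      exact h1.congr_deriv (by linarith)
  have htan : (∀ t ∈ Icc t₁ t₂, involutionDot t₁ t₂ γ w t ∈ tangentSet C) ↔
      ∀ j, ∀ t ∈ Icc t₁ t₂, β j t (vec (n := n) (w t), fieldDeriv t₁ t₂ γ w t) = 0 := by
    have h1 : ∀ t ∈ Icc t₁ t₂, involutionDot t₁ t₂ γ w t ∈ tangentSet C ↔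
        ∀ j, β j t (vec (n := n) (w t), fieldDeriv t₁ t₂ γ w t) = 0 := by
      intro t h
      rw [involutionDot_eq ht h hγ hw]
      exact hβ.mem_iff t h _
    exact ⟨fun H j t h => (h1 t h).1 (H t h) j, fun H t h => (h1 t h).2 fun j => H j t h⟩
  have hl := hzero t₁ (left_mem_Icc.2 ht.le)
  have hr := hzero t₂ (right_mem_Icc.2 ht.le)
  constructor
  · intro H
    have h1 := hl.1 H.left
    have h2 := hr.1 H.right
    refine ⟨⟨fun j => ⟨h1.1 j, h2.1 j⟩, fun l => ⟨h1.2 l, h2.2 l⟩⟩, fun j t h => ?_⟩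
    rw [hder j t h, ← hd j t h]
    exact htan.1 H.tangent j t h
  · rintro ⟨⟨h1, h2⟩, h3⟩
    refine ⟨hw, hl.2 ⟨fun j => (h1 j).1, fun l => (h2 l).1⟩,
      hr.2 ⟨fun j => (h1 j).2, fun l => (h2 l).2⟩, htan.2 fun j t h => ?_⟩
    rw [hd j t h, ← hder j t h]
    exact h3 j t h

theorem isFieldAlong_of_eq_sum (ht : t₁ < t₂) (hγ : ContMDiffOn 𝓘(ℝ, ℝ) (𝓡 n) 1 γ (Icc t₁ t₂))
    (hab : IsAdaptedFrame C t₁ t₂ γ a b) {kap : Fin m → ℝ → ℝ} {lam : Fin (n - m) → ℝ → ℝ}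
    (hkap : ∀ j, ContDiffOn ℝ 1 (kap j) (Icc t₁ t₂))
    (hlam : ∀ l, ContDiffOn ℝ 1 (lam l) (Icc t₁ t₂)) :
    IsFieldAlong t₁ t₂ γ (fun t => ∑ j, kap j t • a j t + ∑ l, lam l t • b l t) := by
  let x : Fin m ⊕ Fin (n - m) → ℝ → ℝ := Sum.elim kap lam
  have hx : ∀ k, ContDiffOn ℝ 1 (x k) (Icc t₁ t₂) := by
    rintro (j | l)
    exacts [hkap j, hlam l]
  have h1 := (fieldDeriv_sum ht (left_mem_Icc.2 ht.le) hγ x _ hx hab.isFieldAlong).1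
  simp only [Fintype.sum_sum_type] at h1
  exact h1

/-- The free components of the admissible variation fields. -/
theorem exists_admissible_iff (ht : t₁ < t₂) (hm : m < n) (hC : IsSubmanifoldOfCodim m C)
    (hsub : ProjectionIsSubmersion C) (hγ : ContMDiffOn 𝓘(ℝ, ℝ) (𝓡 n) 2 γ (Icc t₁ t₂))
    (hdC : ∀ t ∈ Icc t₁ t₂, dot (n := n) t₁ t₂ γ t ∈ C) (hab : IsAdaptedFrame C t₁ t₂ γ a b) :
    ∃ K : Fin m → Fin (n - m) → ℝ → ℝ, (∀ j l, ContinuousOn (K j l) (Icc t₁ t₂)) ∧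
      ∀ lam : Fin (n - m) → ℝ → ℝ, (∀ l, ContDiffOn ℝ 1 (lam l) (Icc t₁ t₂)) →
        (∀ l, lam l t₁ = 0 ∧ lam l t₂ = 0) →
        ((∃ kap : Fin m → ℝ → ℝ, (∀ j, ContDiffOn ℝ 1 (kap j) (Icc t₁ t₂)) ∧
            IsAdmissibleField C t₁ t₂ γ
              (fun t => ∑ j, kap j t • a j t + ∑ l, lam l t • b l t)) ↔
          ∀ j, ∫ t in t₁..t₂, ∑ l, K j l t * lam l t = 0) := by
  have hγ1 := hγ.of_le one_le_two
  obtain ⟨β, hβ⟩ := exists_constraintCoframe hm hC hsub hdC hab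
  let N : Fin m → Fin m → ℝ → ℝ := fun j i t =>
    β j t (vec (n := n) (a i t), fieldDeriv t₁ t₂ γ (a i) t)
  let K₀ : Fin m → Fin (n - m) → ℝ → ℝ := fun j l t =>
    β j t (vec (n := n) (b l t), fieldDeriv t₁ t₂ γ (b l) t)
  have hN : ∀ j i, ContinuousOn (N j i) (Icc t₁ t₂) := fun j i =>
    hβ.continuousOn ht hm hC hsub hγ hdC hab (hab.isFieldAlong_left i) j
  have hK₀ : ∀ j l, ContinuousOn (K₀ j l) (Icc t₁ t₂) := fun j l =>
    hβ.continuousOn ht hm hC hsub hγ hdC hab (hab.isFieldAlong_right l) j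
  obtain ⟨Φ, Ψ, hΦΨ, hΦ, hΨ⟩ := exists_fundamental_matrix ht N hN
  have hΨc : ∀ i j, ContinuousOn (fun t => Ψ t i j) (Icc t₁ t₂) :=
    fun i j t h => (hΨ i j t h).continuousWithinAt
  -- K = ΨK₀, the integrand of variation of constants.
  refine ⟨fun j l t => ∑ i, Ψ t j i * K₀ i l t, fun j l =>
    continuousOn_finsetSum _ fun i _ => (hΨc j i).mul (hK₀ i l), fun lam hlam hlam0 => ?_⟩
  rw [← exists_boundary_solution_iff ht N K₀ hK₀ hΦΨ hΦ hΨ lam fun l => (hlam l).continuousOn]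
  refine exists_congr fun kap => ⟨fun ⟨hkap, H⟩ => ?_, fun ⟨h0, h1⟩ => ?_⟩
  · have h2 := (isAdmissibleField_iff ht hm hγ1 hab hβ hkap hlam H.isFieldAlong fun t _ => rfl).1 H
    exact ⟨h2.1.1, h2.2⟩
  · have hc : ∀ j, ContinuousOn (kap j) (Icc t₁ t₂) := fun j t h =>
      (h1 j t h).continuousWithinAt
    have hkap : ∀ j, ContDiffOn ℝ 1 (kap j) (Icc t₁ t₂) := fun j =>
      contDiffOn_one_of_hasDerivWithinAt ht (h1 j) <|
        ((continuousOn_finsetSum _ fun i _ => (hN j i).mul (hc i)).add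
          (continuousOn_finsetSum _ fun l _ => (hK₀ j l).mul (hlam l).continuousOn)).neg
    exact ⟨hkap, (isAdmissibleField_iff ht hm hγ1 hab hβ hkap hlam
      (isFieldAlong_of_eq_sum ht hγ1 hab hkap hlam) fun t _ => rfl).2 ⟨⟨h0, hlam0⟩, h1⟩⟩

end Admissible

/-! ### Critical paths and multipliers -/

section Multipliers

variable {n : ℕ} {Q : Type*} [TopologicalSpace Q] [ChartedSpace (E n) Q] [IsManifold (𝓡 n) ∞ Q]
  {t₁ t₂ : ℝ} {γ : ℝ → Q} {m : ℕ} {C : Set (TangentBundle (𝓡 n) Q)}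
  {L : TangentBundle (𝓡 n) Q → ℝ}
  {a : Fin m → ∀ t : ℝ, TangentSpace (𝓡 n) (γ t)}
  {b : Fin (n - m) → ∀ t : ℝ, TangentSpace (𝓡 n) (γ t)}
  {β : Fin m → ℝ → E n × E n →L[ℝ] ℝ}

theorem timesIn_eq_Icc {U : Set (TangentBundle (𝓡 n) Q)}
    (hU : ∀ t ∈ Icc t₁ t₂, dot (n := n) t₁ t₂ γ t ∈ U) : timesIn t₁ t₂ γ U = Icc t₁ t₂ :=
  Subset.antisymm (fun _ h => h.1) fun t h => ⟨h, hU t h⟩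

/-- The first variation depends only on the variation field, and `exists_variation` realizes every
admissible field by a C² variation with fixed ends. -/
theorem isCritical_iff (ht : t₁ < t₂) (hL : ContMDiff (𝓡 n).tangent 𝓘(ℝ, ℝ) 2 L)
    (hγ : ContMDiffOn 𝓘(ℝ, ℝ) (𝓡 n) 2 γ (Icc t₁ t₂)) :
    IsCritical L C t₁ t₂ γ ↔ ∀ w : ∀ t : ℝ, TangentSpace (𝓡 n) (γ t),
      IsAdmissibleField C t₁ t₂ γ w →
        ∫ t in t₁..t₂, diffL L (dot (n := n) t₁ t₂ γ t)
          (vec (n := n) (w t), fieldDeriv t₁ t₂ γ w t) = 0 := by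
  constructor
  · intro H w hw
    obtain ⟨δ, Γ, hδ, hΓ, hz, hv, hl, hr⟩ := exists_variation ht hγ hw.isFieldAlong
    exact (hasDerivAt_action hδ ht hΓ hz hv hL).unique
      (H δ Γ w ⟨hδ, hΓ, hl hw.left, hr hw.right, hz⟩ hv hw)
  · intro H δ Γ w hΓ hv hw
    have h1 := hasDerivAt_action hΓ.pos ht hΓ.contMDiffOn hΓ.zero hv hL
    rwa [H w hw] at h1

/-- The differential of the Lagrangian, extended by multiples of the coframe of constraints. -/
noncomputable def extendedDiff (L : TangentBundle (𝓡 n) Q → ℝ) (t₁ t₂ : ℝ) (γ : ℝ → Q)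
    (β : Fin m → ℝ → E n × E n →L[ℝ] ℝ) (ν : Fin m → ℝ → ℝ) (t : ℝ) : E n × E n →L[ℝ] ℝ :=
  diffL L (dot (n := n) t₁ t₂ γ t) + ∑ j, ν j t • β j t

theorem extendedDiff_apply (ν : Fin m → ℝ → ℝ) (t : ℝ) (ξ : E n × E n) :
    extendedDiff L t₁ t₂ γ β ν t ξ =
      diffL L (dot (n := n) t₁ t₂ γ t) ξ + ∑ j, ν j t * β j t ξ := by
  rw [extendedDiff, add_apply, sum_apply]
  rfl

/-- In an adapted frame this is `forall_integral_eq_zero_iff_exists_multiplier`, where A and B are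
the contractions of dL with s(ė) and vl(e). The multipliers ν refer to the coframe β, so no choice
of constraints enters. -/
theorem isCritical_iff_exists_multipliers (ht : t₁ < t₂) (hm : m < n)
    (hL : ContMDiff (𝓡 n).tangent 𝓘(ℝ, ℝ) 2 L) (hC : IsSubmanifoldOfCodim m C)
    (hsub : ProjectionIsSubmersion C) (hγ : ContMDiffOn 𝓘(ℝ, ℝ) (𝓡 n) 2 γ (Icc t₁ t₂))
    (hdC : ∀ t ∈ Icc t₁ t₂, dot (n := n) t₁ t₂ γ t ∈ C) (hab : IsAdaptedFrame C t₁ t₂ γ a b)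
    (hβ : IsConstraintCoframe C t₁ t₂ γ a b β) :
    IsCritical L C t₁ t₂ γ ↔ ∃ ν : Fin m → ℝ → ℝ, (∀ j, ContDiffOn ℝ 1 (ν j) (Icc t₁ t₂)) ∧
      ∀ t ∈ Icc t₁ t₂, ∀ w : ∀ t : ℝ, TangentSpace (𝓡 n) (γ t), IsFieldAlong t₁ t₂ γ w →
        HasDerivWithinAt (fun τ => extendedDiff L t₁ t₂ γ β ν τ (0, vec (n := n) (w τ)))
          (extendedDiff L t₁ t₂ γ β ν t (vec (n := n) (w t), fieldDeriv t₁ t₂ γ w t))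
          (Icc t₁ t₂) t := by
  classical
  have hγ1 := hγ.of_le one_le_two
  have hL1 : ∀ v, ContMDiffAt (𝓡 n).tangent 𝓘(ℝ, ℝ) 1 L v := fun v => (hL v).of_le one_le_two
  have huniv : timesIn t₁ t₂ γ (univ : Set (TangentBundle (𝓡 n) Q)) = Icc t₁ t₂ :=
    timesIn_eq_Icc fun _ _ => mem_univ _
  let A : (∀ t : ℝ, TangentSpace (𝓡 n) (γ t)) → ℝ → ℝ := fun e t =>
    diffL L (dot (n := n) t₁ t₂ γ t) (vec (n := n) (e t), fieldDeriv t₁ t₂ γ e t)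
  let B : (∀ t : ℝ, TangentSpace (𝓡 n) (γ t)) → ℝ → ℝ := fun e t =>
    diffL L (dot (n := n) t₁ t₂ γ t) (0, vec (n := n) (e t))
  have hA : ∀ e, IsFieldAlong t₁ t₂ γ e → ContinuousOn (A e) (Icc t₁ t₂) := by
    intro e he
    rw [← huniv]
    exact continuousOn_diffL ht hγ he isOpen_univ fun v _ => (hL1 v).contMDiffWithinAt
  have hB : ∀ e, IsFieldAlong t₁ t₂ γ e → ContDiffOn ℝ 1 (B e) (Icc t₁ t₂) := by
    intro e he
    rw [← huniv]
    exact (contDiffOn_fibreDerivative ht hγ he isOpen_univ hL.contMDiffOn).congr fun t _ =>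
      (fibreDerivative_eq_diffL (hL1 _) _).symm
  have main := forall_integral_eq_zero_iff_exists_multiplier ht
    (fun j i t => β j t (vec (n := n) (a i t), fieldDeriv t₁ t₂ γ (a i) t))
    (fun j l t => β j t (vec (n := n) (b l t), fieldDeriv t₁ t₂ γ (b l) t))
    (fun j i => hβ.continuousOn ht hm hC hsub hγ hdC hab (hab.isFieldAlong_left i) j)
    (fun j l => hβ.continuousOn ht hm hC hsub hγ hdC hab (hab.isFieldAlong_right l) j)
    (fun i => A (a i)) (fun i => B (a i)) (fun l => A (b l)) (fun l => B (b l))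
    (fun i => hA _ (hab.isFieldAlong_left i)) (fun l => hA _ (hab.isFieldAlong_right l))
    (fun i => hB _ (hab.isFieldAlong_left i)) (fun l => hB _ (hab.isFieldAlong_right l))
  have hint : ∀ (kap : Fin m → ℝ → ℝ) (lam : Fin (n - m) → ℝ → ℝ),
      (∀ j, ContDiffOn ℝ 1 (kap j) (Icc t₁ t₂)) → (∀ l, ContDiffOn ℝ 1 (lam l) (Icc t₁ t₂)) →
      ∀ w : ∀ t : ℝ, TangentSpace (𝓡 n) (γ t),
      (∀ t ∈ Icc t₁ t₂, w t = ∑ j, kap j t • a j t + ∑ l, lam l t • b l t) →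
      ∫ t in t₁..t₂, diffL L (dot (n := n) t₁ t₂ γ t)
          (vec (n := n) (w t), fieldDeriv t₁ t₂ γ w t) =
        ∫ t in t₁..t₂, (∑ i, (kap i t * A (a i) t +
          derivWithin (kap i) (Icc t₁ t₂) t * B (a i) t) +
        ∑ l, (lam l t * A (b l) t + derivWithin (lam l) (Icc t₁ t₂) t * B (b l) t)) := by
    intro kap lam hkap hlam w hw
    refine intervalIntegral.integral_congr fun t h => ?_
    rw [uIcc_of_le ht.le] at h
    have hx : ∀ k, ContDiffOn ℝ 1
        ((Sum.elim kap lam : Fin m ⊕ Fin (n - m) → ℝ → ℝ) k) (Icc t₁ t₂) := by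
      rintro (j | l)
      exacts [hkap j, hlam l]
    have h1 := apply_fieldDeriv_sum (w := w) ht h hγ1 hab.isFieldAlong hx (fun t h => by
      rw [Fintype.sum_sum_type]
      exact hw t h) (diffL L (dot (n := n) t₁ t₂ γ t))
    rw [Fintype.sum_sum_type] at h1
    exact h1
  rw [isCritical_iff ht hL hγ]
  refine (Iff.trans ⟨fun H kap lam hkap hlam hkap0 hlam0 hode => ?_, fun H w hw => ?_⟩ main).trans
    ?_
  · rw [← hint kap lam hkap hlam _ fun t _ => rfl]
    exact H _ ((isAdmissibleField_iff ht hm hγ1 hab hβ hkap hlam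
      (isFieldAlong_of_eq_sum ht hγ1 hab hkap hlam) fun t _ => rfl).2 ⟨⟨hkap0, hlam0⟩, hode⟩)
  · obtain ⟨x, hx, hwx⟩ := exists_coefficients hγ1 hab.isFieldAlong
      (fun t h => hab.frameMap_isInvertible hm h) hw.isFieldAlong
    have hwx' : ∀ t ∈ Icc t₁ t₂, w t = ∑ j, x (Sum.inl j) t • a j t +
        ∑ l, x (Sum.inr l) t • b l t := by
      intro t h
      rw [hwx t h, Fintype.sum_sum_type]
      rfl
    have h1 := (isAdmissibleField_iff ht hm hγ1 hab hβ (fun j => hx (Sum.inl j))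
      (fun l => hx (Sum.inr l)) hw.isFieldAlong hwx').1 hw
    rw [hint _ _ (fun j => hx (Sum.inl j)) (fun l => hx (Sum.inr l)) w hwx']
    exact H _ _ (fun j => hx (Sum.inl j)) (fun l => hx (Sum.inr l)) h1.1.1 h1.1.2 h1.2
  · refine exists_congr fun ν => and_congr_right fun _ => ?_
    -- By duality the momentum in direction a_i is shifted by exactly ν_i, and in direction b_l it
    -- is not changed; these are the left-hand sides of the two families of equations of the linear
    -- problem.
    have ha : ∀ i, ∀ t ∈ Icc t₁ t₂,
        extendedDiff L t₁ t₂ γ β ν t (0, vec (n := n) (a i t)) = B (a i) t + ν i t := by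
      intro i t h
      rw [extendedDiff_apply]
      simp only [hβ.left _ _ t h]
      simp [B]
    have hb : ∀ l, ∀ t ∈ Icc t₁ t₂,
        extendedDiff L t₁ t₂ γ β ν t (0, vec (n := n) (b l t)) = B (b l) t := by
      intro l t h
      rw [extendedDiff_apply]
      simp only [hβ.right _ _ t h]
      simp [B]
    have hframe : ∀ t ∈ Icc t₁ t₂, _ := fun t h => forall_field_hasDerivWithinAt_iff ht h hγ1
      hab.isFieldAlong (fun t h => hab.frameMap_isInvertible hm h) (extendedDiff L t₁ t₂ γ β ν)
    constructor
    · rintro ⟨h1, h2⟩ t h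
      refine (hframe t h).2 ?_
      rintro (i | l)
      · rw [extendedDiff_apply]
        exact (h1 i t h).congr (fun τ hτ => ha i τ hτ) (ha i t h)
      · rw [extendedDiff_apply]
        exact (h2 l t h).congr (fun τ hτ => hb l τ hτ) (hb l t h)
    · intro H
      refine ⟨fun i t h => ?_, fun l t h => ?_⟩
      · have h1 := (hframe t h).1 (H t h) (Sum.inl i)
        rw [extendedDiff_apply] at h1
        exact h1.congr (fun τ hτ => (ha i τ hτ).symm) (ha i t h).symm
      · have h1 := (hframe t h).1 (H t h) (Sum.inr l)
        rw [extendedDiff_apply] at h1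
        exact h1.congr (fun τ hτ => (hb l τ hτ).symm) (hb l t h).symm

/-- The Euler-Lagrange equations of the extended Lagrangian, when the multipliers give the same
combination of the differentials of the constraints. -/
theorem isEulerLagrange_iff (ht : t₁ < t₂) (hL : ContMDiff (𝓡 n).tangent 𝓘(ℝ, ℝ) 2 L)
    (hγ : ContMDiffOn 𝓘(ℝ, ℝ) (𝓡 n) 2 γ (Icc t₁ t₂)) {U : Set (TangentBundle (𝓡 n) Q)}
    {φ : Fin m → TangentBundle (𝓡 n) Q → ℝ} (hφ : IsConstraintSystem C U φ)
    {μ ν : Fin m → ℝ → ℝ}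
    (hμν : ∀ t ∈ timesIn t₁ t₂ γ U,
      ∑ i, μ i t • diffL (φ i) (dot (n := n) t₁ t₂ γ t) = ∑ j, ν j t • β j t) :
    IsEulerLagrange (extendedLagrangian L φ μ) t₁ t₂ γ (timesIn t₁ t₂ γ U) (fun _ => 0) ↔
      ∀ t ∈ timesIn t₁ t₂ γ U, ∀ w : ∀ t : ℝ, TangentSpace (𝓡 n) (γ t), IsFieldAlong t₁ t₂ γ w →
        HasDerivWithinAt (fun τ => extendedDiff L t₁ t₂ γ β ν τ (0, vec (n := n) (w τ)))
          (extendedDiff L t₁ t₂ γ β ν t (vec (n := n) (w t), fieldDeriv t₁ t₂ γ w t))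
          (Icc t₁ t₂) t := by
  have hγ1 := hγ.of_le one_le_two
  have hL1 : ∀ v, ContMDiffAt (𝓡 n).tangent 𝓘(ℝ, ℝ) 1 L v := fun v => (hL v).of_le one_le_two
  have hd : ∀ t ∈ timesIn t₁ t₂ γ U, ContMDiffAt (𝓡 n).tangent 𝓘(ℝ, ℝ) 1
      (extendedLagrangian L φ μ t) (dot (n := n) t₁ t₂ γ t) ∧
      diffL (extendedLagrangian L φ μ t) (dot (n := n) t₁ t₂ γ t) =
        extendedDiff L t₁ t₂ γ β ν t := by
    intro t h
    have h1 := diffL_extendedLagrangian μ t (hL1 (dot (n := n) t₁ t₂ γ t))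
      fun i => hφ.contMDiffAt i h.2
    refine ⟨h1.1, h1.2.trans ?_⟩
    rw [hμν t h, extendedDiff]
  have key : ∀ w : ∀ t : ℝ, TangentSpace (𝓡 n) (γ t), IsFieldAlong t₁ t₂ γ w →
      ∀ t ∈ timesIn t₁ t₂ γ U,
      (HasDerivWithinAt (fun τ => fibreDerivative (extendedLagrangian L φ μ τ)
          (dot (n := n) t₁ t₂ γ τ) (w τ))
        (differential (extendedLagrangian L φ μ t) (involutionDot t₁ t₂ γ w t) -
          (0 : TangentSpace (𝓡 n) (γ t) →L[ℝ] ℝ) (w t)) (Icc t₁ t₂) t ↔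
      HasDerivWithinAt (fun τ => extendedDiff L t₁ t₂ γ β ν τ (0, vec (n := n) (w τ)))
          (extendedDiff L t₁ t₂ γ β ν t (vec (n := n) (w t), fieldDeriv t₁ t₂ γ w t))
          (Icc t₁ t₂) t) := by
    intro w hw t h
    have h1 : differential (extendedLagrangian L φ μ t) (involutionDot t₁ t₂ γ w t) -
        (0 : TangentSpace (𝓡 n) (γ t) →L[ℝ] ℝ) (w t) =
        extendedDiff L t₁ t₂ γ β ν t (vec (n := n) (w t), fieldDeriv t₁ t₂ γ w t) := by
      have h3 : (0 : TangentSpace (𝓡 n) (γ t) →L[ℝ] ℝ) (w t) = 0 := rfl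
      rw [involutionDot_eq ht h.1 hγ1 hw, h3, sub_zero]
      exact DFunLike.congr_fun (hd t h).2 _
    have h2 : ∀ τ ∈ timesIn t₁ t₂ γ U,
        fibreDerivative (extendedLagrangian L φ μ τ) (dot (n := n) t₁ t₂ γ τ) (w τ) =
          extendedDiff L t₁ t₂ γ β ν τ (0, vec (n := n) (w τ)) := by
      intro τ hτ
      refine (fibreDerivative_eq_diffL (hd τ hτ).1 _).trans ?_
      rw [(hd τ hτ).2]
      rfl
    rw [h1]
    exact Filter.EventuallyEq.hasDerivWithinAt_iff
      (Filter.eventuallyEq_of_mem (timesIn_mem_nhdsWithin ht hγ hφ.isOpen h) h2) (h2 t h)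
  exact ⟨fun H t h w hw => (key w hw t h).1 (H w hw t h),
    fun H w hw t h => (key w hw t h).2 (H t h w hw)⟩

/-- The critical paths in terms of local systems of constraints. -/
theorem isCritical_iff_exists_local_multipliers (ht : t₁ < t₂) (hm : m < n)
    (hL : ContMDiff (𝓡 n).tangent 𝓘(ℝ, ℝ) 2 L) (hC : IsSubmanifoldOfCodim m C)
    (hsub : ProjectionIsSubmersion C) (hγ : ContMDiffOn 𝓘(ℝ, ℝ) (𝓡 n) 2 γ (Icc t₁ t₂))
    (hdC : ∀ t ∈ Icc t₁ t₂, dot (n := n) t₁ t₂ γ t ∈ C) {ι : Type*}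
    {U : ι → Set (TangentBundle (𝓡 n) Q)} {φ : ι → Fin m → TangentBundle (𝓡 n) Q → ℝ}
    (hφ : ∀ c, IsConstraintSystem C (U c) (φ c))
    (hcov : ∀ t ∈ Icc t₁ t₂, ∃ c, dot (n := n) t₁ t₂ γ t ∈ U c) :
    IsCritical L C t₁ t₂ γ ↔
      ∃ μ : ι → Fin m → ℝ → ℝ,
        (∀ c i, ContDiffOn ℝ 1 (μ c i) (timesIn t₁ t₂ γ (U c))) ∧
        (∀ c c', ∀ t ∈ timesIn t₁ t₂ γ (U c) ∩ timesIn t₁ t₂ γ (U c'),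
          ∑ i, μ c i t • differentialAt (φ c i) (dot t₁ t₂ γ t) =
            ∑ i, μ c' i t • differentialAt (φ c' i) (dot t₁ t₂ γ t)) ∧
        (∀ c, IsEulerLagrange (extendedLagrangian L (φ c) (μ c)) t₁ t₂ γ
          (timesIn t₁ t₂ γ (U c)) (fun _ => 0)) := by
  obtain ⟨a, b, hab⟩ := exists_adapted_frame ht hm hC hsub hγ hdC
  obtain ⟨β, hβ⟩ := exists_constraintCoframe hm hC hsub hdC hab
  rw [isCritical_iff_exists_multipliers ht hm hL hC hsub hγ hdC hab hβ]
  constructor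
  · rintro ⟨ν, hν, H⟩
    -- The coefficients of ∑ ν_j β^j in terms of the dφ_c^i. All systems represent the same
    -- covector, so the compatibility condition is automatic.
    let μ : ι → Fin m → ℝ → ℝ := fun c i t =>
      ∑ j, ν j t * (constraintMatrix (φ c) t₁ t₂ a t)⁻¹ j i
    have hμ : ∀ c, ∀ t ∈ timesIn t₁ t₂ γ (U c),
        ∑ i, μ c i t • diffL (φ c i) (dot (n := n) t₁ t₂ γ t) = ∑ j, ν j t • β j t := by
      intro c t h
      simp only [hβ.eq_sum _ _ (hφ c) t h, dualConstraint, Finset.smul_sum, smul_smul]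
      rw [Finset.sum_comm]
      simp only [← Finset.sum_smul]
      rfl
    refine ⟨μ, fun c i => ?_, fun c c' t h => ?_, fun c => ?_⟩
    · exact ContDiffOn.sum fun j _ => ((hν j).mono fun t h => h.1).mul
        (contDiffOn_constraintMatrix_inv ht hm hsub hγ hdC (hφ c) hab j i)
    · exact (hμ c t h.1).trans (hμ c' t h.2).symm
    · exact (isEulerLagrange_iff ht hL hγ (hφ c) (hμ c)).2 fun t h => H t h.1
  · rintro ⟨μ, hμ, hcomp, H⟩
    have : Nonempty ι := (hcov t₁ (left_mem_Icc.2 ht.le)).nonempty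
    choose! c hc using hcov
    -- The value of ∑ μ_i dφ^i on vl(a_j). The index c t is chosen without continuity, but
    -- compatibility allows it to be replaced by a fixed one near each time, which gives the C¹
    -- regularity.
    let ν : Fin m → ℝ → ℝ := fun j t => ∑ i, μ (c t) i t *
      diffL (φ (c t) i) (dot (n := n) t₁ t₂ γ t) (0, vec (n := n) (a j t))
    have hν : ∀ d, ∀ t ∈ timesIn t₁ t₂ γ (U d), ∀ j, ν j t = ∑ i, μ d i t *
        diffL (φ d i) (dot (n := n) t₁ t₂ γ t) (0, vec (n := n) (a j t)) := by
      intro d t h j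
      have h1 : ∑ i, μ (c t) i t • diffL (φ (c t) i) (dot (n := n) t₁ t₂ γ t) =
          ∑ i, μ d i t • diffL (φ d i) (dot (n := n) t₁ t₂ γ t) :=
        hcomp (c t) d t ⟨⟨h.1, hc t h.1⟩, h⟩
      have h2 := DFunLike.congr_fun h1 ((0 : E n), vec (n := n) (a j t))
      rw [sum_apply, sum_apply] at h2
      exact h2
    have hsum : ∀ d, ∀ t ∈ timesIn t₁ t₂ γ (U d),
        ∑ i, μ d i t • diffL (φ d i) (dot (n := n) t₁ t₂ γ t) = ∑ j, ν j t • β j t := by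
      intro d t h
      simp only [hν d t h, Finset.sum_smul, mul_smul]
      rw [Finset.sum_comm]
      refine Finset.sum_congr rfl fun i _ => ?_
      rw [← Finset.smul_sum, ← hβ.diffL_eq _ _ (hφ d) t h i]
    refine ⟨ν, fun j t h => ?_, fun t h => ?_⟩
    · have h1 : t ∈ timesIn t₁ t₂ γ (U (c t)) := ⟨h, hc t h⟩
      have h2 : ContDiffOn ℝ 1 (ν j) (timesIn t₁ t₂ γ (U (c t))) := by
        refine ContDiffOn.congr (ContDiffOn.sum (s := Finset.univ) fun i _ => (hμ (c t) i).mul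
          (contDiffOn_fibreDerivative ht hγ (hab.isFieldAlong_left j) (hφ (c t)).isOpen
            ((hφ (c t)).contMDiffOn i))) fun s hs => ?_
        rw [hν (c t) s hs]
        refine Finset.sum_congr rfl fun i _ => ?_
        exact congrArg (μ (c t) i s * ·)
          (fibreDerivative_eq_diffL ((hφ (c t)).contMDiffAt i hs.2) _).symm
      exact (h2 t h1).mono_of_mem_nhdsWithin
        (timesIn_mem_nhdsWithin ht hγ (hφ (c t)).isOpen h1)
    · exact (isEulerLagrange_iff ht hL hγ (hφ (c t)) (hsum (c t))).1 (H (c t)) t ⟨h, hc t h⟩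

end Multipliers

end Vakonomic

theorem mainTheorem1 {n m : ℕ} (hm : m < n)
    {Q : Type*} [TopologicalSpace Q] [T2Space Q] [SecondCountableTopology Q]
    [ChartedSpace (Vakonomic.E n) Q] [IsManifold (𝓡 n) ∞ Q]
    (L : TangentBundle (𝓡 n) Q → ℝ) (hL : ContMDiff (𝓡 n).tangent 𝓘(ℝ, ℝ) 2 L)
    (C : Set (TangentBundle (𝓡 n) Q)) (hC : Vakonomic.IsSubmanifoldOfCodim m C)
    (hsub : Vakonomic.ProjectionIsSubmersion C)
    (t₁ t₂ : ℝ) (ht : t₁ < t₂) (q₁ q₂ : Q)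
    (γ : ℝ → Q) (hγ : Vakonomic.IsAdmissiblePath C t₁ t₂ q₁ q₂ γ) :
    -- the constraints `φⁱ` define `C` in a neighbourhood of `γ̇(I)`
    (∀ (U : Set (TangentBundle (𝓡 n) Q)) (φ : Fin m → TangentBundle (𝓡 n) Q → ℝ),
      Vakonomic.IsConstraintSystem C U φ →
      (∀ t ∈ Icc t₁ t₂, Vakonomic.dot t₁ t₂ γ t ∈ U) →
      (Vakonomic.IsCritical L C t₁ t₂ γ ↔
        ∃ μ : Fin m → ℝ → ℝ, (∀ i, ContDiffOn ℝ 1 (μ i) (Icc t₁ t₂)) ∧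
          Vakonomic.IsEulerLagrange (Vakonomic.extendedLagrangian L φ μ) t₁ t₂ γ
            (Icc t₁ t₂) (fun _ => 0))) ∧
    -- a family of local systems of constraints whose domains cover `γ̇(I)`
    (∀ (ι : Type*) (U : ι → Set (TangentBundle (𝓡 n) Q))
      (φ : ι → Fin m → TangentBundle (𝓡 n) Q → ℝ),
      (∀ c, Vakonomic.IsConstraintSystem C (U c) (φ c)) →
      (∀ t ∈ Icc t₁ t₂, ∃ c, Vakonomic.dot t₁ t₂ γ t ∈ U c) →
      (Vakonomic.IsCritical L C t₁ t₂ γ ↔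
        ∃ μ : ι → Fin m → ℝ → ℝ,
          (∀ c i, ContDiffOn ℝ 1 (μ c i) (Vakonomic.timesIn t₁ t₂ γ (U c))) ∧
          (∀ c c', ∀ t ∈ Vakonomic.timesIn t₁ t₂ γ (U c) ∩ Vakonomic.timesIn t₁ t₂ γ (U c'),
            ∑ i, μ c i t • Vakonomic.differentialAt (φ c i) (Vakonomic.dot t₁ t₂ γ t) =
              ∑ i, μ c' i t • Vakonomic.differentialAt (φ c' i) (Vakonomic.dot t₁ t₂ γ t)) ∧
          (∀ c, Vakonomic.IsEulerLagrange (Vakonomic.extendedLagrangian L (φ c) (μ c)) t₁ t₂ γ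
            (Vakonomic.timesIn t₁ t₂ γ (U c)) (fun _ => 0)))) ∧
    -- existence of admissible variation fields
    (∃ (a : Fin m → ∀ t : ℝ, TangentSpace (𝓡 n) (γ t))
        (b : Fin (n - m) → ∀ t : ℝ, TangentSpace (𝓡 n) (γ t)),
      Vakonomic.IsAdaptedFrame C t₁ t₂ γ a b) ∧
    (∀ (a : Fin m → ∀ t : ℝ, TangentSpace (𝓡 n) (γ t))
        (b : Fin (n - m) → ∀ t : ℝ, TangentSpace (𝓡 n) (γ t)),
      Vakonomic.IsAdaptedFrame C t₁ t₂ γ a b →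
      ∃ K : Fin m → Fin (n - m) → ℝ → ℝ, (∀ j l, ContinuousOn (K j l) (Icc t₁ t₂)) ∧
        ∀ lam : Fin (n - m) → ℝ → ℝ, (∀ l, ContDiffOn ℝ 1 (lam l) (Icc t₁ t₂)) →
          (∀ l, lam l t₁ = 0 ∧ lam l t₂ = 0) →
          ((∃ kap : Fin m → ℝ → ℝ, (∀ j, ContDiffOn ℝ 1 (kap j) (Icc t₁ t₂)) ∧
              Vakonomic.IsAdmissibleField C t₁ t₂ γ
                (fun t => ∑ j, kap j t • a j t + ∑ l, lam l t • b l t)) ↔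
            ∀ j, ∫ t in t₁..t₂, ∑ l, K j l t * lam l t = 0)) := by
  have hγ2 := hγ.contMDiffOn
  refine ⟨fun U φ hφ hU => ?_, fun ι U φ hφ hcov =>
    Vakonomic.isCritical_iff_exists_local_multipliers ht hm hL hC hsub hγ2 hγ.dot_mem hφ hcov,
    Vakonomic.exists_adapted_frame ht hm hC hsub hγ2 hγ.dot_mem, fun a b hab =>
    Vakonomic.exists_admissible_iff ht hm hC hsub hγ2 hγ.dot_mem hab⟩
  -- A covering by a single system, indexed by `Unit`: the compatibility condition is trivial and
  -- the times in U are all of I.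
  rw [Vakonomic.isCritical_iff_exists_local_multipliers ht hm hL hC hsub hγ2 hγ.dot_mem
    (ι := Unit) (U := fun _ => U) (φ := fun _ => φ) (fun _ => hφ) fun t h => ⟨(), hU t h⟩,
    Vakonomic.timesIn_eq_Icc hU]
  exact ⟨fun ⟨μ, h1, _, h2⟩ => ⟨μ (), h1 (), h2 ()⟩,
    fun ⟨μ, h1, h2⟩ => ⟨fun _ => μ, fun _ => h1, fun _ _ _ _ => rfl, fun _ => h2⟩⟩
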